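/- Let $R_0$ be an equicharacteristic regular local ring of dimension $d\ge 3$ with field of fractions $K$ and a fixed regular system of parameters $x_{0,1},\dots,x_{0,d}$, and let $$R_0\subset R_1\subset\cdots\subset R_n\qquad(n\ge 3)$$ be a sequence of local monomial quadratic transformations: for $0\le i<n$ there is a direction $j=j_i\in\{1,\dots,d\}$ such that $R_{i+1}$ is the localization of $R_i[\mathfrak m_i/x_{i,j}]\subset K$ at the prime ideal generated by $x_{i+1,j}:=x_{i,j}$ and $x_{i+1,l}:=x_{i,l}/x_{i,j}$ $(l\ne j)$; here $\mathfrak m_i=(x_{i,1},\dots,x_{i,d})$ is the maximal ideal of $R_i$. An ideal of $R_i$ is *monomial* if it is generated by monomials in $x_{i,1},\dots,x_{i,d}$; $\Delta(I)$ denotes the set of monomial minimal generators of a monomial ideal $I$, $\mu(I)$ its minimal number of generators, $\overline I$ its integral closure, and $I$ is *complete* if $I=\overline I$. The order $\mathrm{ord}_{R_i}(I)$ is the largest $r$ with $I\subseteq\mathfrak m_i^r$; also $\mathrm{ord}_{R_i}$ denotes the valuation of $K$ given by the orders of principal ideals. The Rees valuation rings of a nonzero ideal $I$ of $R_0$ are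 the localizations of the rings $\overline{R_0[I/a]}$ ($0\neq a\in I$, integral closure in $K$) at their height one primes containing $I$; a valuation is a Rees valuation of $I$ if its valuation ring is one of these. There is a *change of direction* from $R_i$ to $R_k$ ($i\le k$) if $\mathfrak m_i\subseteq\mathfrak m_k^2$. For an $\mathfrak m_{i+1}$-primary monomial ideal $I'$ of $R_{i+1}$, with $j=j_i$, let $\delta=\max\{\sum_{l\ne j}a_l-a_j\}$ over all $\prod_l x_{i+1,l}^{a_l}\in\Delta(I')$. The *complete inverse transform* of $I'$ in $R_i$ is the integral closure of the ideal of $R_i$ generated by all $x_{i,j}^{\delta}\alpha$, $\alpha\in\Delta(I')$, and all $x_{i,l}^{\delta}$, $l\ne j$. Let $I_n$ be a complete $\mathfrak m_n$-primary monomial ideal of $R_n$, and for $0\le i<n$ let $I_i$ be the complete inverse transform of $I_{i+1}$ in $R_i$. (a) If $n=3$, the following are equivalent: 1. there is a change of direction from $R_0$ to $R_2$ and a change of direction from $R_1$ to $R_3$; 2. $\mu(I_0)>\mu(I_1)>\mu(I_2)$; 3. $\mathrm{ord}_{R_0}(I_0)=\mathrm{ord}_{R_1}(I_1)+\mathrm{ord}_{R_2}(I_2)$;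 4. $\mathrm{ord}_{R_0}$ and $\mathrm{ord}_{R_1}$ are both Rees valuations of $I_0$. (b) For every $n\ge 3$, the following are equivalent: 1. there is a change of direction from $R_i$ to $R_{i+2}$ for each $0\le i\le n-2$; 2. $\mu(I_0)>\mu(I_1)>\cdots>\mu(I_{n-1})$; 3. $\mathrm{ord}_{R_i}(I_i)=\mathrm{ord}_{R_{i+1}}(I_{i+1})+\mathrm{ord}_{R_{i+2}}(I_{i+2})$ for each $0\le i\le n-3$; 4. $\mathrm{ord}_{R_i}$ is a Rees valuation of $I_0$ for each $0\le i\le n-2$. -/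

import Mathlib

open IsLocalRing

/-! ### Ideals: integral closure, order, monomials -/

section Ideals

variable {A : Type*} [CommRing A]

/-- `a` is integral over the ideal `I`: it satisfies an equation
`a ^ n + r₁ a ^ (n - 1) + ⋯ + rₙ = 0` with `n ≥ 1` and `rᵢ ∈ I ^ i`. -/
def IsIntegralOverIdeal (I : Ideal A) (a : A) : Prop :=
  ∃ n : ℕ, 0 < n ∧ ∃ r : ℕ → A, (∀ i, r i ∈ I ^ i) ∧
    a ^ n + ∑ i ∈ Finset.Icc 1 n, r i * a ^ (n - i) = 0

theorem isIntegralOverIdeal_iff (I : Ideal A) (a : A) :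
    IsIntegralOverIdeal I a ↔ IsIntegral (reesAlgebra I) (Polynomial.monomial 1 a) := by
  classical
  constructor
  · rintro ⟨n, hn, r, hr, h⟩
    let c : ℕ → reesAlgebra I := fun i =>
      ⟨Polynomial.monomial i (r i), reesAlgebra.monomial_mem.2 (hr i)⟩
    let q : Polynomial (reesAlgebra I) :=
      ∑ i ∈ Finset.Icc 1 n, Polynomial.C (c i) * Polynomial.X ^ (n - i)
    refine ⟨Polynomial.X ^ n + q, ?_, ?_⟩
    · apply Polynomial.monic_X_pow_add
      refine Polynomial.mem_degreeLT.1 (Submodule.sum_mem _ fun i hi => Polynomial.mem_degreeLT.2 ?_)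
      rw [Finset.mem_Icc] at hi
      refine lt_of_le_of_lt (Polynomial.degree_C_mul_X_pow_le _ _) ?_
      exact_mod_cast (by omega : n - i < n)
    · have key : Polynomial.monomial n
          (a ^ n + ∑ i ∈ Finset.Icc 1 n, r i * a ^ (n - i)) = 0 := by
        rw [h, Polynomial.monomial_zero_right]
      rw [map_add, map_sum] at key
      rw [Polynomial.eval₂_add, Polynomial.eval₂_finsetSum, Polynomial.eval₂_pow,
        Polynomial.eval₂_X, Polynomial.monomial_pow, one_mul, ← key]
      congr 1
      refine Finset.sum_congr rfl fun i hi => ?_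
      rw [Finset.mem_Icc] at hi
      rw [Polynomial.eval₂_mul, Polynomial.eval₂_C, Polynomial.eval₂_pow, Polynomial.eval₂_X,
        Polynomial.monomial_pow, one_mul]
      change Polynomial.monomial i (r i) * _ = _
      rw [Polynomial.monomial_mul_monomial, Nat.add_sub_cancel' hi.2]
  · rintro ⟨p, hp, h⟩
    have hp' : (p * Polynomial.X).Monic := hp.mul Polynomial.monic_X
    have h' : Polynomial.eval₂ (algebraMap (reesAlgebra I) (Polynomial A))
        (Polynomial.monomial 1 a) (p * Polynomial.X) = 0 := by
      rw [Polynomial.eval₂_mul, h, zero_mul]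
    rcases subsingleton_or_nontrivial A with hA | hA
    · exact ⟨1, one_pos, fun _ => 0, fun _ => zero_mem _, Subsingleton.elim _ _⟩
    set q := p * Polynomial.X with hq
    have hpos : 0 < q.natDegree := by
      rw [hq, hp.natDegree_mul Polynomial.monic_X, Polynomial.natDegree_X]
      omega
    refine ⟨q.natDegree, hpos, fun i => if i ≤ q.natDegree then
      ((q.coeff (q.natDegree - i) : reesAlgebra I) : Polynomial A).coeff i else 0, ?_, ?_⟩
    · intro i
      dsimp only
      split_ifs
      · exact (q.coeff (q.natDegree - i)).2 i
      · exact zero_mem _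
    · have h2 := congrArg (fun f => Polynomial.coeff f q.natDegree) h'
      simp only [Polynomial.eval₂_eq_sum_range, Polynomial.finsetSum_coeff,
        Polynomial.monomial_pow, one_mul, Polynomial.coeff_zero] at h2
      have hIcc : ∀ (g : ℕ → A) (n : ℕ),
          ∑ i ∈ Finset.Icc 1 n, g i = ∑ j ∈ Finset.range n, g (j + 1) := by
        intro g n
        rw [Finset.range_eq_Ico, Finset.sum_Ico_add' g 0 n 1]
        rfl
      refine Eq.trans ?_ h2
      rw [← Finset.sum_range_reflect, Finset.sum_range_succ', add_comm, hIcc]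
      congr 1
      · refine Finset.sum_congr rfl fun j hj => ?_
        rw [Finset.mem_range] at hj
        dsimp only
        rw [if_pos (by omega : j + 1 ≤ q.natDegree),
          show q.natDegree + 1 - 1 - (j + 1) = q.natDegree - (j + 1) by omega]
        change _ = (((q.coeff (q.natDegree - (j + 1)) : reesAlgebra I) : Polynomial A) *
          Polynomial.monomial (q.natDegree - (j + 1)) (a ^ (q.natDegree - (j + 1)))).coeff
            q.natDegree
        have e : q.natDegree = (j + 1) + (q.natDegree - (j + 1)) := by omega
        generalize q.natDegree - (j + 1) = m at e ⊢
        rw [e, Polynomial.coeff_mul_monomial]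
      · simp only [Nat.add_sub_cancel, Nat.sub_zero]
        rw [hp'.coeff_natDegree, map_one, one_mul, Polynomial.coeff_monomial_same]

/-- The integral closure (completion) of an ideal. -/
def idealClosure (I : Ideal A) : Ideal A where
  carrier := {a | IsIntegralOverIdeal I a}
  zero_mem' := by
    simp only [Set.mem_ofPred_eq, isIntegralOverIdeal_iff, map_zero]
    exact isIntegral_zero
  add_mem' := by
    intro a b ha hb
    simp only [Set.mem_ofPred_eq, isIntegralOverIdeal_iff, map_add] at *
    exact ha.add hb
  smul_mem' := by
    intro c a ha
    simp only [Set.mem_ofPred_eq, isIntegralOverIdeal_iff] at *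
    have : Polynomial.monomial 1 (c • a) = algebraMap A (Polynomial A) c * Polynomial.monomial 1 a := by
      rw [Polynomial.algebraMap_eq, Polynomial.C_mul_monomial, smul_eq_mul]
    rw [this]
    exact IsIntegral.mul (isIntegral_algebraMap (R := reesAlgebra I) (A := Polynomial A)
      (x := algebraMap A (reesAlgebra I) c)) ha

end Ideals

section LocalRings

variable {A : Type*} [CommRing A]

/-- The order of an ideal of a local ring: the largest `r` with `I ≤ 𝔪 ^ r` (and `⊤` if `I ≤ 𝔪 ^ r`
for every `r`, which for Noetherian local rings means `I = ⊥`). -/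
noncomputable def idealOrd [IsLocalRing A] (I : Ideal A) : ℕ∞ :=
  ⨆ (r : ℕ) (_ : I ≤ maximalIdeal A ^ r), (r : ℕ∞)

/-- A local ring is equicharacteristic if it has the same characteristic as its residue field. -/
def IsEquicharacteristic (A : Type*) [CommRing A] [IsLocalRing A] : Prop :=
  ringChar A = ringChar (ResidueField A)

/-- The monomial with exponent vector `α` in the elements `w`. -/
def monomialIn {d : ℕ} (w : Fin d → A) (α : Fin d → ℕ) : A :=
  ∏ l, w l ^ α l

/-- `I` is generated by monomials in the elements `w`. -/
def IsMonomialIdeal {d : ℕ} (w : Fin d → A) (I : Ideal A) : Prop :=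
  ∃ E : Set (Fin d → ℕ), I = Ideal.span (monomialIn w '' E)

/-- Exponent vectors of the monomial minimal generators of a monomial ideal `I`, that is, of the
monomials in `I` that are minimal with respect to divisibility of monomials. -/
def minimalMonomials {d : ℕ} (w : Fin d → A) (I : Ideal A) : Set (Fin d → ℕ) :=
  {α | Minimal (fun β => monomialIn w β ∈ I) α}

/-- The maximum of `-ν (α) = (∑_{l ≠ j} α l) - α j` over the monomial minimal generators `α` of `I`.
Here `ν` is the `x`-adic valuation of `R` for `x = x_j`, and the `w` are the parameters `x_j` and
`x_l / x_j` (`l ≠ j`) of the monomial transform of `R` in the `x_j`-direction, so that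
`ν (w j) = 1` and `ν (w l) = -1` for `l ≠ j`. -/
noncomputable def inverseTransformOrder {d : ℕ} (w : Fin d → A) (j : Fin d) (I : Ideal A) : ℤ :=
  sSup ((fun α : Fin d → ℕ => (∑ l ∈ Finset.univ.erase j, (α l : ℤ)) - (α j : ℤ)) ''
    minimalMonomials w I)

end LocalRings

/-! ### Birational extensions inside a field -/

section Birational

variable {K : Type*} [Field K]

/-- The subring `A[I / a]` of `K`. -/
def blowupSubring (A : Subring K) (I : Ideal A) (a : A) : Subring K :=
  Subring.closure ((A : Set K) ∪ {k | ∃ b ∈ I, k = (b : K) / (a : K)})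

/-- The pair `(B, v)` is the local monomial quadratic transform in the direction of `w j` of the
local ring `A` with parameters `w`: the new parameters are `v j = w j` and `v l = w l / w j` for
`l ≠ j`, and `B` is the localization of `A[𝔪 / w j]` at the prime ideal generated by the `v l`. -/
def IsMonomialTransform {d : ℕ} (A : LocalSubring K) (w : Fin d → A.toSubring) (j : Fin d)
    (B : LocalSubring K) (v : Fin d → B.toSubring) : Prop :=
  (∀ l, (v l : K) = if l = j then (w j : K) else (w l : K) / (w j : K)) ∧
  ∃ P : Ideal (blowupSubring A.toSubring (maximalIdeal A.toSubring) (w j)),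
    P = Ideal.span {f : blowupSubring _ _ _ | ∃ l, (f : K) = (v l : K)} ∧
    ∃ _ : P.IsPrime, B = LocalSubring.ofPrime _ P

/-- The complete inverse transform in `A` of a monomial ideal `I₁` of the local monomial quadratic
transform `(B, v)` of `(A, w)` in the direction of `x = w j`: the integral closure of the ideal
generated by the `x ^ δ * α`, for `α` a monomial minimal generator of `I₁`, and the `(w l) ^ δ`,
for `l ≠ j`. -/
noncomputable def completeInverseTransform {d : ℕ} (A : LocalSubring K)
    (w : Fin d → A.toSubring) (j : Fin d) (B : LocalSubring K) (v : Fin d → B.toSubring)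
    (I₁ : Ideal B.toSubring) : Ideal A.toSubring :=
  idealClosure (Ideal.span
    ({f : A.toSubring | ∃ α ∈ minimalMonomials v I₁,
        (f : K) = (w j : K) ^ inverseTransformOrder v j I₁ * ((monomialIn v α : B.toSubring) : K)} ∪
      {f : A.toSubring | ∃ l, l ≠ j ∧ (f : K) = (w l : K) ^ inverseTransformOrder v j I₁}))

/-- There is a change of direction between `A` and `B`: `𝔪_A ⊆ 𝔪_B ^ 2`. -/
def ChangeOfDirection (A B : LocalSubring K) : Prop :=
  ∀ f ∈ maximalIdeal A.toSubring, ∃ g ∈ maximalIdeal B.toSubring ^ 2, (g : K) = f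

/-- `V` is the order valuation ring of the regular local ring `A` with field of fractions `K`. -/
def IsOrderValuationRing (A : LocalSubring K) (V : Subring K) : Prop :=
  ∀ k : K, k ∈ V ↔ ∃ f g : A.toSubring, g ≠ 0 ∧
    idealOrd (Ideal.span {g}) ≤ idealOrd (Ideal.span {f}) ∧ k = (f : K) / (g : K)

/-- `V` is a Rees valuation ring of the ideal `I` of the domain `A` with field of fractions `K`:
the localization of the integral closure in `K` of `A[I / a]`, for some `0 ≠ a ∈ I`, at a height one
prime ideal containing `I`. -/
def IsReesValuationRing (A : Subring K) (I : Ideal A) (V : Subring K) : Prop :=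
  ∃ a ∈ I, a ≠ 0 ∧
    ∃ Q : Ideal (integralClosure (blowupSubring A I a) K).toSubring, ∃ _ : Q.IsPrime,
      Q.height = 1 ∧ (∀ b ∈ I, ∃ q ∈ Q, (q : K) = b) ∧ V = (LocalSubring.ofPrime _ Q).toSubring

/-- `ord_B` is a Rees valuation of the ideal `I` of `A`. -/
def OrdIsReesValuation (B : LocalSubring K) (A : LocalSubring K) (I : Ideal A.toSubring) : Prop :=
  ∃ V : Subring K, IsOrderValuationRing B V ∧ IsReesValuationRing A.toSubring I V

end Birational

/-! ### Quasi-regular systems of parameters -/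

open MvPolynomial in
/-- The elements `w` generate the maximal ideal and are quasi-regular: the associated graded ring is
the polynomial ring in the initial forms of the `w l` over the residue field. -/
structure IsQR {A : Type*} [CommRing A] [IsLocalRing A] {d : ℕ} (w : Fin d → A) : Prop where
  span_range : Ideal.span (Set.range w) = maximalIdeal A
  coeff_mem : ∀ (r : ℕ) (F : MvPolynomial (Fin d) A), F.IsHomogeneous r →
    eval w F ∈ maximalIdeal A ^ (r + 1) → ∀ a, coeff a F ∈ maximalIdeal A

section QuasiRegular

open MvPolynomial

variable {A : Type*} [CommRing A] [IsLocalRing A] {d : ℕ} {w : Fin d → A}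

theorem mem_maximalIdeal_pow_iff_exists_isHomogeneous
    (hw : Ideal.span (Set.range w) = maximalIdeal A) (r : ℕ) (f : A) :
    f ∈ maximalIdeal A ^ r ↔ ∃ F : MvPolynomial (Fin d) A, F.IsHomogeneous r ∧ eval w F = f := by
  rw [← hw, Ideal.mem_span_pow_iff_exists_isHomogeneous]

theorem eval_mem_maximalIdeal_pow (hw : Ideal.span (Set.range w) = maximalIdeal A) {r : ℕ}
    {F : MvPolynomial (Fin d) A} (hF : F.IsHomogeneous r) : eval w F ∈ maximalIdeal A ^ r :=
  (mem_maximalIdeal_pow_iff_exists_isHomogeneous hw r _).2 ⟨F, hF, rfl⟩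

theorem eval_mem_maximalIdeal_pow_succ (hw : Ideal.span (Set.range w) = maximalIdeal A) {r : ℕ}
    {F : MvPolynomial (Fin d) A} (hF : F.IsHomogeneous r)
    (hc : ∀ a, coeff a F ∈ maximalIdeal A) : eval w F ∈ maximalIdeal A ^ (r + 1) := by
  rw [F.as_sum, map_sum]
  refine Ideal.sum_mem _ fun a ha => ?_
  have h1 : monomial a (coeff a F) = C (coeff a F) * monomial a 1 := by
    rw [C_mul_monomial, mul_one]
  rw [h1, map_mul, eval_C, pow_succ', ]
  refine Ideal.mul_mem_mul (hc a) (eval_mem_maximalIdeal_pow hw (isHomogeneous_monomial _ ?_))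
  rw [← hF (mem_support_iff.1 ha), Finsupp.degree_eq_weight_one]
  rfl

theorem isHomogeneous_divMonomial_single {R : Type*} [CommRing R] {F : MvPolynomial (Fin d) R}
    {r : ℕ} (hF : F.IsHomogeneous (r + 1)) (j : Fin d) :
    (F.divMonomial (Finsupp.single j 1)).IsHomogeneous r := by
  intro a ha
  rw [coeff_divMonomial] at ha
  have := hF ha
  simp only [map_add, Finsupp.weight_single, Pi.one_apply, smul_eq_mul, mul_one] at this
  omega

theorem isHomogeneous_modMonomial {R : Type*} [CommRing R] {F : MvPolynomial (Fin d) R}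
    {r : ℕ} (hF : F.IsHomogeneous r) (j : Fin d) :
    (F.modMonomial (Finsupp.single j 1)).IsHomogeneous r := by
  intro a ha
  by_cases h : Finsupp.single j 1 ≤ a
  · rw [coeff_modMonomial_of_le _ h] at ha
    exact absurd rfl ha
  · rw [coeff_modMonomial_of_not_le _ h] at ha
    exact hF ha

theorem coeff_modMonomial_single_ne_zero {R : Type*} [CommRing R] {F : MvPolynomial (Fin d) R}
    {j : Fin d} {a : Fin d →₀ ℕ} (ha : coeff a (F.modMonomial (Finsupp.single j 1)) ≠ 0) :
    a j = 0 := by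
  by_contra h
  refine ha (coeff_modMonomial_of_le _ ?_)
  rw [Finsupp.single_le_iff]
  omega

theorem eval_eq_divMonomial_add_modMonomial {R : Type*} [CommRing R] (v : Fin d → R)
    (F : MvPolynomial (Fin d) R) (j : Fin d) :
    eval v F = v j * eval v (F.divMonomial (Finsupp.single j 1)) +
      eval v (F.modMonomial (Finsupp.single j 1)) := by
  conv_lhs => rw [← divMonomial_add_modMonomial_single F j]
  simp

/-- Quasi-regularity lifts from `A ⧸ (w j)` to `A` if `w j` is a nonzerodivisor. -/
theorem IsQR.of_quotient [IsNoetherianRing A]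
    (hw : Ideal.span (Set.range w) = maximalIdeal A) (j : Fin d)
    (hj : w j ∈ nonZeroDivisors A)
    (H : ∀ (r : ℕ) (F : MvPolynomial (Fin d) A), F.IsHomogeneous r →
      (∀ a, coeff a F ≠ 0 → a j = 0) →
      eval w F ∈ maximalIdeal A ^ (r + 1) ⊔ Ideal.span {w j} →
      ∀ a, coeff a F ∈ maximalIdeal A) : IsQR w := by
  have hwm : w j ∈ maximalIdeal A := hw ▸ Ideal.subset_span ⟨j, rfl⟩
  have cancel : ∀ {r : ℕ} {z : A}, w j * z ∈ maximalIdeal A ^ (r + 1) →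
      z ∈ maximalIdeal A ^ r := by
    intro r z hz
    have key : ∀ N, ∃ z' ∈ maximalIdeal A ^ r,
        w j * (z - z') ∈ maximalIdeal A ^ (r + 1 + N) := by
      intro N
      induction N with
      | zero => exact ⟨0, zero_mem _, by simpa using hz⟩
      | succ N ih =>
        obtain ⟨z', hz', h⟩ := ih
        obtain ⟨F, hF, hFe⟩ := (mem_maximalIdeal_pow_iff_exists_isHomogeneous hw _ _).1 h
        have hF' : F.IsHomogeneous (r + N + 1) := by convert hF using 1; omega
        rw [eval_eq_divMonomial_add_modMonomial w F j] at hFe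
        have hd := eval_mem_maximalIdeal_pow hw (isHomogeneous_divMonomial_single hF' j)
        refine ⟨z' + eval w (F.divMonomial (Finsupp.single j 1)), Ideal.add_mem _ hz'
          (Ideal.pow_le_pow_right (by omega) hd), ?_⟩
        have e : w j * (z - (z' + eval w (F.divMonomial (Finsupp.single j 1)))) =
            eval w (F.modMonomial (Finsupp.single j 1)) := by
          linear_combination -hFe
        rw [e]
        have hm := isHomogeneous_modMonomial hF j
        refine eval_mem_maximalIdeal_pow_succ hw hm
          (H _ _ hm (fun a => coeff_modMonomial_single_ne_zero) ?_)
        rw [← e]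
        exact Ideal.mem_sup_right (Ideal.mul_mem_right _ _ (Ideal.mem_span_singleton_self _))
    let I : Ideal A := Ideal.span {w j} * maximalIdeal A ^ r
    have hI : I ≠ ⊤ := fun h => (maximalIdeal.isMaximal A).ne_top
      (top_le_iff.1 (h ▸ Ideal.mul_le_left.trans ((Ideal.span_singleton_le_iff_mem _).2 hwm)))
    have : Nontrivial (A ⧸ I) := Ideal.Quotient.nontrivial_iff.2 hI
    have : IsLocalRing (A ⧸ I) :=
      IsLocalRing.of_surjective' (Ideal.Quotient.mk I) Ideal.Quotient.mk_surjective
    have hmap : Ideal.map (Ideal.Quotient.mk I) (maximalIdeal A) ≠ ⊤ := by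
      intro h
      have h2 := Ideal.comap_map_of_surjective _ (Ideal.Quotient.mk_surjective (I := I))
        (maximalIdeal A)
      rw [h, Ideal.comap_top, ← RingHom.ker_eq_comap_bot, Ideal.mk_ker] at h2
      exact (maximalIdeal.isMaximal A).ne_top
        (h2.trans (sup_eq_left.2 (le_maximalIdeal hI))).symm
    have hkr := Ideal.iInf_pow_eq_bot_of_isLocalRing _ hmap
    have h0 : Ideal.Quotient.mk I (w j * z) = 0 := by
      rw [← Ideal.mem_bot, ← hkr, Ideal.mem_iInf]
      intro N
      obtain ⟨z', hz', h⟩ := key N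
      have h3 : Ideal.Quotient.mk I (w j * z) = Ideal.Quotient.mk I (w j * (z - z')) := by
        rw [Ideal.Quotient.mk_eq_mk_iff_sub_mem]
        have : w j * z - w j * (z - z') = w j * z' := by ring
        rw [this]
        exact Ideal.mul_mem_mul (Ideal.mem_span_singleton_self _) hz'
      rw [h3, ← Ideal.map_pow]
      exact Ideal.mem_map_of_mem _ (Ideal.pow_le_pow_right (by omega) h)
    rw [Ideal.Quotient.eq_zero_iff_mem, Ideal.mem_span_singleton_mul] at h0
    obtain ⟨z', hz', h⟩ := h0
    have : z' = z := by
      rw [← sub_eq_zero]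
      exact (mem_nonZeroDivisors_iff.1 hj).1 _ (by rw [mul_sub, h, sub_self])
    exact this ▸ hz'
  refine ⟨hw, fun r => ?_⟩
  induction r with
  | zero =>
    intro F hF h a
    have h1 := isHomogeneous_modMonomial hF j
    have hd : F.divMonomial (Finsupp.single j 1) = 0 := by
      ext a
      rw [coeff_divMonomial, coeff_zero]
      by_contra hne
      have := hF hne
      simp [Finsupp.weight_single] at this
    have h2 : F.modMonomial (Finsupp.single j 1) = F := by
      conv_rhs => rw [← divMonomial_add_modMonomial_single F j, hd, mul_zero, zero_add]
    rw [← h2] at h ⊢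
    exact H _ _ h1 (fun a => coeff_modMonomial_single_ne_zero) (Ideal.mem_sup_left h) a
  | succ r ih =>
    intro F hF h a
    have h1 := isHomogeneous_modMonomial hF j
    have hd := isHomogeneous_divMonomial_single hF j
    have e := eval_eq_divMonomial_add_modMonomial w F j
    have hc := H _ _ h1 (fun a => coeff_modMonomial_single_ne_zero) (by
      have : eval w (F.modMonomial (Finsupp.single j 1)) = eval w F +
          w j * (-eval w (F.divMonomial (Finsupp.single j 1))) := by
        rw [e]; ring
      rw [this]
      exact Ideal.add_mem _ (Ideal.mem_sup_left h) (Ideal.mem_sup_right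
        (Ideal.mul_mem_right _ _ (Ideal.mem_span_singleton_self _))))
    have hdc := ih _ hd (cancel (r := r + 1) (by
      have : w j * eval w (F.divMonomial (Finsupp.single j 1)) = eval w F -
          eval w (F.modMonomial (Finsupp.single j 1)) := by
        rw [e]; ring
      rw [this]
      exact Ideal.sub_mem _ h (eval_mem_maximalIdeal_pow_succ hw h1 hc)))
    by_cases hle : Finsupp.single j 1 ≤ a
    · have := hdc (a - Finsupp.single j 1)
      rwa [coeff_divMonomial, add_tsub_cancel_of_le hle] at this
    · have := hc a
      rwa [coeff_modMonomial_of_not_le _ hle] at this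

end QuasiRegular

/-! ### Regular local rings -/

section Regular

open MvPolynomial

/-- The images of `w l`, `l ≠ i`, generate the maximal ideal of `A ⧸ (x)` if `w i` is redundant. -/
theorem span_range_succAbove_quotient {A : Type*} [CommRing A] [IsLocalRing A] {d : ℕ}
    {w : Fin (d + 1) → A} (hw : Ideal.span (Set.range w) = maximalIdeal A) {x : A}
    (hx : x ∈ maximalIdeal A) (i : Fin (d + 1))
    (hi : w i ∈ Ideal.span (insert x (Set.range fun l => w (i.succAbove l))))
    [IsLocalRing (A ⧸ Ideal.span {x})] :
    Ideal.span (Set.range fun l => Ideal.Quotient.mk (Ideal.span {x}) (w (i.succAbove l))) =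
      maximalIdeal (A ⧸ Ideal.span {x}) := by
  have hsur := Ideal.Quotient.mk_surjective (I := Ideal.span {x})
  have hmap : Ideal.map (Ideal.Quotient.mk (Ideal.span {x})) (maximalIdeal A) =
      maximalIdeal (A ⧸ Ideal.span {x}) := by
    have hc : Ideal.comap (Ideal.Quotient.mk (Ideal.span {x}))
        (maximalIdeal (A ⧸ Ideal.span {x})) = maximalIdeal A := by
      have := Ideal.comap_isMaximal_of_surjective _ hsur
        (K := maximalIdeal (A ⧸ Ideal.span {x}))
      exact eq_maximalIdeal this
    rw [← hc, Ideal.map_comap_of_surjective _ hsur]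
  have hspan : maximalIdeal A = Ideal.span (insert x (Set.range fun l => w (i.succAbove l))) := by
    apply le_antisymm
    · rw [← hw, Ideal.span_le]
      rintro _ ⟨l, rfl⟩
      rcases Fin.eq_self_or_eq_succAbove i l with rfl | ⟨l', rfl⟩
      · exact hi
      · exact Ideal.subset_span (Or.inr ⟨l', rfl⟩)
    · rw [Ideal.span_le]
      rintro _ (rfl | ⟨l, rfl⟩)
      · exact hx
      · exact hw ▸ Ideal.subset_span ⟨_, rfl⟩
  rw [← hmap, hspan, Ideal.map_span, Set.image_insert_eq, Ideal.Quotient.eq_zero_iff_mem.2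
    (Ideal.mem_span_singleton_self x), Ideal.span_insert_zero, ← Set.range_comp]
  rfl

theorem isDomain_of_span_range_eq_maximalIdeal (d : ℕ) : ∀ (A : Type*) [CommRing A] [IsLocalRing A]
    [IsNoetherianRing A] (w : Fin d → A), Ideal.span (Set.range w) = maximalIdeal A →
    (d : WithBot ℕ∞) ≤ ringKrullDim A → IsDomain A := by
  induction d with
  | zero =>
    intro A _ _ _ w hw _
    have h0 : maximalIdeal A = ⊥ := by
      rw [← hw]; simp
    have hf : IsField A := IsLocalRing.isField_iff_maximalIdeal_eq.2 h0
    exact hf.isDomain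
  | succ d ih =>
    intro A _ _ _ w hw hdim
    have hmin : ∀ p ∈ minimalPrimes A, ¬ maximalIdeal A ≤ p := by
      intro p hp hle
      have hpp : p.IsPrime := hp.1.1
      have hpm : p = maximalIdeal A := le_antisymm (le_maximalIdeal hpp.ne_top) hle
      have h1 : (maximalIdeal A).height = 0 := by
        rw [← hpm]; exact Ideal.height_eq_zero_iff.2 hp
      rw [← IsLocalRing.maximalIdeal_height_eq_ringKrullDim, h1] at hdim
      have : ((d + 1 : ℕ) : ℕ∞) ≤ 0 := by exact_mod_cast hdim
      simp at this
    have hsq : ¬ maximalIdeal A ≤ maximalIdeal A ^ 2 := by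
      intro hle
      have : maximalIdeal A = ⊥ := by
        refine Submodule.eq_bot_of_le_smul_of_le_jacobson_bot (maximalIdeal A) _
          (IsNoetherian.noetherian _) ?_ (maximalIdeal_le_jacobson _)
        rwa [smul_eq_mul, ← sq]
      obtain ⟨p, hp⟩ := Ideal.nonempty_minimalPrimes (I := (⊥ : Ideal A)) (by simp)
      exact hmin p hp (this ▸ bot_le)
    have hfin : (minimalPrimes A).Finite := minimalPrimes.finite_of_isNoetherianRing A
    obtain ⟨x, hxm, hx2, hxp⟩ : ∃ x ∈ maximalIdeal A, x ∉ maximalIdeal A ^ 2 ∧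
        ∀ p ∈ minimalPrimes A, x ∉ p := by
      by_contra hcon
      push Not at hcon
      have hsub : (maximalIdeal A : Set A) ⊆
          ⋃ p ∈ (↑(insert (maximalIdeal A ^ 2) hfin.toFinset) : Set (Ideal A)), (p : Set A) := by
        intro x hx
        simp only [Finset.coe_insert, Set.Finite.coe_toFinset, Set.mem_insert_iff,
          Set.iUnion_iUnion_eq_or_left, Set.mem_union, SetLike.mem_coe, Set.mem_iUnion,
          exists_prop]
        by_cases h2 : x ∈ maximalIdeal A ^ 2
        · exact Or.inl h2
        · exact Or.inr (hcon x hx h2)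
      have := (Ideal.subset_union_prime (maximalIdeal A ^ 2) (maximalIdeal A ^ 2)
        (s := insert (maximalIdeal A ^ 2) hfin.toFinset) (f := id) (by
          intro p hp hne _
          rw [Finset.mem_insert, Set.Finite.mem_toFinset] at hp
          rcases hp with rfl | hp
          · exact absurd rfl hne
          · exact hp.1.1)).1 (by simpa using hsub)
      obtain ⟨p, hp, hle⟩ := this
      rw [Finset.mem_insert, Set.Finite.mem_toFinset] at hp
      rcases hp with rfl | hp
      · exact hsq hle
      · exact hmin p hp hle
    have hxt : Ideal.span {x} ≠ ⊤ := fun h => (maximalIdeal.isMaximal A).ne_top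
      (top_le_iff.1 (h ▸ (Ideal.span_singleton_le_iff_mem _).2 hxm))
    have : Nontrivial (A ⧸ Ideal.span {x}) := Ideal.Quotient.nontrivial_iff.2 hxt
    have : IsLocalRing (A ⧸ Ideal.span {x}) :=
      IsLocalRing.of_surjective' (Ideal.Quotient.mk _) Ideal.Quotient.mk_surjective
    obtain ⟨c, hc⟩ := (Ideal.mem_span_range_iff_exists_fun).1 (hw.symm ▸ hxm)
    obtain ⟨i, hi⟩ : ∃ i, IsUnit (c i) := by
      by_contra hcon
      push Not at hcon
      refine hx2 (hc ▸ Ideal.sum_mem _ fun i _ => ?_)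
      rw [sq]
      exact Ideal.mul_mem_mul ((mem_maximalIdeal _).2 (hcon i)) (hw ▸ Ideal.subset_span ⟨i, rfl⟩)
    have hwi : w i ∈ Ideal.span (insert x (Set.range fun l => w (i.succAbove l))) := by
      rw [← Ideal.unit_mul_mem_iff_mem _ hi]
      rw [Fin.sum_univ_succAbove _ i] at hc
      rw [eq_sub_of_add_eq hc]
      refine Ideal.sub_mem _ (Ideal.subset_span (Or.inl rfl)) (Ideal.sum_mem _ fun l _ => ?_)
      exact Ideal.mul_mem_left _ _ (Ideal.subset_span (Or.inr ⟨l, rfl⟩))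
    have hspan := span_range_succAbove_quotient hw hxm i hwi
    have hdim' : (d : WithBot ℕ∞) ≤ ringKrullDim (A ⧸ Ideal.span {x}) := by
      have h := ringKrullDim_le_ringKrullDim_quotient_add_encard {x}
        (by simpa [ringJacobson_eq_maximalIdeal] using hxm)
      rw [Set.encard_singleton] at h
      have h2 := hdim.trans h
      push_cast at h2
      exact ENat.WithBot.add_le_add_one_right_iff.1 h2
    have hdom := ih (A ⧸ Ideal.span {x}) _ hspan hdim'
    have hprime : (Ideal.span {x}).IsPrime := (Ideal.Quotient.isDomain_iff_prime _).1 hdom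
    obtain ⟨p, hp, hpx⟩ := Ideal.exists_minimalPrimes_le (I := ⊥) (J := Ideal.span {x}) bot_le
    have hpp : p.IsPrime := hp.1.1
    have hbot : p = ⊥ := by
      refine Submodule.eq_bot_of_le_smul_of_le_jacobson_bot (maximalIdeal A) _
          (IsNoetherian.noetherian _) ?_ (maximalIdeal_le_jacobson _)
      intro y hy
      obtain ⟨z, rfl⟩ := Ideal.mem_span_singleton'.1 (hpx hy)
      rw [mul_comm]
      exact Ideal.mul_mem_mul hxm ((hpp.mem_or_mem hy).resolve_right (hxp p hp))
    rw [hbot] at hpp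
    exact (IsDomain.of_bot_isPrime A)

theorem isQR_of_span_range_eq_maximalIdeal (d : ℕ) : ∀ (A : Type*) [CommRing A] [IsLocalRing A]
    [IsNoetherianRing A] (w : Fin d → A), Ideal.span (Set.range w) = maximalIdeal A →
    (d : WithBot ℕ∞) ≤ ringKrullDim A → IsQR w := by
  induction d with
  | zero =>
    intro A _ _ _ w hw _
    refine ⟨hw, fun r F hF h a => ?_⟩
    by_cases hr : coeff a F = 0
    · rw [hr]; exact zero_mem _
    · have hr0 := hF hr
      rw [Subsingleton.elim a 0] at hr0 ⊢
      obtain ⟨c, rfl⟩ := C_surjective (Fin 0) F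
      simp only [map_zero] at hr0
      subst hr0
      simpa using h
  | succ d ih =>
    intro A _ _ _ w hw hdim
    have hdom := isDomain_of_span_range_eq_maximalIdeal _ A w hw hdim
    have hxm : w 0 ∈ maximalIdeal A := hw ▸ Ideal.subset_span ⟨0, rfl⟩
    have hxt : Ideal.span {w 0} ≠ ⊤ := fun h => (maximalIdeal.isMaximal A).ne_top
      (top_le_iff.1 (h ▸ (Ideal.span_singleton_le_iff_mem _).2 hxm))
    have : Nontrivial (A ⧸ Ideal.span {w 0}) := Ideal.Quotient.nontrivial_iff.2 hxt
    have : IsLocalRing (A ⧸ Ideal.span {w 0}) :=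
      IsLocalRing.of_surjective' (Ideal.Quotient.mk _) Ideal.Quotient.mk_surjective
    have hspan := span_range_succAbove_quotient hw hxm 0 (Ideal.subset_span (Or.inl rfl))
    have hdim' : (d : WithBot ℕ∞) ≤ ringKrullDim (A ⧸ Ideal.span {w 0}) := by
      have h := ringKrullDim_le_ringKrullDim_quotient_add_encard {w 0}
        (by simpa [ringJacobson_eq_maximalIdeal] using hxm)
      rw [Set.encard_singleton] at h
      have h2 := hdim.trans h
      push_cast at h2
      exact ENat.WithBot.add_le_add_one_right_iff.1 h2
    have hqr := ih (A ⧸ Ideal.span {w 0}) _ hspan hdim'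
    have hne : w 0 ≠ 0 := by
      intro h0
      have h3 : Ideal.span (Set.range fun l => w ((0 : Fin (d + 1)).succAbove l)) =
          maximalIdeal A := by
        rw [← hw, ← Ideal.span_insert_zero, ← h0]
        congr 1
        ext y
        simp [Fin.exists_fin_succ, eq_comm]
      have h4 := IsLocalRing.maximalIdeal_height_eq_ringKrullDim (R := A)
      have h5 := Ideal.height_le_spanFinrank (maximalIdeal A) (maximalIdeal.isMaximal A).ne_top
      have h6 := Submodule.spanFinrank_span_le_ncard_of_finite (R := A)
        (Set.finite_range fun l => w ((0 : Fin (d + 1)).succAbove l))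
      rw [Ideal.span] at h3
      rw [h3] at h6
      have h7 : (Set.range fun l => w ((0 : Fin (d + 1)).succAbove l)).ncard ≤ d := by
        rw [← Set.image_univ]
        exact (Set.ncard_image_le Set.finite_univ).trans (by simp [Set.ncard_univ])
      rw [← h4] at hdim
      have h8 : ((d + 1 : ℕ) : ℕ∞) ≤ (maximalIdeal A).height := by exact_mod_cast hdim
      have h9 := h8.trans h5
      have h10 : d + 1 ≤ (maximalIdeal A).spanFinrank := by exact_mod_cast h9
      omega
    refine IsQR.of_quotient hw 0 (mem_nonZeroDivisors_of_ne_zero hne) ?_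
    intro r F hF hsupp hmem a
    obtain ⟨G, rfl⟩ : ∃ G : MvPolynomial (Fin d) A, rename Fin.succ G = F := by
      refine exists_rename_eq_of_vars_subset_range F Fin.succ (Fin.succ_injective d) ?_
      intro l hl
      obtain ⟨b, hb, hbl⟩ := (mem_vars_iff_mem_support _).1 hl
      have h0 := hsupp b (mem_support_iff.1 hb)
      rcases Fin.eq_zero_or_eq_succ l with rfl | ⟨l', rfl⟩
      · simp [h0] at hbl
      · exact ⟨l', rfl⟩
    have hG : G.IsHomogeneous r := (IsHomogeneous.rename_isHomogeneous_iff (Fin.succ_injective d)).1 hF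
    let π := Ideal.Quotient.mk (Ideal.span {w 0})
    have hmaple : Ideal.map π (maximalIdeal A) ≤ maximalIdeal _ := by
      rw [← hw, Ideal.map_span, Ideal.span_le]
      rintro _ ⟨_, ⟨l, rfl⟩, rfl⟩
      rcases Fin.eq_zero_or_eq_succ l with rfl | ⟨l', rfl⟩
      · have : π (w 0) = 0 := Ideal.Quotient.eq_zero_iff_mem.2 (Ideal.mem_span_singleton_self _)
        rw [this]; exact zero_mem _
      · rw [← hspan]; exact Ideal.subset_span ⟨l', rfl⟩
    have hcomp : ∀ c, π c ∈ maximalIdeal (A ⧸ Ideal.span {w 0}) → c ∈ maximalIdeal A := by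
      intro c hc
      by_contra hcu
      rw [mem_maximalIdeal, mem_nonunits_iff, not_not] at hcu
      exact (mem_maximalIdeal _).1 hc (hcu.map π)
    have hmem' : eval (fun l => π (w ((0 : Fin (d + 1)).succAbove l))) (map π G) ∈
        maximalIdeal (A ⧸ Ideal.span {w 0}) ^ (r + 1) := by
      have e : eval (fun l => π (w ((0 : Fin (d + 1)).succAbove l))) (map π G) =
          π (eval w (rename Fin.succ G)) := by
        rw [eval_rename, map_eval]
        rfl
      rw [e]
      have h1 := Ideal.mem_map_of_mem π hmem
      rw [Ideal.map_sup, Ideal.map_pow, Ideal.map_span, Set.image_singleton,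
        Ideal.Quotient.eq_zero_iff_mem.2 (Ideal.mem_span_singleton_self _),
        Ideal.span_singleton_eq_bot.2 rfl, sup_bot_eq] at h1
      exact Ideal.pow_right_mono hmaple _ h1
    have hc := hqr.coeff_mem r _ (hG.map π) hmem'
    by_cases ha : coeff a (rename Fin.succ G) = 0
    · rw [ha]; exact zero_mem _
    · obtain ⟨b, rfl, -⟩ := coeff_rename_ne_zero _ _ _ ha
      rw [coeff_rename_mapDomain _ (Fin.succ_injective d)]
      refine hcomp _ ?_
      have := hc b
      rwa [coeff_map] at this

end Regular

/-! ### Monomials in a quasi-regular system of parameters -/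

section Monomials

open MvPolynomial

variable {A : Type*} [CommRing A] {d : ℕ} {w : Fin d → A}

theorem eval_monomial_eq_mul_monomialIn (w : Fin d → A) (a : Fin d → ℕ) (c : A) :
    eval w (monomial (Finsupp.equivFunOnFinite.symm a) c) = c * monomialIn w a := by
  rw [eval_monomial, Finsupp.prod_fintype _ _ (fun _ => pow_zero _)]
  rfl

theorem monomialIn_add (w : Fin d → A) (a b : Fin d → ℕ) :
    monomialIn w (a + b) = monomialIn w a * monomialIn w b := by
  simp only [monomialIn, Pi.add_apply, pow_add, Finset.prod_mul_distrib]

theorem monomialIn_single (w : Fin d → A) (l : Fin d) (t : ℕ) :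
    monomialIn w (Pi.single l t) = w l ^ t := by
  rw [monomialIn, Finset.prod_eq_single l]
  · rw [Pi.single_eq_same]
  · intro m _ hm
    rw [Pi.single_eq_of_ne hm, pow_zero]
  · simp

theorem monomialIn_zero (w : Fin d → A) : monomialIn w 0 = 1 := by
  simp [monomialIn]

theorem sum_add_single (a : Fin d → ℕ) (l : Fin d) (t : ℕ) :
    ∑ m, (a + Pi.single l t : Fin d → ℕ) m = ∑ m, a m + t := by
  simp [Finset.sum_add_distrib]

theorem exists_sum_of_mem_span_monomialIn {E : Set (Fin d → ℕ)} {f : A}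
    (hf : f ∈ Ideal.span (monomialIn w '' E)) :
    ∃ (s : Finset (Fin d → ℕ)) (c : (Fin d → ℕ) → A), (∀ a ∈ s, a ∈ E) ∧
      f = ∑ a ∈ s, c a * monomialIn w a := by
  obtain ⟨c, hc, hf⟩ := (Finsupp.mem_span_image_iff_linearCombination A).1 hf
  refine ⟨c.support, c, fun a ha => hc ha, ?_⟩
  rw [← hf, Finsupp.linearCombination_apply, Finsupp.sum]
  rfl

theorem mul_mem_span_monomialIn_of_mem {E : Set (Fin d → ℕ)} {a : Fin d → ℕ} (ha : a ∈ E) (c : A) :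
    c * monomialIn w a ∈ Ideal.span (monomialIn w '' E) :=
  Ideal.mul_mem_left _ _ (Ideal.subset_span ⟨a, ha, rfl⟩)

variable [IsLocalRing A]

theorem monomialIn_mem_maximalIdeal_pow (hw : Ideal.span (Set.range w) = maximalIdeal A)
    (a : Fin d → ℕ) : monomialIn w a ∈ maximalIdeal A ^ ∑ l, a l := by
  rw [monomialIn, ← Finset.prod_pow_eq_pow_sum]
  exact Ideal.prod_mem_prod fun l _ => Ideal.pow_mem_pow (hw ▸ Ideal.subset_span ⟨l, rfl⟩) _

theorem exists_sum_of_mem_maximalIdeal_pow (hw : Ideal.span (Set.range w) = maximalIdeal A)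
    {r : ℕ} {f : A} (hf : f ∈ maximalIdeal A ^ r) :
    ∃ (s : Finset (Fin d → ℕ)) (c : (Fin d → ℕ) → A), (∀ a ∈ s, ∑ l, a l = r) ∧
      f = ∑ a ∈ s, c a * monomialIn w a := by
  obtain ⟨F, hF, rfl⟩ := (mem_maximalIdeal_pow_iff_exists_isHomogeneous hw r f).1 hf
  refine ⟨F.support.image Finsupp.equivFunOnFinite,
    fun a => coeff (Finsupp.equivFunOnFinite.symm a) F, ?_, ?_⟩
  · intro a ha
    obtain ⟨b, hb, rfl⟩ := Finset.mem_image.1 ha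
    have := hF (mem_support_iff.1 hb)
    rw [Finsupp.weight_apply, Finsupp.sum_fintype _ _ (by simp)] at this
    simpa using this
  · rw [Finset.sum_image (by simp)]
    conv_lhs => rw [F.as_sum, map_sum]
    refine Finset.sum_congr rfl fun b _ => ?_
    rw [← eval_monomial_eq_mul_monomialIn]
    simp

theorem IsQR.coeff_mem_of_sum (h : IsQR w) {s : Finset (Fin d → ℕ)} {c : (Fin d → ℕ) → A} {r : ℕ}
    (hs : ∀ a ∈ s, ∑ l, a l = r)
    (hm : ∑ a ∈ s, c a * monomialIn w a ∈ maximalIdeal A ^ (r + 1)) :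
    ∀ a ∈ s, c a ∈ maximalIdeal A := by
  intro a ha
  let F : MvPolynomial (Fin d) A :=
    ∑ a ∈ s, monomial (Finsupp.equivFunOnFinite.symm a) (c a)
  have hF : F.IsHomogeneous r := by
    refine IsHomogeneous.sum _ _ _ fun b hb => isHomogeneous_monomial _ ?_
    rw [← hs b hb, Finsupp.degree_eq_sum]
    rfl
  have he : eval w F = ∑ a ∈ s, c a * monomialIn w a := by
    rw [map_sum]
    exact Finset.sum_congr rfl fun b _ => eval_monomial_eq_mul_monomialIn w b _
  have := h.coeff_mem r F hF (he ▸ hm) (Finsupp.equivFunOnFinite.symm a)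
  rw [coeff_sum, Finset.sum_eq_single a] at this
  · simpa using this
  · intro b _ hb
    rw [coeff_monomial, if_neg (by simpa using hb)]
  · exact fun h => absurd ha h

theorem IsQR.monomialIn_notMem_pow (h : IsQR w) (a : Fin d → ℕ) :
    monomialIn w a ∉ maximalIdeal A ^ (∑ l, a l + 1) := by
  intro hm
  have := h.coeff_mem_of_sum (s := {a}) (c := fun _ => 1) (r := ∑ l, a l) (by simp)
    (by simpa using hm) a (by simp)
  exact (Ideal.ne_top_iff_one _).1 (maximalIdeal.isMaximal A).ne_top this

theorem IsQR.param_pow_notMem_pow (h : IsQR w) (l : Fin d) (r : ℕ) :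
    w l ^ r ∉ maximalIdeal A ^ (r + 1) := by
  simpa [monomialIn_single] using h.monomialIn_notMem_pow (Pi.single l r)

/-- A monomial ideal meets a power of the maximal ideal in a monomial ideal. -/
theorem IsQR.mem_span_of_mem_pow (h : IsQR w) {E : Set (Fin d → ℕ)} (hE : IsUpperSet E) {f : A}
    (hf : f ∈ Ideal.span (monomialIn w '' E)) (t : ℕ) (ht : f ∈ maximalIdeal A ^ t) :
    f ∈ Ideal.span (monomialIn w '' {b | b ∈ E ∧ t ≤ ∑ l, b l}) := by
  induction t with
  | zero => simpa using hf
  | succ t ih =>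
    obtain ⟨s, c, hs, rfl⟩ := exists_sum_of_mem_span_monomialIn
      (ih (Ideal.pow_le_pow_right (Nat.le_succ t) ht))
    have hsplit := Finset.sum_filter_add_sum_filter_not s (fun a => ∑ l, a l = t)
      (fun a => c a * monomialIn w a)
    have hrest : ∀ a ∈ s.filter (fun a => ¬ ∑ l, a l = t), t + 1 ≤ ∑ l, a l := by
      intro a ha
      rw [Finset.mem_filter] at ha
      have := (hs a ha.1).2
      omega
    have hlow : ∑ a ∈ s.filter (fun a => ∑ l, a l = t), c a * monomialIn w a ∈
        maximalIdeal A ^ (t + 1) := by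
      rw [eq_sub_of_add_eq hsplit]
      exact Ideal.sub_mem _ ht (Ideal.sum_mem _ fun a ha => Ideal.mul_mem_left _ _
        (Ideal.pow_le_pow_right (hrest a ha) (monomialIn_mem_maximalIdeal_pow h.span_range a)))
    have hc := h.coeff_mem_of_sum (fun a ha => (Finset.mem_filter.1 ha).2) hlow
    rw [← hsplit]
    refine Ideal.add_mem _ (Ideal.sum_mem _ fun a ha => ?_) (Ideal.sum_mem _ fun a ha => ?_)
    · have hca := hc a ha
      rw [← h.span_range] at hca
      obtain ⟨g, hg⟩ := Ideal.mem_span_range_iff_exists_fun.1 hca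
      rw [← hg, Finset.sum_mul]
      refine Ideal.sum_mem _ fun l _ => ?_
      have e : g l * w l * monomialIn w a = g l * monomialIn w (a + Pi.single l 1) := by
        rw [monomialIn_add, monomialIn_single]; ring
      rw [e]
      rw [Finset.mem_filter] at ha
      refine mul_mem_span_monomialIn_of_mem
        (E := {b | b ∈ E ∧ t + 1 ≤ ∑ l, b l}) ⟨hE le_self_add (hs a ha.1).1, ?_⟩ _
      rw [sum_add_single, ha.2]
    · exact mul_mem_span_monomialIn_of_mem
        (E := {b | b ∈ E ∧ t + 1 ≤ ∑ l, b l}) ⟨(hs a (Finset.mem_filter.1 ha).1).1, hrest a ha⟩ _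

/-- If a combination of monomials with unit coefficients lies in a monomial ideal, then so do all
the monomials. -/
theorem IsQR.mem_of_sum_mem_span (h : IsQR w) {E : Set (Fin d → ℕ)} (hE : IsUpperSet E)
    {s : Finset (Fin d → ℕ)} {u : (Fin d → ℕ) → A} (hu : ∀ a ∈ s, IsUnit (u a))
    (hf : ∑ a ∈ s, u a * monomialIn w a ∈ Ideal.span (monomialIn w '' E)) :
    ∀ a ∈ s, a ∈ E := by
  classical
  by_contra hcon
  push Not at hcon
  obtain ⟨a₁, ha₁, ha₁E⟩ := hcon
  obtain ⟨a₀, ha₀, hmin⟩ := Finset.exists_min_image (s.filter (· ∉ E)) (fun a => ∑ l, a l)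
    ⟨a₁, Finset.mem_filter.2 ⟨ha₁, ha₁E⟩⟩
  set t := ∑ l, a₀ l with ht
  have hT : ∑ a ∈ s.filter (· ∉ E), u a * monomialIn w a ∈ Ideal.span (monomialIn w '' E) := by
    have hsplit := Finset.sum_filter_add_sum_filter_not s (· ∉ E)
      (fun a => u a * monomialIn w a)
    rw [eq_sub_of_add_eq hsplit]
    refine Ideal.sub_mem _ hf (Ideal.sum_mem _ fun a ha => mul_mem_span_monomialIn_of_mem ?_ _)
    simpa using (Finset.mem_filter.1 ha).2
  have hTt : ∑ a ∈ s.filter (· ∉ E), u a * monomialIn w a ∈ maximalIdeal A ^ t :=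
    Ideal.sum_mem _ fun a ha => Ideal.mul_mem_left _ _
      (Ideal.pow_le_pow_right (hmin a ha) (monomialIn_mem_maximalIdeal_pow h.span_range a))
  obtain ⟨s', c, hs', he⟩ := exists_sum_of_mem_span_monomialIn
    (h.mem_span_of_mem_pow hE hT t hTt)
  set T := s.filter (· ∉ E) with hTdef
  have hhigh : ∀ (r : Finset (Fin d → ℕ)) (c : (Fin d → ℕ) → A), (∀ a ∈ r, t ≤ ∑ l, a l) →
      ∑ a ∈ r.filter (fun a => ¬ ∑ l, a l = t), c a * monomialIn w a ∈
        maximalIdeal A ^ (t + 1) := by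
    intro r c hr
    refine Ideal.sum_mem _ fun a ha => Ideal.mul_mem_left _ _
      (Ideal.pow_le_pow_right ?_ (monomialIn_mem_maximalIdeal_pow h.span_range a))
    rw [Finset.mem_filter] at ha
    have := hr a ha.1
    omega
  have hd : Disjoint (T.filter (fun a => ∑ l, a l = t)) (s'.filter (fun a => ∑ l, a l = t)) := by
    rw [Finset.disjoint_left]
    intro a ha ha'
    rw [Finset.mem_filter] at ha ha'
    exact (Finset.mem_filter.1 ha.1).2 (hs' a ha'.1).1
  have key := h.coeff_mem_of_sum
    (s := T.filter (fun a => ∑ l, a l = t) ∪ s'.filter (fun a => ∑ l, a l = t))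
    (c := fun a => if a ∈ E then - c a else u a) (r := t) (by
      intro a ha
      rw [Finset.mem_union, Finset.mem_filter (s := T), Finset.mem_filter (s := s')] at ha
      exact ha.elim (fun h => h.2) (fun h => h.2)) (by
      rw [Finset.sum_union hd]
      have e1 : ∑ a ∈ T.filter (fun a => ∑ l, a l = t), (if a ∈ E then - c a else u a) *
          monomialIn w a = ∑ a ∈ T.filter (fun a => ∑ l, a l = t), u a * monomialIn w a := by
        refine Finset.sum_congr rfl fun a ha => ?_
        rw [Finset.mem_filter] at ha
        rw [if_neg (Finset.mem_filter.1 ha.1).2]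
      have e2 : ∑ a ∈ s'.filter (fun a => ∑ l, a l = t), (if a ∈ E then - c a else u a) *
          monomialIn w a = - ∑ a ∈ s'.filter (fun a => ∑ l, a l = t), c a * monomialIn w a := by
        rw [← Finset.sum_neg_distrib]
        refine Finset.sum_congr rfl fun a ha => ?_
        rw [Finset.mem_filter] at ha
        rw [if_pos (hs' a ha.1).1, neg_mul]
      have f1 := Finset.sum_filter_add_sum_filter_not T (fun a => ∑ l, a l = t)
        (fun a => u a * monomialIn w a)
      have f2 := Finset.sum_filter_add_sum_filter_not s' (fun a => ∑ l, a l = t)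
        (fun a => c a * monomialIn w a)
      have g1 := hhigh T u hmin
      have g2 := hhigh s' c (fun a ha => (hs' a ha).2)
      rw [e1, e2]
      convert Ideal.sub_mem _ g2 g1 using 1
      rw [← f1, ← f2] at he
      linear_combination he)
    a₀ (Finset.mem_union_left _ (Finset.mem_filter.2 ⟨ha₀, ht.symm⟩))
  have ha₀' := Finset.mem_filter.1 ha₀
  simp only [if_neg ha₀'.2] at key
  exact (mem_maximalIdeal _).1 key (hu a₀ ha₀'.1)

theorem IsQR.monomialIn_mem_span_iff (h : IsQR w) {E : Set (Fin d → ℕ)} (hE : IsUpperSet E)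
    (a : Fin d → ℕ) : monomialIn w a ∈ Ideal.span (monomialIn w '' E) ↔ a ∈ E := by
  refine ⟨fun ha => ?_, fun ha => Ideal.subset_span ⟨a, ha, rfl⟩⟩
  exact h.mem_of_sum_mem_span hE (s := {a}) (u := fun _ => 1) (by simp) (by simpa using ha) a
    (by simp)

/-- Expansion of an element as a combination of monomials with unit coefficients. -/
theorem IsQR.exists_expansion (h : IsQR w) {r : ℕ} {f : A} (hf : f ∈ maximalIdeal A ^ r) (k : ℕ) :
    ∃ (s : Finset (Fin d → ℕ)) (u : (Fin d → ℕ) → A),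
      (∀ a ∈ s, r ≤ ∑ l, a l ∧ ∑ l, a l < r + k) ∧ (∀ a ∈ s, IsUnit (u a)) ∧
      f - ∑ a ∈ s, u a * monomialIn w a ∈ maximalIdeal A ^ (r + k) := by
  classical
  induction k with
  | zero => exact ⟨∅, fun _ => 1, by simp, by simp, by simpa using hf⟩
  | succ k ih =>
    obtain ⟨s, u, hs, hu, hm⟩ := ih
    obtain ⟨s', c, hs', he⟩ := exists_sum_of_mem_maximalIdeal_pow h.span_range hm
    have hd : Disjoint s (s'.filter fun a => IsUnit (c a)) := by
      rw [Finset.disjoint_left]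
      intro a ha ha'
      have h1 := (hs a ha).2
      have h2 := hs' a (Finset.mem_filter.1 ha').1
      omega
    refine ⟨s ∪ s'.filter fun a => IsUnit (c a), fun a => if a ∈ s then u a else c a, ?_, ?_, ?_⟩
    · intro a ha
      rcases Finset.mem_union.1 ha with ha | ha
      · have := hs a ha
        omega
      · have := hs' a (Finset.mem_filter.1 ha).1
        omega
    · intro a ha
      by_cases has : a ∈ s
      · simp only [if_pos has]; exact hu a has
      · simp only [if_neg has]
        exact (Finset.mem_filter.1 ((Finset.mem_union.1 ha).resolve_left has)).2
    · rw [Finset.sum_union hd]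
      have e1 : ∑ a ∈ s, (if a ∈ s then u a else c a) * monomialIn w a =
          ∑ a ∈ s, u a * monomialIn w a :=
        Finset.sum_congr rfl fun a ha => by rw [if_pos ha]
      have e2 : ∑ a ∈ s'.filter (fun a => IsUnit (c a)), (if a ∈ s then u a else c a) *
          monomialIn w a = ∑ a ∈ s'.filter (fun a => IsUnit (c a)), c a * monomialIn w a :=
        Finset.sum_congr rfl fun a ha => by rw [if_neg (Finset.disjoint_right.1 hd ha)]
      have e3 := Finset.sum_filter_add_sum_filter_not s' (fun a => IsUnit (c a))
        (fun a => c a * monomialIn w a)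
      have e4 : f - (∑ a ∈ s, u a * monomialIn w a +
          ∑ a ∈ s'.filter (fun a => IsUnit (c a)), c a * monomialIn w a) =
          ∑ a ∈ s'.filter (fun a => ¬ IsUnit (c a)), c a * monomialIn w a := by
        linear_combination he - e3
      rw [e1, e2, e4]
      refine Ideal.sum_mem _ fun a ha => ?_
      rw [Finset.mem_filter] at ha
      rw [← add_assoc, pow_succ', ← hs' a ha.1]
      exact Ideal.mul_mem_mul ((mem_maximalIdeal _).2 ha.2)
        (monomialIn_mem_maximalIdeal_pow h.span_range a)

theorem exists_mem_pow_notMem_pow_succ {R : Type*} [CommRing R] {I : Ideal R} {f : R} {r : ℕ}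
    (hf : f ∉ I ^ (r + 1)) :
    ∃ r' ≤ r, f ∈ I ^ r' ∧ f ∉ I ^ (r' + 1) := by
  induction r with
  | zero => exact ⟨0, le_rfl, by simp, hf⟩
  | succ r ih =>
    by_cases h : f ∈ I ^ (r + 1)
    · exact ⟨r + 1, le_rfl, h, hf⟩
    · obtain ⟨r', h1, h2⟩ := ih h
      exact ⟨r', h1.trans (Nat.le_succ r), h2⟩

theorem IsQR.mul_notMem_pow (h : IsQR w) {f g : A} {r s : ℕ} (hf : f ∉ maximalIdeal A ^ (r + 1))
    (hg : g ∉ maximalIdeal A ^ (s + 1)) : f * g ∉ maximalIdeal A ^ (r + s + 1) := by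
  obtain ⟨r', hr', hf1, hf2⟩ := exists_mem_pow_notMem_pow_succ hf
  obtain ⟨s', hs', hg1, hg2⟩ := exists_mem_pow_notMem_pow_succ hg
  intro hfg
  have key : ∀ {f : A} {r : ℕ}, f ∈ maximalIdeal A ^ r → f ∉ maximalIdeal A ^ (r + 1) →
      ∃ F : MvPolynomial (Fin d) A, F.IsHomogeneous r ∧ eval w F = f ∧ map (residue A) F ≠ 0 := by
    intro f r hf hf'
    obtain ⟨F, hF, rfl⟩ := (mem_maximalIdeal_pow_iff_exists_isHomogeneous h.span_range r f).1 hf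
    refine ⟨F, hF, rfl, fun h0 => hf' (eval_mem_maximalIdeal_pow_succ h.span_range hF fun a => ?_)⟩
    rw [← residue_eq_zero_iff, ← coeff_map, h0, coeff_zero]
  obtain ⟨F, hF, rfl, hF0⟩ := key hf1 hf2
  obtain ⟨G, hG, rfl, hG0⟩ := key hg1 hg2
  refine mul_ne_zero hF0 hG0 ?_
  rw [← map_mul]
  ext a
  rw [coeff_map, coeff_zero, residue_eq_zero_iff]
  refine h.coeff_mem (r' + s') (F * G) (hF.mul hG) ?_ a
  rw [map_mul]
  exact Ideal.pow_le_pow_right (by omega) hfg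

theorem le_idealOrd_iff (I : Ideal A) (r : ℕ) : (r : ℕ∞) ≤ idealOrd I ↔ I ≤ maximalIdeal A ^ r := by
  refine ⟨fun h => ?_, fun h => le_iSup₂_of_le r h le_rfl⟩
  by_contra hcon
  rcases r with _ | r
  · simp at hcon
  · have : idealOrd I ≤ r := by
      refine iSup₂_le fun r' h' => ?_
      by_contra hlt
      rw [not_le, Nat.cast_lt] at hlt
      exact hcon (h'.trans (Ideal.pow_le_pow_right hlt))
    have h2 := h.trans this
    norm_cast at h2
    omega

theorem le_idealOrd_span_singleton_iff (f : A) (r : ℕ) :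
    (r : ℕ∞) ≤ idealOrd (Ideal.span {f}) ↔ f ∈ maximalIdeal A ^ r := by
  rw [le_idealOrd_iff, Ideal.span_singleton_le_iff_mem]

theorem idealOrd_eq_iff (I : Ideal A) (r : ℕ) : idealOrd I = r ↔
    I ≤ maximalIdeal A ^ r ∧ ¬ I ≤ maximalIdeal A ^ (r + 1) := by
  rw [← le_idealOrd_iff, ← le_idealOrd_iff, not_le, Nat.cast_succ]
  constructor
  · intro h
    rw [h]
    exact ⟨le_rfl, by exact_mod_cast Nat.lt_succ_self r⟩
  · rintro ⟨h1, h2⟩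
    exact le_antisymm (Order.lt_add_one_iff_of_not_isMax (by simp) |>.1 h2) h1

theorem finite_setOf_minimal (E : Set (Fin d → ℕ)) : {a | Minimal (· ∈ E) a}.Finite :=
  (setOfPred_minimal_antichain _).finite_of_partiallyWellOrderedOn
    (Set.isPWO_of_wellQuasiOrderedLE _)

theorem exists_minimal_le_of_mem {E : Set (Fin d → ℕ)} {a : Fin d → ℕ} (ha : a ∈ E) :
    ∃ b ≤ a, Minimal (· ∈ E) b :=
  exists_minimal_le_of_wellFoundedLT (· ∈ E) a ha

/-- The minimal number of generators of a monomial ideal is the number of its monomial minimal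
generators. -/
theorem IsQR.spanFinrank_eq_ncard [IsNoetherianRing A] (h : IsQR w) {E : Set (Fin d → ℕ)}
    {I : Ideal A} (hI : I = Ideal.span (monomialIn w '' E)) :
    I.spanFinrank = {a | Minimal (· ∈ E) a}.ncard := by
  classical
  have hfin := finite_setOf_minimal E
  apply le_antisymm
  · have : I = Ideal.span (monomialIn w '' {a | Minimal (· ∈ E) a}) := by
      rw [hI]
      apply le_antisymm
      · rw [Ideal.span_le]
        rintro _ ⟨a, ha, rfl⟩
        obtain ⟨b, hb, hbm⟩ := exists_minimal_le_of_mem ha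
        have : monomialIn w a = monomialIn w (a - b) * monomialIn w b := by
          rw [← monomialIn_add, tsub_add_cancel_of_le hb]
        rw [this]
        exact mul_mem_span_monomialIn_of_mem hbm _
      · exact Ideal.span_mono (Set.image_mono fun a ha => ha.prop)
    rw [this]
    exact (Submodule.spanFinrank_span_le_ncard_of_finite (hfin.image _)).trans
      (Set.ncard_image_le hfin)
  · rw [IsLocalRing.spanFinrank_eq_finrank_quotient I (IsNoetherian.noetherian I)]
    have : Fintype {a | Minimal (· ∈ E) a} := hfin.fintype
    have hmem : ∀ a : {a | Minimal (· ∈ E) a}, monomialIn w (a : Fin d → ℕ) ∈ I := fun a =>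
      hI ▸ Ideal.subset_span ⟨a, a.2.prop, rfl⟩
    let x : {a | Minimal (· ∈ E) a} → I ⧸ (maximalIdeal A • (⊤ : Submodule A I)) :=
      fun a => Submodule.Quotient.mk ⟨monomialIn w a, hmem a⟩
    have hli : LinearIndependent (A ⧸ maximalIdeal A) x := by
      rw [Fintype.linearIndependent_iff]
      intro g hg
      choose c hc using fun a => Ideal.Quotient.mk_surjective (g a)
      have h1 : (∑ a : {a | Minimal (· ∈ E) a}, c a * monomialIn w a) ∈ maximalIdeal A * I := by
        have h2 : (∑ a, c a • (⟨monomialIn w a, hmem a⟩ : I)) ∈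
            maximalIdeal A • (⊤ : Submodule A I) := by
          rw [← Submodule.Quotient.mk_eq_zero, ← hg]
          rw [← Submodule.mkQ_apply, map_sum]
          refine Finset.sum_congr rfl fun a _ => ?_
          rw [← hc a]
          rfl
        have h3 := Submodule.mem_map_of_mem (f := Submodule.subtype I) h2
        rw [Submodule.map_smul'', Submodule.map_top, Submodule.range_subtype] at h3
        simpa using h3
      have hE2 : IsUpperSet {b : Fin d → ℕ | ∃ e ∈ E, ∃ l, e + Pi.single l 1 ≤ b} := by
        rintro b b' hbb ⟨e, he, l, hl⟩
        exact ⟨e, he, l, hl.trans hbb⟩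
      have hmI : maximalIdeal A * I ≤
          Ideal.span (monomialIn w '' {b | ∃ e ∈ E, ∃ l, e + Pi.single l 1 ≤ b}) := by
        rw [← h.span_range, hI, Ideal.span_mul_span', Ideal.span_le]
        rintro _ ⟨_, ⟨l, rfl⟩, _, ⟨e, he, rfl⟩, rfl⟩
        refine Ideal.subset_span ⟨e + Pi.single l 1, ⟨e, he, l, le_rfl⟩, ?_⟩
        rw [monomialIn_add, monomialIn_single, pow_one, mul_comm]
      intro a
      rw [← hc a, Ideal.Quotient.eq_zero_iff_mem]
      by_contra hca
      let c' : (Fin d → ℕ) → A := fun b => if hb : Minimal (· ∈ E) b then c ⟨b, hb⟩ else 0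
      have h4 : ∑ b ∈ hfin.toFinset.filter (fun b => IsUnit (c' b)), c' b * monomialIn w b ∈
          maximalIdeal A * I := by
        have h5 : ∑ b ∈ hfin.toFinset, c' b * monomialIn w b ∈ maximalIdeal A * I := by
          rw [← Finset.sum_subtype_of_mem (p := fun b => b ∈ {a | Minimal (· ∈ E) a})
            (f := fun b => c' b * monomialIn w b) (by simp)] 
          convert h1 using 1
          refine Finset.sum_congr (by ext; simp) fun b _ => ?_
          have hb : Minimal (· ∈ E) b.1 := b.2
          simp only [c', dif_pos hb]
        rw [eq_sub_of_add_eq (Finset.sum_filter_add_sum_filter_not hfin.toFinset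
          (fun b => IsUnit (c' b)) (fun b => c' b * monomialIn w b))]
        refine Ideal.sub_mem _ h5 (Ideal.sum_mem _ fun b hb => ?_)
        rw [Finset.mem_filter, Set.Finite.mem_toFinset] at hb
        exact Ideal.mul_mem_mul ((mem_maximalIdeal _).2 hb.2) (hmem ⟨b, hb.1⟩)
      have ha : Minimal (· ∈ E) a.1 := a.2
      obtain ⟨e, he, l, hl⟩ := h.mem_of_sum_mem_span hE2
        (fun b hb => (Finset.mem_filter.1 hb).2) (hmI h4) a.1 (by
          rw [Finset.mem_filter, Set.Finite.mem_toFinset]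
          refine ⟨ha, ?_⟩
          simp only [c', dif_pos ha]
          by_contra hnu
          exact hca ((mem_maximalIdeal _).2 hnu))
      have h6 := ha.le_of_le he (le_self_add.trans hl) l
      have h7 := hl l
      change a.1 l ≤ e l at h6
      simp only [Pi.add_apply, Pi.single_eq_same] at h7
      omega
    rw [← Nat.card_coe_set_eq, Nat.card_eq_fintype_card]
    have : Module.Finite (A ⧸ maximalIdeal A) (I ⧸ (maximalIdeal A • (⊤ : Submodule A I))) :=
      Module.Finite.of_restrictScalars_finite A _ _
    exact hli.fintype_card_le_finrank

end Monomials

/-! ### Localizations inside a field -/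

section OfPrime

variable {K : Type*} [Field K] {S : Subring K} {P : Ideal S} [P.IsPrime]

theorem mem_ofPrime_iff {z : K} :
    z ∈ (LocalSubring.ofPrime S P).toSubring ↔ ∃ a s : S, s ∉ P ∧ z * s = a := by
  constructor
  · intro hz
    obtain ⟨⟨a, s⟩, h⟩ := IsLocalization.surj P.primeCompl
      (⟨z, hz⟩ : (LocalSubring.ofPrime S P).toSubring)
    exact ⟨a, s, s.2, congrArg Subtype.val h⟩
  · rintro ⟨a, s, hs, h⟩
    have hu := (IsLocalization.AtPrime.isUnit_to_map_iff
      (LocalSubring.ofPrime S P).toSubring P s).2 hs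
    obtain ⟨t, ht⟩ := hu.exists_right_inv
    have ht' : (s : K) * (t : K) = 1 := congrArg Subtype.val ht
    have : z = (a : K) * (t : K) := by
      rw [← h, mul_assoc, ht', mul_one]
    rw [this]
    exact mul_mem (LocalSubring.le_ofPrime S P a.2) t.2

theorem coe_mem_maximalIdeal_ofPrime_iff (a : S)
    (z : (LocalSubring.ofPrime S P).toSubring) (h : (z : K) = a) :
    z ∈ maximalIdeal (LocalSubring.ofPrime S P).toSubring ↔ a ∈ P := by
  have : z = algebraMap S _ a := Subtype.ext h
  rw [this]
  exact IsLocalization.AtPrime.to_map_mem_maximal_iff _ P a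

end OfPrime

/-! ### Monomial quadratic transforms -/

section Transform

open MvPolynomial

variable {K : Type*} [Field K] {d : ℕ}

theorem IsQR.param_ne_zero {A : Type*} [CommRing A] [IsLocalRing A] {w : Fin d → A} (h : IsQR w)
    (l : Fin d) : w l ≠ 0 := by
  intro h0
  have := h.monomialIn_notMem_pow (Pi.single l 1)
  rw [monomialIn_single, pow_one, h0] at this
  exact this (zero_mem _)

theorem IsQR.param_mem {A : Type*} [CommRing A] [IsLocalRing A] {w : Fin d → A} (h : IsQR w)
    (l : Fin d) : w l ∈ maximalIdeal A := h.span_range ▸ Ideal.subset_span ⟨l, rfl⟩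

theorem IsQR.coe_param_ne_zero {A : LocalSubring K} {w : Fin d → A.toSubring} (h : IsQR w)
    (l : Fin d) : (w l : K) ≠ 0 := fun h0 => h.param_ne_zero l (Subtype.ext h0)

variable {A : LocalSubring K} {w : Fin d → A.toSubring}

theorem le_blowupSubring (A : Subring K) (I : Ideal A) (a : A) : A ≤ blowupSubring A I a :=
  fun _ hz => Subring.subset_closure (Or.inl hz)

theorem div_mem_blowupSubring {A : Subring K} {I : Ideal A} (a : A) {b : A} (hb : b ∈ I) :
    (b : K) / a ∈ blowupSubring A I a :=
  Subring.subset_closure (Or.inr ⟨b, hb, rfl⟩)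

theorem div_pow_mem_blowupSubring {A : Subring K} {I : Ideal A} {a : A} (ha : (a : K) ≠ 0) (N : ℕ) :
    ∀ {f : A}, f ∈ I ^ N → (f : K) / (a : K) ^ N ∈ blowupSubring A I a := by
  induction N with
  | zero =>
    intro f _
    rw [pow_zero, div_one]
    exact le_blowupSubring _ _ _ f.2
  | succ N ih =>
    intro f hf
    rw [pow_succ] at hf
    refine Submodule.mul_induction_on hf (fun g hg b hb => ?_) (fun x y hx hy => ?_)
    · have : ((g * b : A) : K) / (a : K) ^ (N + 1) = (g : K) / (a : K) ^ N * ((b : K) / a) := by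
        push_cast
        field_simp
        ring
      rw [this]
      exact mul_mem (ih hg) (div_mem_blowupSubring a hb)
    · rw [Subring.coe_add, add_div]
      exact add_mem hx hy

theorem exists_mul_pow_eq_of_mem_blowupSubring {A : Subring K} {I : Ideal A} {a : A}
    (ha : (a : K) ≠ 0) (haI : a ∈ I) {z : K} (hz : z ∈ blowupSubring A I a) :
    ∃ N : ℕ, ∀ M, N ≤ M → ∃ f ∈ I ^ M, z * (a : K) ^ M = f := by
  have up : ∀ {z : K} {N : ℕ}, (∃ f ∈ I ^ N, z * (a : K) ^ N = f) →
      ∀ M, N ≤ M → ∃ f ∈ I ^ M, z * (a : K) ^ M = f := by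
    rintro z N ⟨f, hf, h⟩ M hM
    obtain ⟨k, rfl⟩ := Nat.exists_eq_add_of_le hM
    refine ⟨f * a ^ k, ?_, ?_⟩
    · rw [pow_add]
      exact Ideal.mul_mem_mul hf (Ideal.pow_mem_pow haI k)
    · push_cast
      rw [← h]; ring
  suffices h : ∃ N : ℕ, ∃ f ∈ I ^ N, z * (a : K) ^ N = f by
    obtain ⟨N, h⟩ := h
    exact ⟨N, up h⟩
  refine Subring.closure_induction (fun x hx => ?_) ⟨0, 0, zero_mem _, by simp⟩
    ⟨0, 1, by simp, by simp⟩ (fun x y _ _ hx hy => ?_) (fun x _ hx => ?_)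
    (fun x y _ _ hx hy => ?_) hz
  · rcases hx with hx | ⟨b, hb, rfl⟩
    · exact ⟨0, ⟨x, hx⟩, by simp, by simp⟩
    · exact ⟨1, b, by simpa using hb, by field_simp⟩
  · obtain ⟨N, h1⟩ := hx
    obtain ⟨M, h2⟩ := hy
    obtain ⟨f, hf, hf'⟩ := up h1 (max N M) (le_max_left _ _)
    obtain ⟨g, hg, hg'⟩ := up h2 (max N M) (le_max_right _ _)
    exact ⟨max N M, f + g, add_mem hf hg, by push_cast; rw [add_mul, hf', hg']⟩
  · obtain ⟨N, f, hf, hf'⟩ := hx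
    exact ⟨N, -f, neg_mem hf, by push_cast; rw [neg_mul, hf']⟩
  · obtain ⟨N, f, hf, hf'⟩ := hx
    obtain ⟨M, g, hg, hg'⟩ := hy
    refine ⟨N + M, f * g, ?_, by push_cast; rw [← hf', ← hg']; ring⟩
    rw [pow_add]
    exact Ideal.mul_mem_mul hf hg

/-- The blow-up ring of a finitely generated ideal of a Noetherian ring is Noetherian. -/
theorem isNoetherianRing_blowupSubring {A : Subring K} [IsNoetherianRing A] {n : ℕ}
    (g : Fin n → A) (a : A) :
    IsNoetherianRing (blowupSubring A (Ideal.span (Set.range g)) a) := by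
  let φ : MvPolynomial (Fin n) A →+* K := eval₂Hom A.subtype (fun l => (g l : K) / a)
  have h : blowupSubring A (Ideal.span (Set.range g)) a = φ.range := by
    apply le_antisymm
    · rw [blowupSubring, Subring.closure_le]
      have hA : ∀ x : A, (x : K) ∈ φ.range := fun x => ⟨C x, by simp [φ]⟩
      rintro x (hx | ⟨b, hb, rfl⟩)
      · exact hA ⟨x, hx⟩
      · obtain ⟨c, rfl⟩ := Ideal.mem_span_range_iff_exists_fun.1 hb
        push_cast
        rw [Finset.sum_div]
        refine sum_mem fun l _ => ?_
        rw [mul_div_assoc]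
        exact mul_mem (hA _) ⟨X l, by simp [φ]⟩
    · rintro _ ⟨F, rfl⟩
      induction F using MvPolynomial.induction_on with
      | C c => simpa [φ] using le_blowupSubring A _ a c.2
      | add p q hp hq => rw [map_add]; exact add_mem hp hq
      | mul_X p l hp =>
        rw [map_mul]
        refine mul_mem hp ?_
        have : φ (X l) = (g l : K) / a := by simp [φ]
        rw [this]
        exact div_mem_blowupSubring a (Ideal.subset_span ⟨l, rfl⟩)
  rw [h]
  exact isNoetherianRing_of_surjective _ _ φ.rangeRestrict φ.rangeRestrict_surjective

theorem eval_single_eq_coeff {R : Type*} [CommRing R] {C : MvPolynomial (Fin d) R} {N : ℕ}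
    (hC : C.IsHomogeneous N) (j : Fin d) :
    eval (Pi.single j 1) C = coeff (Finsupp.single j N) C := by
  rw [eval_eq', Finset.sum_eq_single (Finsupp.single j N)]
  · rw [Finset.prod_eq_one, mul_one]
    intro l _
    by_cases hl : l = j
    · subst hl; simp
    · simp [Ne.symm hl]
  · intro b hb hne
    obtain ⟨l, hl, hbl⟩ : ∃ l, l ≠ j ∧ b l ≠ 0 := by
      by_contra hcon
      push Not at hcon
      have hbs : b = Finsupp.single j (b j) := by
        ext l
        by_cases hl : l = j
        · subst hl; simp
        · rw [hcon l hl, Finsupp.single_eq_of_ne hl]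
      have h1 := hC (mem_support_iff.1 hb)
      rw [hbs, Finsupp.weight_single] at h1
      simp at h1
      exact hne (h1 ▸ hbs)
    rw [Finset.prod_eq_zero (Finset.mem_univ l), mul_zero]
    rw [Pi.single_eq_of_ne hl, zero_pow hbl]
  · intro h
    rw [notMem_support_iff.1 h, zero_mul]

/-- Homogeneous forms in `w` divided by a power of `w j` lie in the blow-up ring, and lie in the
prime `(w j, w l / w j)` if and only if the coefficient of the power of `w j` is not a unit. -/
theorem exists_dehomogenization (hw : Ideal.span (Set.range w) = maximalIdeal A.toSubring)
    (j : Fin d) (hj : (w j : K) ≠ 0)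
    {P : Ideal (blowupSubring A.toSubring (maximalIdeal A.toSubring) (w j))} [hP : P.IsPrime]
    (hPv : ∀ x : blowupSubring A.toSubring (maximalIdeal A.toSubring) (w j),
      (x : K) = w j ∨ (∃ l, l ≠ j ∧ (x : K) = w l / w j) → x ∈ P)
    {N : ℕ} {C : MvPolynomial (Fin d) A.toSubring} (hC : C.IsHomogeneous N) :
    ∃ c : blowupSubring A.toSubring (maximalIdeal A.toSubring) (w j),
      (c : K) * (w j : K) ^ N = eval w C ∧
      (c ∈ P ↔ eval (Pi.single j 1) C ∈ maximalIdeal A.toSubring) := by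
  have hmem : ∀ l, w l ∈ maximalIdeal A.toSubring := fun l => hw ▸ Ideal.subset_span ⟨l, rfl⟩
  let ι : A.toSubring →+* blowupSubring A.toSubring (maximalIdeal A.toSubring) (w j) :=
    Subring.inclusion (le_blowupSubring _ _ _)
  let u : Fin d → blowupSubring A.toSubring (maximalIdeal A.toSubring) (w j) :=
    fun l => ⟨(w l : K) / w j, div_mem_blowupSubring _ (hmem l)⟩
  have hιP : ∀ x, ι x ∈ P ↔ x ∈ maximalIdeal A.toSubring := by
    intro x
    constructor
    · intro hx
      rw [mem_maximalIdeal, mem_nonunits_iff]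
      exact fun hu => hP.ne_top (Ideal.eq_top_of_isUnit_mem _ hx (hu.map ι))
    · intro hx
      rw [← hw] at hx
      obtain ⟨g, rfl⟩ := Ideal.mem_span_range_iff_exists_fun.1 hx
      rw [map_sum]
      refine Ideal.sum_mem _ fun l _ => ?_
      have e : ι (g l * w l) = ι (g l) * u l * ι (w j) := by
        apply Subtype.ext
        change ((g l * w l : A.toSubring) : K) = (g l : K) * ((w l : K) / w j) * w j
        push_cast
        field_simp
      rw [e]
      exact Ideal.mul_mem_left _ _ (hPv _ (Or.inl rfl))
  refine ⟨eval₂ ι u C, ?_, ?_⟩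
  · rw [eval₂_eq', eval_eq']
    push_cast
    rw [Finset.sum_mul]
    refine Finset.sum_congr rfl fun b hb => ?_
    have hN : N = ∑ l, b l := by
      rw [← hC (mem_support_iff.1 hb), Finsupp.weight_apply, Finsupp.sum_fintype _ _ (by simp)]
      simp
    rw [hN, mul_assoc, ← Finset.prod_pow_eq_pow_sum, ← Finset.prod_mul_distrib]
    congr 1
    refine Finset.prod_congr rfl fun l _ => ?_
    rw [← mul_pow]
    congr 1
    change (w l : K) / w j * w j = w l
    field_simp
  · rw [← hιP, ← Ideal.Quotient.eq_zero_iff_mem, ← Ideal.Quotient.eq_zero_iff_mem]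
    have e : Ideal.Quotient.mk P (eval₂ ι u C) =
        Ideal.Quotient.mk P (ι (eval (Pi.single j 1) C)) := by
      rw [eval₂_comp_left, ← RingHom.comp_apply (Ideal.Quotient.mk P) ι, eval₂_comp]
      refine congrArg (fun g => eval₂ ((Ideal.Quotient.mk P).comp ι) g C) ?_
      funext l
      by_cases hl : l = j
      · subst hl
        have : u l = 1 := Subtype.ext (div_self hj)
        simp [this]
      · simp only [Function.comp_apply, Pi.single_eq_of_ne hl, map_zero]
        exact Ideal.Quotient.eq_zero_iff_mem.2 (hPv _ (Or.inr ⟨l, hl, rfl⟩))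
    rw [e]

variable {j : Fin d} {B : LocalSubring K} {v : Fin d → B.toSubring}

theorem IsMonomialTransform.coe_eq (hT : IsMonomialTransform A w j B v) (l : Fin d) :
    (v l : K) = if l = j then (w j : K) else (w l : K) / (w j : K) := hT.1 l

theorem IsMonomialTransform.coe_self (hT : IsMonomialTransform A w j B v) :
    (v j : K) = w j := by
  rw [hT.coe_eq, if_pos rfl]

theorem IsMonomialTransform.coe_of_ne (hT : IsMonomialTransform A w j B v) {l : Fin d}
    (hl : l ≠ j) : (v l : K) = w l / w j := by
  rw [hT.coe_eq, if_neg hl]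

theorem IsMonomialTransform.blowupSubring_le (hT : IsMonomialTransform A w j B v) :
    blowupSubring A.toSubring (maximalIdeal A.toSubring) (w j) ≤ B.toSubring := by
  obtain ⟨-, P, -, _, rfl⟩ := hT
  exact LocalSubring.le_ofPrime _ _

theorem IsMonomialTransform.le (hT : IsMonomialTransform A w j B v) :
    A.toSubring ≤ B.toSubring :=
  (le_blowupSubring _ _ _).trans hT.blowupSubring_le

theorem IsMonomialTransform.div_pow_mem (hT : IsMonomialTransform A w j B v) (hw : IsQR w)
    {N : ℕ} {f : A.toSubring} (hf : f ∈ maximalIdeal A.toSubring ^ N) :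
    (f : K) / (w j : K) ^ N ∈ B.toSubring :=
  hT.blowupSubring_le (div_pow_mem_blowupSubring (hw.coe_param_ne_zero j) N hf)

theorem IsMonomialTransform.isNoetherianRing [IsNoetherianRing A.toSubring]
    (hT : IsMonomialTransform A w j B v) (hw : IsQR w) : IsNoetherianRing B.toSubring := by
  obtain ⟨-, P, -, _, rfl⟩ := hT
  have := isNoetherianRing_blowupSubring w (w j)
  rw [hw.span_range] at this
  exact IsLocalization.isNoetherianRing P.primeCompl _ this

theorem IsMonomialTransform.span_range (hT : IsMonomialTransform A w j B v) (hw : IsQR w) :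
    Ideal.span (Set.range v) = maximalIdeal B.toSubring := by
  obtain ⟨hv, P, hP, _, rfl⟩ := hT
  rw [← IsLocalization.AtPrime.map_eq_maximalIdeal P (LocalSubring.ofPrime _ P).toSubring]
  refine Eq.trans ?_ (congrArg (Ideal.map (algebraMap _ (LocalSubring.ofPrime _ P).toSubring))
    hP).symm
  rw [Ideal.map_span]
  congr 1
  ext z
  constructor
  · rintro ⟨l, rfl⟩
    refine ⟨⟨v l, ?_⟩, ⟨l, rfl⟩, rfl⟩
    rw [hv]
    split_ifs
    · exact le_blowupSubring _ _ _ (w j).2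
    · exact div_mem_blowupSubring _ (hw.param_mem l)
  · rintro ⟨f, ⟨l, hl⟩, rfl⟩
    exact ⟨l, Subtype.ext hl.symm⟩

/-- Elements of the transform as fractions of forms of the same degree, with a denominator that
involves the power of `w j`. -/
theorem IsMonomialTransform.exists_isHomogeneous (hT : IsMonomialTransform A w j B v)
    (hw : IsQR w) (z : B.toSubring) :
    ∃ (N : ℕ) (G C : MvPolynomial (Fin d) A.toSubring), G.IsHomogeneous N ∧ C.IsHomogeneous N ∧
      eval (Pi.single j 1) G ∉ maximalIdeal A.toSubring ∧ (z : K) * eval w G = eval w C ∧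
      (z ∉ maximalIdeal B.toSubring → eval (Pi.single j 1) C ∉ maximalIdeal A.toSubring) := by
  obtain ⟨hv, P, hP, _, rfl⟩ := hT
  have hj := hw.coe_param_ne_zero j
  have hPv : ∀ x : blowupSubring A.toSubring (maximalIdeal A.toSubring) (w j),
      (x : K) = w j ∨ (∃ l, l ≠ j ∧ (x : K) = w l / w j) → x ∈ P := by
    rintro x (hx | ⟨l, hl, hx⟩)
    · rw [hP]
      exact Ideal.subset_span ⟨j, by rw [hx, hv, if_pos rfl]⟩
    · rw [hP]
      exact Ideal.subset_span ⟨l, by rw [hx, hv, if_neg hl]⟩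
  obtain ⟨a, s, hs, h⟩ := mem_ofPrime_iff.1 z.2
  obtain ⟨N₁, h₁⟩ := exists_mul_pow_eq_of_mem_blowupSubring hj (hw.param_mem j) a.2
  obtain ⟨N₂, h₂⟩ := exists_mul_pow_eq_of_mem_blowupSubring hj (hw.param_mem j) s.2
  obtain ⟨f, hf, hf'⟩ := h₁ (max N₁ N₂) (le_max_left _ _)
  obtain ⟨g, hg, hg'⟩ := h₂ (max N₁ N₂) (le_max_right _ _)
  obtain ⟨C, hC, rfl⟩ := (mem_maximalIdeal_pow_iff_exists_isHomogeneous hw.span_range _ _).1 hf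
  obtain ⟨G, hG, rfl⟩ := (mem_maximalIdeal_pow_iff_exists_isHomogeneous hw.span_range _ _).1 hg
  obtain ⟨c, hc, hcP⟩ := exists_dehomogenization hw.span_range j hj hPv hC
  obtain ⟨c', hc', hcP'⟩ := exists_dehomogenization hw.span_range j hj hPv hG
  have hca : c = a := Subtype.ext (mul_right_cancel₀ (pow_ne_zero _ hj) (hc.trans hf'.symm))
  have hcs : c' = s := Subtype.ext (mul_right_cancel₀ (pow_ne_zero _ hj) (hc'.trans hg'.symm))
  subst hca hcs
  refine ⟨_, G, C, hG, hC, fun h0 => hs (hcP'.2 h0), ?_, fun hz h0 => hz ?_⟩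
  · rw [← hc', ← hc, ← mul_assoc, h]
  · have h1 : z * algebraMap _ (LocalSubring.ofPrime _ P).toSubring c' = algebraMap _ _ c :=
      Subtype.ext h
    have h2 : algebraMap _ (LocalSubring.ofPrime _ P).toSubring c ∈ maximalIdeal _ :=
      (coe_mem_maximalIdeal_ofPrime_iff c _ rfl).2 (hcP.2 h0)
    rw [← h1] at h2
    refine (Ideal.IsPrime.mem_or_mem inferInstance h2).resolve_right fun h3 => hs ?_
    exact (coe_mem_maximalIdeal_ofPrime_iff c' _ rfl).1 h3

theorem IsMonomialTransform.exists_isHomogeneous_finset (hT : IsMonomialTransform A w j B v)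
    (hw : IsQR w) {ι : Type*} (s : Finset ι) (z : ι → B.toSubring) :
    ∃ (N : ℕ) (G : MvPolynomial (Fin d) A.toSubring), G.IsHomogeneous N ∧
      eval (Pi.single j 1) G ∉ maximalIdeal A.toSubring ∧
      ∃ C : ι → MvPolynomial (Fin d) A.toSubring, ∀ i ∈ s, (C i).IsHomogeneous N ∧
        (z i : K) * eval w G = eval w (C i) ∧
      (z i ∉ maximalIdeal B.toSubring →
        eval (Pi.single j 1) (C i) ∉ maximalIdeal A.toSubring) := by
  classical
  induction s using Finset.induction_on with
  | empty =>
    exact ⟨0, 1, isHomogeneous_one _ _, by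
      rw [map_one]
      exact (Ideal.ne_top_iff_one _).1 (maximalIdeal.isMaximal _).ne_top, fun _ => 0, by simp⟩
  | insert i s hi ih =>
    obtain ⟨N, G, hG, hG1, C, hC⟩ := ih
    obtain ⟨M, G', D, hG', hD, hG1', hz, hz'⟩ := hT.exists_isHomogeneous hw (z i)
    have hmul : ∀ {x y : A.toSubring}, x ∉ maximalIdeal A.toSubring →
        y ∉ maximalIdeal A.toSubring → x * y ∉ maximalIdeal A.toSubring := fun hx hy hxy =>
      (Ideal.IsPrime.mem_or_mem inferInstance hxy).elim hx hy
    refine ⟨N + M, G * G', hG.mul hG', by rw [map_mul]; exact hmul hG1 hG1',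
      fun i' => if i' = i then G * D else C i' * G', ?_⟩
    intro i' hi'
    by_cases hii : i' = i
    · subst hii
      simp only [if_true]
      refine ⟨hG.mul hD, ?_, fun h => ?_⟩
      · rw [map_mul, map_mul]
        push_cast
        rw [← hz]; ring
      · rw [map_mul]; exact hmul hG1 (hz' h)
    · simp only [if_neg hii]
      obtain ⟨h1, h2, h3⟩ := hC i' ((Finset.mem_insert.1 hi').resolve_left hii)
      refine ⟨h1.mul hG', ?_, fun h => ?_⟩
      · rw [map_mul, map_mul]
        push_cast
        rw [← h2]; ring
      · rw [map_mul]; exact hmul (h3 h) hG1'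

/-- The monomial quadratic transform of a quasi-regular system of parameters is quasi-regular. -/
theorem IsMonomialTransform.isQR [IsNoetherianRing A.toSubring]
    (hT : IsMonomialTransform A w j B v) (hw : IsQR w) : IsQR v := by
  classical
  have hsp := hT.span_range hw
  have hx := hw.coe_param_ne_zero j
  have hBn := hT.isNoetherianRing hw
  refine IsQR.of_quotient hsp j (mem_nonZeroDivisors_of_ne_zero fun h0 => hx ?_) ?_
  · rw [← hT.coe_self, h0]; rfl
  intro r F hF hsupp hmem a₀
  by_contra ha₀
  have hFa₀ : coeff a₀ F ≠ 0 := fun h0 => ha₀ (h0 ▸ zero_mem _)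
  obtain ⟨y, hy, y', hy', hyy⟩ := Submodule.mem_sup.1 hmem
  obtain ⟨E, hE, rfl⟩ := (mem_maximalIdeal_pow_iff_exists_isHomogeneous hsp _ _).1 hy
  obtain ⟨e, rfl⟩ := Ideal.mem_span_singleton'.1 hy'
  obtain ⟨e', he'⟩ : ∃ e', eval v F = eval v (E.modMonomial (Finsupp.single j 1)) + e' * v j := by
    refine ⟨e + eval v (E.divMonomial (Finsupp.single j 1)), ?_⟩
    rw [← hyy, eval_eq_divMonomial_add_modMonomial v E j]
    ring
  have hE₀ := isHomogeneous_modMonomial hE j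
  have hEs : ∀ b, coeff b (E.modMonomial (Finsupp.single j 1)) ≠ 0 → b j = 0 :=
    fun b => coeff_modMonomial_single_ne_zero
  set E₀ := E.modMonomial (Finsupp.single j 1) with hE₀def
  -- common denominators
  obtain ⟨N, G, hG, -, C, hC⟩ := hT.exists_isHomogeneous_finset hw
    (ι := (Fin d →₀ ℕ) ⊕ (Fin d →₀ ℕ) ⊕ Unit)
    (Finset.disjSum F.support (Finset.disjSum E₀.support {()}))
    (Sum.elim (fun a => coeff a F) (Sum.elim (fun b => coeff b E₀) (fun _ => e')))
  have hCF : ∀ a ∈ F.support, _ := fun a ha => hC (Sum.inl a) (by simpa using ha)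
  have hCE : ∀ b ∈ E₀.support, _ := fun b hb => hC (Sum.inr (Sum.inl b)) (by simpa using hb)
  have hCe := hC (Sum.inr (Sum.inr ())) (by simp)
  simp only [Sum.elim_inl, Sum.elim_inr] at hCF hCE hCe
  have hclear : ∀ (r : ℕ) (F : MvPolynomial (Fin d) B.toSubring)
      (D : (Fin d →₀ ℕ) → MvPolynomial (Fin d) A.toSubring), F.IsHomogeneous r →
      (∀ a, coeff a F ≠ 0 → a j = 0) →
      (∀ a ∈ F.support, ((coeff a F : B.toSubring) : K) * eval w G = eval w (D a)) →
      ((eval v F : B.toSubring) : K) * (eval w G : A.toSubring) * (w j : K) ^ r =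
        (eval w (∑ a ∈ F.support, D a * monomial a 1) : A.toSubring) := by
    intro r F D hF hs hD
    rw [eval_eq', map_sum]
    push_cast
    rw [Finset.sum_mul, Finset.sum_mul]
    refine Finset.sum_congr rfl fun a ha => ?_
    rw [map_mul, eval_monomial, one_mul, Finsupp.prod_fintype _ _ (fun _ => pow_zero _)]
    push_cast
    rw [← hD a ha]
    have hr : r = ∑ l, a l := by
      rw [← hF (mem_support_iff.1 ha), Finsupp.weight_apply, Finsupp.sum_fintype _ _ (by simp)]
      simp
    have h1 : (∏ l, (v l : K) ^ a l) * (w j : K) ^ r = ∏ l, (w l : K) ^ a l := by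
      rw [hr, ← Finset.prod_pow_eq_pow_sum, ← Finset.prod_mul_distrib]
      refine Finset.prod_congr rfl fun l _ => ?_
      by_cases hl : l = j
      · subst hl
        rw [hs a (mem_support_iff.1 ha)]; simp
      · rw [hT.coe_of_ne hl, ← mul_pow, div_mul_cancel₀ _ hx]
    rw [← h1]; ring
  have k1 := hclear r F (fun a => C (Sum.inl a)) hF hsupp (fun a ha => (hCF a ha).2.1)
  have k2 := hclear (r + 1) E₀ (fun b => C (Sum.inr (Sum.inl b))) hE₀ hEs
    (fun b hb => (hCE b hb).2.1)
  set S₁ := ∑ a ∈ F.support, C (Sum.inl a) * monomial a 1 with hS₁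
  set S₂ := ∑ b ∈ E₀.support, C (Sum.inr (Sum.inl b)) * monomial b 1 with hS₂
  have hS₁h : S₁.IsHomogeneous (N + r) := by
    refine IsHomogeneous.sum _ _ _ fun a ha => (hCF a ha).1.mul (isHomogeneous_monomial _ ?_)
    rw [← hF (mem_support_iff.1 ha), Finsupp.degree_eq_weight_one]
    rfl
  have hS₂h : S₂.IsHomogeneous (N + r + 1) := by
    refine IsHomogeneous.sum _ _ _ fun b hb => ?_
    rw [add_assoc]
    refine (hCE b hb).1.mul (isHomogeneous_monomial _ ?_)
    rw [← hE₀ (mem_support_iff.1 hb), Finsupp.degree_eq_weight_one]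
    rfl
  have hkey : eval w (S₁ * X j - S₂) = w j ^ (r + 2) * eval w (C (Sum.inr (Sum.inr ()))) := by
    apply Subtype.ext
    rw [map_sub, map_mul, eval_X]
    push_cast
    rw [← k1, ← k2, ← hCe.2.1, he']
    push_cast
    rw [hT.coe_self]
    ring
  have hco := hw.coeff_mem (N + r + 1) (S₁ * X j - S₂)
    ((hS₁h.mul (isHomogeneous_X _ j)).sub hS₂h) (by
      rw [hkey]
      have := Ideal.mul_mem_mul (Ideal.pow_mem_pow (hw.param_mem j) (r + 2))
        (eval_mem_maximalIdeal_pow hw.span_range hCe.1)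
      rw [← pow_add] at this
      exact Ideal.pow_le_pow_right (by omega) this) (a₀ + Finsupp.single j (N + 1))
  have hdeg : ∀ {R : Type _} [CommRing R] {t : ℕ} {F : MvPolynomial (Fin d) R},
      F.IsHomogeneous t → ∀ a ∈ F.support, t = ∑ l, a l := by
    intro R _ t F hF a ha
    rw [← hF (mem_support_iff.1 ha), Finsupp.weight_apply, Finsupp.sum_fintype _ _ (by simp)]
    simp
  have ha₀j := hsupp a₀ hFa₀
  have ha₀s := mem_support_iff.2 hFa₀
  have hle : ∀ a : Fin d →₀ ℕ, a j = 0 → a ≤ a₀ + Finsupp.single j (N + 1) → a ≤ a₀ := by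
    intro a haj ha l
    by_cases hl : l = j
    · subst hl; omega
    · have := ha l
      rwa [Finsupp.add_apply, Finsupp.single_eq_of_ne hl, add_zero] at this
  have hc2 : coeff (a₀ + Finsupp.single j (N + 1)) S₂ = 0 := by
    rw [hS₂, coeff_sum]
    refine Finset.sum_eq_zero fun b hb => ?_
    rw [coeff_mul_monomial', if_neg]
    intro hba
    have h1 := hle b (hEs b (mem_support_iff.1 hb)) hba
    have h2 := Finset.sum_le_sum (s := Finset.univ) fun l _ => h1 l
    have h3 := hdeg hE₀ b hb
    have h4 := hdeg hF a₀ ha₀s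
    omega
  have hc1 : coeff (a₀ + Finsupp.single j (N + 1)) (S₁ * X j) =
      coeff (Finsupp.single j N) (C (Sum.inl a₀)) := by
    rw [Finsupp.single_add, ← add_assoc, coeff_mul_X, hS₁, coeff_sum, Finset.sum_eq_single a₀]
    · rw [add_comm a₀, coeff_mul_monomial, mul_one]
    · intro a ha hne
      rw [coeff_mul_monomial', if_neg]
      intro hba
      have h1 := hle a (hsupp a (mem_support_iff.1 ha)) (hba.trans (by
        gcongr
        omega))
      have h3 := hdeg hF a ha
      have h4 := hdeg hF a₀ ha₀s
      apply hne
      ext l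
      exact (Finset.sum_eq_sum_iff_of_le fun l _ => h1 l).1 (h3.symm.trans h4) l
        (Finset.mem_univ l)
    · exact fun h => absurd ha₀s h
  rw [coeff_sub, hc1, hc2, sub_zero, ← eval_single_eq_coeff (hCF a₀ ha₀s).1] at hco
  exact (hCF a₀ ha₀s).2.2 ha₀ hco

theorem IsMonomialTransform.coe_mem_maximalIdeal (hT : IsMonomialTransform A w j B v)
    (hw : IsQR w) {f : A.toSubring} (hf : f ∈ maximalIdeal A.toSubring) :
    Subring.inclusion hT.le f ∈ maximalIdeal B.toSubring := by
  have hv := hT.span_range hw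
  rw [← hw.span_range] at hf
  obtain ⟨g, rfl⟩ := Ideal.mem_span_range_iff_exists_fun.1 hf
  rw [map_sum]
  refine Ideal.sum_mem _ fun l _ => ?_
  rw [map_mul]
  refine Ideal.mul_mem_left _ _ ?_
  by_cases hl : l = j
  · have : Subring.inclusion hT.le (w l) = v l := Subtype.ext (by
      rw [hl, hT.coe_self]; rfl)
    rw [this, ← hv]
    exact Ideal.subset_span ⟨l, rfl⟩
  · have : Subring.inclusion hT.le (w l) = v l * v j := Subtype.ext (by
      push_cast
      rw [hT.coe_of_ne hl, hT.coe_self, div_mul_cancel₀ _ (hw.coe_param_ne_zero j)]; rfl)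
    rw [this, ← hv]
    exact Ideal.mul_mem_right _ _ (Ideal.subset_span ⟨l, rfl⟩)

end Transform

/-! ### Integral closure of ideals -/

section Closure

variable {A : Type*} [CommRing A]

theorem IsIntegralOverIdeal.mono {I J : Ideal A} (h : I ≤ J) {f : A}
    (hf : IsIntegralOverIdeal I f) : IsIntegralOverIdeal J f := by
  obtain ⟨n, hn, r, hr, he⟩ := hf
  exact ⟨n, hn, r, fun i => Ideal.pow_right_mono h i (hr i), he⟩

theorem IsIntegralOverIdeal.of_pow_mem {I : Ideal A} {f : A} {n : ℕ} (hn : 0 < n)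
    (hf : f ^ n ∈ I ^ n) : IsIntegralOverIdeal I f := by
  classical
  refine ⟨n, hn, fun i => if i = n then -f ^ n else 0, fun i => ?_, ?_⟩
  · dsimp only
    split_ifs with h
    · rw [h]; exact neg_mem hf
    · exact zero_mem _
  · rw [Finset.sum_eq_single n]
    · simp
    · intro b _ hb
      simp only [if_neg hb, zero_mul]
    · intro h
      exact absurd (Finset.mem_Icc.2 ⟨hn, le_rfl⟩) h

/-- Some power of `f` lies in the same power of `I`. -/
def IsPowerIntegral (I : Ideal A) (f : A) : Prop := ∃ n : ℕ, 0 < n ∧ f ^ n ∈ I ^ n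

theorem IsPowerIntegral.isIntegralOverIdeal {I : Ideal A} {f : A} (h : IsPowerIntegral I f) :
    IsIntegralOverIdeal I f := by
  obtain ⟨n, hn, hf⟩ := h
  exact .of_pow_mem hn hf

theorem IsPowerIntegral.of_mem {I : Ideal A} {f : A} (h : f ∈ I) : IsPowerIntegral I f :=
  ⟨1, one_pos, by simpa using h⟩

theorem IsPowerIntegral.mul_left {I : Ideal A} {f : A} (h : IsPowerIntegral I f) (g : A) :
    IsPowerIntegral I (g * f) := by
  obtain ⟨n, hn, hf⟩ := h
  exact ⟨n, hn, by rw [mul_pow]; exact Ideal.mul_mem_left _ _ hf⟩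

theorem IsPowerIntegral.of_pow_succ_eq {I : Ideal A} {f g h : A} {p : ℕ} (hg : IsPowerIntegral I g)
    (hh : IsPowerIntegral I h) (he : f ^ (p + 1) = g ^ p * h) : IsPowerIntegral I f := by
  obtain ⟨n, hn, hg⟩ := hg
  obtain ⟨m, hm, hh⟩ := hh
  refine ⟨(p + 1) * (n * m), by positivity, ?_⟩
  have e : f ^ ((p + 1) * (n * m)) = (g ^ n) ^ (p * m) * (h ^ m) ^ n := by
    rw [pow_mul, he]; ring
  have e' : I ^ ((p + 1) * (n * m)) = (I ^ n) ^ (p * m) * (I ^ m) ^ n := by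
    rw [← pow_mul, ← pow_mul, ← pow_add]; congr 1; ring
  rw [e, e']
  exact Ideal.mul_mem_mul (Ideal.pow_mem_pow hg _) (Ideal.pow_mem_pow hh _)

/-- If the `δ`-th powers of the parameters dividing a monomial of degree at least `δ` lie in `I`,
then the monomial is integral over `I`. -/
theorem isPowerIntegral_monomialIn {d : ℕ} {w : Fin d → A} {I : Ideal A} {δ : ℕ} (hδ : 0 < δ)
    {a : Fin d → ℕ} (ha : δ ≤ ∑ l, a l) (h : ∀ l, a l ≠ 0 → w l ^ δ ∈ I) :
    IsPowerIntegral I (monomialIn w a) := by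
  refine ⟨δ, hδ, Ideal.pow_le_pow_right ha ?_⟩
  rw [monomialIn, ← Finset.prod_pow, ← Finset.prod_pow_eq_pow_sum]
  refine Ideal.prod_mem_prod fun l _ => ?_
  by_cases hl : a l = 0
  · simp [hl]
  · rw [← pow_mul, mul_comm, pow_mul]
    exact Ideal.pow_mem_pow (h l hl) _

variable [IsLocalRing A] {d : ℕ} {w : Fin d → A}

theorem IsQR.pow_notMem_pow (h : IsQR w) {f : A} {t : ℕ} (hf : f ∉ maximalIdeal A ^ (t + 1))
    (n : ℕ) : f ^ n ∉ maximalIdeal A ^ (n * t + 1) := by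
  induction n with
  | zero =>
    simp only [pow_zero, zero_mul, zero_add, pow_one]
    exact (Ideal.ne_top_iff_one _).1 (maximalIdeal.isMaximal A).ne_top
  | succ n ih =>
    rw [pow_succ f, add_mul, one_mul]
    exact h.mul_notMem_pow ih hf

/-- Powers of the maximal ideal are integrally closed. -/
theorem IsQR.mem_pow_of_isIntegralOverIdeal (h : IsQR w) {I : Ideal A} {δ : ℕ}
    (hI : I ≤ maximalIdeal A ^ δ) {f : A} (hf : IsIntegralOverIdeal I f) :
    f ∈ maximalIdeal A ^ δ := by
  rcases δ with _ | δ
  · simp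
  by_contra hcon
  obtain ⟨t, ht, hft, hft'⟩ := exists_mem_pow_notMem_pow_succ hcon
  obtain ⟨n, hn, r, hr, he⟩ := hf
  refine h.pow_notMem_pow hft' n ?_
  rw [eq_neg_of_add_eq_zero_left he]
  refine neg_mem (Ideal.sum_mem _ fun i hi => ?_)
  rw [Finset.mem_Icc] at hi
  have h1 := Ideal.mul_mem_mul (Ideal.pow_right_mono hI i (hr i)) (Ideal.pow_mem_pow hft (n - i))
  rw [← pow_mul, ← pow_mul, ← pow_add] at h1
  refine Ideal.pow_le_pow_right ?_ h1
  obtain ⟨k, rfl⟩ := Nat.exists_eq_add_of_le hi.2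
  rw [Nat.add_sub_cancel_left]
  nlinarith [hi.1]

end Closure

/-! ### The inverse transform of a complete monomial ideal -/

/-- A complete monomial ideal that is primary for the maximal ideal. -/
structure IsCompleteMonomial {A : Type*} [CommRing A] [IsLocalRing A] {d : ℕ} (w : Fin d → A)
    (I : Ideal A) : Prop where
  eq_span : I = Ideal.span (monomialIn w '' {a | monomialIn w a ∈ I})
  complete : ∀ f, IsIntegralOverIdeal I f → f ∈ I
  pow_le : ∃ N, maximalIdeal A ^ N ≤ I
  ne_top : I ≠ ⊤

/-- The relation between the exponent sets `E'` of a complete primary monomial ideal and `E` of its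
complete inverse transform of order `δ` in direction `k`. -/
structure InverseStep {d : ℕ} (k : Fin d) (δ : ℕ) (E E' : Set (Fin d → ℕ)) : Prop where
  pos : 0 < δ
  isUpperSet : IsUpperSet E
  isUpperSet' : IsUpperSet E'
  zero_notMem' : (0 : Fin d → ℕ) ∉ E'
  mem_iff : ∀ a, a ∈ E ↔ δ ≤ ∑ l, a l ∧ Function.update a k (∑ l, a l - δ) ∈ E'
  le : ∀ b, Minimal (· ∈ E') b → ∑ l ∈ Finset.univ.erase k, b l ≤ δ + b k
  exists_eq : ∃ b, Minimal (· ∈ E') b ∧ ∑ l ∈ Finset.univ.erase k, b l = δ + b k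
  mem_of_zero : ∀ a, a k = 0 → δ ≤ ∑ l, a l → a ∈ E
  exists_single : ∀ l, ∃ t : ℕ, Pi.single l t ∈ E'

theorem isUpperSet_setOf_monomialIn_mem {A : Type*} [CommRing A] {d : ℕ} (w : Fin d → A)
    (I : Ideal A) : IsUpperSet {a | monomialIn w a ∈ I} := by
  intro a b hab ha
  have : monomialIn w b = monomialIn w (b - a) * monomialIn w a := by
    rw [← monomialIn_add, tsub_add_cancel_of_le hab]
  change monomialIn w b ∈ I
  rw [this]
  exact Ideal.mul_mem_left _ _ ha

theorem exists_sub_single_mem_of_not_minimal {d : ℕ} {E : Set (Fin d → ℕ)} (hE : IsUpperSet E)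
    {b : Fin d → ℕ} (hb : b ∈ E) (hmin : ¬ Minimal (· ∈ E) b) :
    ∃ l, 0 < b l ∧ b - Pi.single l 1 ∈ E := by
  obtain ⟨c, hcb, hc⟩ := exists_minimal_le_of_mem hb
  have hne : c ≠ b := fun h => hmin (h ▸ hc)
  obtain ⟨l, hl⟩ : ∃ l, c l < b l := by
    by_contra hcon
    push Not at hcon
    exact hne (le_antisymm hcb hcon)
  refine ⟨l, by omega, hE ?_ hc.prop⟩
  intro m
  by_cases hm : m = l
  · subst hm
    simp only [Pi.sub_apply, Pi.single_eq_same]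
    omega
  · simp only [Pi.sub_apply, Pi.single_eq_of_ne hm]
    exact hcb m

theorem sum_erase_add_apply {d : ℕ} (k : Fin d) (a : Fin d → ℕ) :
    ∑ l ∈ Finset.univ.erase k, a l + a k = ∑ l, a l :=
  Finset.sum_erase_add _ _ (Finset.mem_univ k)

theorem sum_erase_update {d : ℕ} (k : Fin d) (a : Fin d → ℕ) (t : ℕ) :
    ∑ l ∈ Finset.univ.erase k, Function.update a k t l = ∑ l ∈ Finset.univ.erase k, a l :=
  Finset.sum_congr rfl fun l hl => by rw [Function.update_of_ne (Finset.ne_of_mem_erase hl)]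

theorem sum_update_eq {d : ℕ} (k : Fin d) (a : Fin d → ℕ) (t : ℕ) :
    ∑ l, Function.update a k t l = ∑ l ∈ Finset.univ.erase k, a l + t := by
  rw [← sum_erase_add_apply k, sum_erase_update, Function.update_self]

section Inverse

variable {K : Type*} [Field K] {d : ℕ} {A : LocalSubring K} {w : Fin d → A.toSubring} {j : Fin d}
  {B : LocalSubring K} {v : Fin d → B.toSubring}

theorem IsMonomialTransform.coe_mul_coe_self (hT : IsMonomialTransform A w j B v) (hw : IsQR w)
    {l : Fin d} (hl : l ≠ j) : (w l : K) = w j * v l := by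
  rw [hT.coe_of_ne hl, mul_div_cancel₀ _ (hw.coe_param_ne_zero j)]

theorem IsMonomialTransform.coe_monomialIn (hT : IsMonomialTransform A w j B v) (hw : IsQR w)
    {a : Fin d → ℕ} {δ : ℕ} (ha : δ ≤ ∑ l, a l) :
    ((monomialIn w a : A.toSubring) : K) = (w j : K) ^ δ *
      (monomialIn v (Function.update a j (∑ l, a l - δ)) : B.toSubring) := by
  obtain ⟨t, ht⟩ := Nat.exists_eq_add_of_le ha
  rw [monomialIn, monomialIn, ← Finset.mul_prod_erase _ _ (Finset.mem_univ j),
    ← Finset.mul_prod_erase _ _ (Finset.mem_univ j)]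
  push_cast
  have e1 : ∏ l ∈ Finset.univ.erase j, (w l : K) ^ a l =
      (w j : K) ^ (∑ l ∈ Finset.univ.erase j, a l) *
      ∏ l ∈ Finset.univ.erase j, (v l : K) ^ a l := by
    rw [← Finset.prod_pow_eq_pow_sum, ← Finset.prod_mul_distrib]
    refine Finset.prod_congr rfl fun l hl => ?_
    rw [← mul_pow, ← hT.coe_mul_coe_self hw (Finset.ne_of_mem_erase hl)]
  have e2 : ∏ l ∈ Finset.univ.erase j, (v l : K) ^ Function.update a j (∑ l, a l - δ) l =
      ∏ l ∈ Finset.univ.erase j, (v l : K) ^ a l :=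
    Finset.prod_congr rfl fun l hl => by rw [Function.update_of_ne (Finset.ne_of_mem_erase hl)]
  rw [e1, e2, Function.update_self, hT.coe_self, ← mul_assoc, ← mul_assoc, ← pow_add, ← pow_add]
  congr 2
  rw [add_comm, sum_erase_add_apply]
  omega

theorem IsMonomialTransform.mem_pow_of_coe_eq_mul (hT : IsMonomialTransform A w j B v)
    (hw : IsQR w) {f : A.toSubring} {g : B.toSubring} {δ : ℕ} (h : (f : K) = (w j : K) ^ δ * g) :
    f ∈ maximalIdeal A.toSubring ^ δ := by
  rcases δ with _ | δ
  · simp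
  obtain ⟨N, G, C, hG, hC, hG1, he, -⟩ := hT.exists_isHomogeneous hw g
  by_contra hcon
  have hG0 : MvPolynomial.eval w G ∉ maximalIdeal A.toSubring ^ (N + 1) := by
    intro h0
    rw [eval_single_eq_coeff hG] at hG1
    exact hG1 (hw.coeff_mem N G hG h0 _)
  refine hw.mul_notMem_pow hcon hG0 ?_
  have : f * MvPolynomial.eval w G = w j ^ (δ + 1) * MvPolynomial.eval w C := by
    apply Subtype.ext
    push_cast
    rw [h, mul_assoc, he]
  rw [this, show δ + N + 1 = δ + 1 + N by omega, pow_add]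
  exact Ideal.mul_mem_mul (Ideal.pow_mem_pow (hw.param_mem j) _)
    (eval_mem_maximalIdeal_pow hw.span_range hC)

/-- The ideal `x ^ δ I' ∩ A`. -/
def scaledContraction (A : LocalSubring K) (B : LocalSubring K) (h : A.toSubring ≤ B.toSubring)
    (x : K) (I' : Ideal B.toSubring) : Ideal A.toSubring where
  carrier := {f | ∃ g ∈ I', (f : K) = x * g}
  zero_mem' := ⟨0, zero_mem _, by simp⟩
  add_mem' := by
    rintro f f' ⟨g, hg, e⟩ ⟨g', hg', e'⟩
    exact ⟨g + g', add_mem hg hg', by push_cast; rw [e, e', mul_add]⟩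
  smul_mem' := by
    rintro c f ⟨g, hg, e⟩
    refine ⟨Subring.inclusion h c * g, Ideal.mul_mem_left _ _ hg, ?_⟩
    rw [smul_eq_mul]
    push_cast
    rw [e, mul_left_comm]
    rfl

theorem exists_of_mem_scaledContraction_pow {h : A.toSubring ≤ B.toSubring} {x : K}
    {I' : Ideal B.toSubring} (i : ℕ) : ∀ {f : A.toSubring},
    f ∈ scaledContraction A B h x I' ^ i → ∃ g ∈ I' ^ i, (f : K) = x ^ i * g := by
  induction i with
  | zero => exact fun {f} _ => ⟨Subring.inclusion h f, by simp, by simp⟩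
  | succ i ih =>
    intro f hf
    rw [pow_succ] at hf
    refine Submodule.mul_induction_on hf (fun a ha b hb => ?_) (fun a b ha hb => ?_)
    · obtain ⟨g, hg, e⟩ := ih ha
      obtain ⟨g', hg', e'⟩ := hb
      refine ⟨g * g', by rw [pow_succ]; exact Ideal.mul_mem_mul hg hg', ?_⟩
      push_cast
      rw [e, e']; ring
    · obtain ⟨g, hg, e⟩ := ha
      obtain ⟨g', hg', e'⟩ := hb
      exact ⟨g + g', add_mem hg hg', by push_cast; rw [e, e', mul_add]⟩

theorem IsMonomialTransform.mem_scaledContraction_of_isIntegralOverIdeal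
    (hT : IsMonomialTransform A w j B v) (hw : IsQR w) {I' : Ideal B.toSubring}
    (hI' : ∀ g, IsIntegralOverIdeal I' g → g ∈ I') {δ : ℕ} {f : A.toSubring}
    (hf : IsIntegralOverIdeal (scaledContraction A B hT.le ((w j : K) ^ δ) I') f) :
    f ∈ scaledContraction A B hT.le ((w j : K) ^ δ) I' := by
  have hle : scaledContraction A B hT.le ((w j : K) ^ δ) I' ≤ maximalIdeal A.toSubring ^ δ := by
    rintro f ⟨g, -, hfg⟩
    exact hT.mem_pow_of_coe_eq_mul hw hfg
  have hfm := hw.mem_pow_of_isIntegralOverIdeal hle hf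
  have hx : (w j : K) ^ δ ≠ 0 := pow_ne_zero _ (hw.coe_param_ne_zero j)
  let g : B.toSubring := ⟨_, hT.div_pow_mem hw hfm⟩
  have hg : (f : K) = (w j : K) ^ δ * g := by
    change (f : K) = (w j : K) ^ δ * (f / (w j : K) ^ δ)
    rw [mul_div_cancel₀ _ hx]
  obtain ⟨n, hn, r, hr, he⟩ := hf
  choose ρ hρ hρe using fun i => exists_of_mem_scaledContraction_pow i (hr i)
  refine ⟨g, hI' g ⟨n, hn, ρ, hρ, ?_⟩, hg⟩
  apply Subtype.ext
  apply mul_left_cancel₀ (pow_ne_zero n hx)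
  have he' := congrArg (fun z : A.toSubring => (z : K)) he
  push_cast at he' ⊢
  rw [mul_zero, ← he', mul_add, Finset.mul_sum, hg, mul_pow]
  congr 1
  refine Finset.sum_congr rfl fun i hi => ?_
  rw [Finset.mem_Icc] at hi
  rw [hρe i, mul_pow]
  obtain ⟨k, rfl⟩ := Nat.exists_eq_add_of_le hi.2
  rw [Nat.add_sub_cancel_left, pow_add]
  ring

/-- Basic data of the inverse transform: the order is a positive natural number, attained, and the
parameters `w l`, `l ≠ j`, to this power lie in the ideal. -/
theorem IsCompleteMonomial.inverseTransformOrder_spec [Nontrivial (Fin d)] (hv : IsQR v)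
    {I' : Ideal B.toSubring} (hI' : IsCompleteMonomial v I') (j : Fin d) :
    ∃ δ : ℕ, inverseTransformOrder v j I' = δ ∧ 0 < δ ∧
      (∀ b ∈ minimalMonomials v I', ∑ l ∈ Finset.univ.erase j, b l ≤ δ + b j) ∧
      (∃ b ∈ minimalMonomials v I', ∑ l ∈ Finset.univ.erase j, b l = δ + b j) ∧
      ∀ l, l ≠ j → v l ^ δ ∈ I' := by
  obtain ⟨N, hN⟩ := hI'.pow_le
  set φ : (Fin d → ℕ) → ℤ := fun α => (∑ l ∈ Finset.univ.erase j, (α l : ℤ)) - (α j : ℤ) with hφ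
  have hfin : (minimalMonomials v I').Finite := finite_setOf_minimal {a | monomialIn v a ∈ I'}
  have hpure : ∀ l, ∃ s : ℕ, 0 < s ∧ Pi.single l s ∈ minimalMonomials v I' := by
    intro l
    have h1 : Pi.single l N ∈ {a | monomialIn v a ∈ I'} := by
      change monomialIn v _ ∈ I'
      rw [monomialIn_single]
      exact hN (Ideal.pow_mem_pow (hv.param_mem l) N)
    obtain ⟨b, hb, hbm⟩ := exists_minimal_le_of_mem h1
    have hbe : b = Pi.single l (b l) := by
      funext m
      by_cases hm : m = l
      · subst hm; simp
      · have h2 : b m ≤ (Pi.single l N : Fin d → ℕ) m := hb m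
        rw [Pi.single_eq_of_ne hm] at h2 ⊢
        exact Nat.le_zero.1 h2
    refine ⟨b l, ?_, hbe ▸ hbm⟩
    rw [Nat.pos_iff_ne_zero]
    intro h0
    rw [h0, Pi.single_zero] at hbe
    have := hbm.prop
    rw [hbe] at this
    change monomialIn v 0 ∈ I' at this
    rw [monomialIn_zero] at this
    exact hI'.ne_top ((Ideal.eq_top_iff_one _).2 this)
  have hφpure : ∀ l, l ≠ j → ∀ s : ℕ, φ (Pi.single l s) = s := by
    intro l hl s
    rw [hφ]
    dsimp only
    rw [Finset.sum_eq_single l, Pi.single_eq_same, Pi.single_eq_of_ne hl.symm]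
    · simp
    · intro m _ hm
      rw [Pi.single_eq_of_ne hm]; simp
    · intro h
      exact absurd (Finset.mem_erase.2 ⟨hl, Finset.mem_univ _⟩) h
  have hne : (φ '' minimalMonomials v I').Nonempty := by
    obtain ⟨s, -, h⟩ := hpure j
    exact ⟨_, _, h, rfl⟩
  have hbdd : BddAbove (φ '' minimalMonomials v I') := (hfin.image φ).bddAbove
  obtain ⟨b₀, hb₀, hb₀e⟩ := hne.csSup_mem (hfin.image φ)
  have hle : ∀ b ∈ minimalMonomials v I', φ b ≤ sSup (φ '' minimalMonomials v I') :=
    fun b hb => le_csSup hbdd ⟨b, hb, rfl⟩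
  obtain ⟨l₀, hl₀⟩ := exists_ne j
  obtain ⟨s₀, hs₀, hs₀m⟩ := hpure l₀
  have h1 := hle _ hs₀m
  rw [hφpure l₀ hl₀] at h1
  have hcast : ∀ b : Fin d → ℕ, φ b = ((∑ l ∈ Finset.univ.erase j, b l : ℕ) : ℤ) - (b j : ℤ) := by
    intro b; simp [hφ]
  obtain ⟨δ, hδ⟩ := Int.eq_ofNat_of_zero_le (a := sSup (φ '' minimalMonomials v I')) (by omega)
  refine ⟨δ, hδ, by omega, fun b hb => ?_, ⟨b₀, hb₀, ?_⟩, fun l hl => ?_⟩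
  · have := hle b hb
    rw [hcast, hδ] at this
    omega
  · rw [hcast, hδ] at hb₀e
    omega
  · obtain ⟨s, hs, hsm⟩ := hpure l
    have h2 := hle _ hsm
    rw [hφpure l hl, hδ] at h2
    have h3 : v l ^ s ∈ I' := by
      have := Minimal.prop (P := fun β => monomialIn v β ∈ I') hsm
      rwa [monomialIn_single] at this
    exact I'.pow_mem_of_pow_mem h3 (by exact_mod_cast h2)

/-- The complete inverse transform of a complete primary monomial ideal is a complete primary
monomial ideal, described by `InverseStep`. -/
theorem IsMonomialTransform.inverseStep [Nontrivial (Fin d)] [IsNoetherianRing A.toSubring]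
    (hT : IsMonomialTransform A w j B v) (hw : IsQR w) {I' : Ideal B.toSubring}
    (hI' : IsCompleteMonomial v I') {I : Ideal A.toSubring}
    (hI : I = completeInverseTransform A w j B v I') :
    IsCompleteMonomial w I ∧ ∃ δ : ℕ,
      InverseStep j δ {a | monomialIn w a ∈ I} {a | monomialIn v a ∈ I'} ∧
      ∀ f : A.toSubring, f ∈ I ↔ ∃ g ∈ I', (f : K) = (w j : K) ^ δ * g := by
  classical
  have hv := hT.isQR hw
  obtain ⟨δ, hδe, hδ, hle, heq, hpure⟩ := hI'.inverseTransformOrder_spec hv j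
  have hx : (w j : K) ≠ 0 := hw.coe_param_ne_zero j
  have hxδ : (w j : K) ^ δ ≠ 0 := pow_ne_zero _ hx
  set E' : Set (Fin d → ℕ) := {a | monomialIn v a ∈ I'} with hE'
  have hE'u : IsUpperSet E' := isUpperSet_setOf_monomialIn_mem v I'
  set T : (Fin d → ℕ) → (Fin d → ℕ) := fun a => Function.update a j (∑ l, a l - δ) with hTdef
  set E : Set (Fin d → ℕ) := {a | δ ≤ ∑ l, a l ∧ T a ∈ E'} with hE
  have hTmono : ∀ {a b : Fin d → ℕ}, a ≤ b → T a ≤ T b := by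
    intro a b hab m
    have h1 : ∑ l, a l ≤ ∑ l, b l := Finset.sum_le_sum fun l _ => hab l
    by_cases hm : m = j
    · subst hm
      simp only [hTdef, Function.update_self]
      omega
    · simp only [hTdef, Function.update_of_ne hm]
      exact hab m
  have hEu : IsUpperSet E := fun a b hab ha =>
    ⟨ha.1.trans (Finset.sum_le_sum fun l _ => hab l), hE'u (hTmono hab) ha.2⟩
  have hmon : ∀ {a : Fin d → ℕ}, δ ≤ ∑ l, a l →
      ((monomialIn w a : A.toSubring) : K) = (w j : K) ^ δ * (monomialIn v (T a) : B.toSubring) :=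
    fun ha => hT.coe_monomialIn hw ha
  obtain ⟨N, hN⟩ := hI'.pow_le
  have hNE' : ∀ b : Fin d → ℕ, N ≤ ∑ l, b l → b ∈ E' := fun b hb =>
    hN (Ideal.pow_le_pow_right hb (monomialIn_mem_maximalIdeal_pow hv.span_range b))
  have hsumT : ∀ a, ∑ l, T a l = ∑ l ∈ Finset.univ.erase j, a l + (∑ l, a l - δ) :=
    fun a => sum_update_eq j a _
  -- the contraction is monomial
  set I₀ : Ideal A.toSubring := scaledContraction A B hT.le ((w j : K) ^ δ) I' with hI₀
  have hmemI₀ : ∀ {f : A.toSubring}, f ∈ I₀ ↔ ∃ g ∈ I', (f : K) = (w j : K) ^ δ * g := Iff.rfl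
  have hEI₀ : Ideal.span (monomialIn w '' E) ≤ I₀ := by
    rw [Ideal.span_le]
    rintro _ ⟨a, ha, rfl⟩
    exact ⟨monomialIn v (T a), ha.2, hmon ha.1⟩
  have hpow : maximalIdeal A.toSubring ^ (δ + N) ≤ Ideal.span (monomialIn w '' E) := by
    intro f hf
    obtain ⟨s, c, hs, rfl⟩ := exists_sum_of_mem_maximalIdeal_pow hw.span_range hf
    refine Ideal.sum_mem _ fun a ha =>
      mul_mem_span_monomialIn_of_mem (E := E) ⟨?_, hNE' _ ?_⟩ _
    · have := hs a ha; omega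
    · rw [hsumT]
      have := hs a ha
      omega
  have hI₀E : I₀ ≤ Ideal.span (monomialIn w '' E) := by
    intro f hf
    obtain ⟨g, hg, hfg⟩ := hmemI₀.1 hf
    obtain ⟨s, u, hs, hu, hexp⟩ := hw.exists_expansion (hT.mem_pow_of_coe_eq_mul hw hfg) N
    have h1 : ∑ a ∈ s, u a * monomialIn w a ∈ I₀ := by
      have := I₀.sub_mem hf (hEI₀ (hpow hexp))
      rwa [sub_sub_cancel] at this
    obtain ⟨g', hg', hfg'⟩ := hmemI₀.1 h1
    let S : (Fin d → ℕ) → (Fin d → ℕ) := fun b =>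
      Function.update b j (δ + b j - ∑ l ∈ Finset.univ.erase j, b l)
    have hST : ∀ a, δ ≤ ∑ l, a l → S (T a) = a := by
      intro a ha
      simp only [S, hTdef, Function.update_idem, Function.update_self]
      rw [sum_erase_update, Function.update_eq_self_iff]
      have := sum_erase_add_apply j a
      omega
    have hinj : Set.InjOn T (s : Set (Fin d → ℕ)) := by
      intro a ha b hb hab
      rw [← hST a (hs a ha).1, hab, hST b (hs b hb).1]
    have h2 : g' = ∑ b ∈ s.image T, Subring.inclusion hT.le (u (S b)) * monomialIn v b := by
      rw [Finset.sum_image hinj]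
      apply Subtype.ext
      apply mul_left_cancel₀ hxδ
      rw [← hfg']
      push_cast
      rw [Finset.mul_sum]
      refine Finset.sum_congr rfl fun a ha => ?_
      rw [hST a (hs a ha).1, hmon (hs a ha).1, mul_left_comm]
      rfl
    rw [h2, hI'.eq_span] at hg'
    have h3 := hv.mem_of_sum_mem_span hE'u (fun b hb => by
      obtain ⟨a, ha, rfl⟩ := Finset.mem_image.1 hb
      rw [hST a (hs a ha).1]
      exact (hu a ha).map _) hg'
    rw [← sub_add_cancel f (∑ a ∈ s, u a * monomialIn w a)]
    refine Ideal.add_mem _ (hpow hexp) (Ideal.sum_mem _ fun a ha =>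
      mul_mem_span_monomialIn_of_mem (E := E) ⟨(hs a ha).1, h3 _ (Finset.mem_image_of_mem T ha)⟩ _)
  -- the generating ideal
  rw [completeInverseTransform, hδe] at hI
  set J : Ideal A.toSubring := Ideal.span
    ({f : A.toSubring | ∃ α ∈ minimalMonomials v I',
        (f : K) = (w j : K) ^ (δ : ℤ) * ((monomialIn v α : B.toSubring) : K)} ∪
      {f : A.toSubring | ∃ l, l ≠ j ∧ (f : K) = (w l : K) ^ (δ : ℤ)}) with hJ
  have hJpure : ∀ l, l ≠ j → w l ^ δ ∈ J := fun l hl =>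
    Ideal.subset_span (Or.inr ⟨l, hl, by push_cast; rw [zpow_natCast]⟩)
  have hJI₀ : J ≤ I₀ := by
    rw [hJ, Ideal.span_le]
    rintro f (⟨α, hα, hf⟩ | ⟨l, hl, hf⟩)
    · exact ⟨monomialIn v α, Minimal.prop (P := fun β => monomialIn v β ∈ I') hα, by
        rw [hf, zpow_natCast]⟩
    · refine ⟨v l ^ δ, hpure l hl, ?_⟩
      push_cast
      rw [hf, zpow_natCast, hT.coe_mul_coe_self hw hl, mul_pow]
  have hzero : ∀ c : Fin d → ℕ, c j = 0 → δ ≤ ∑ l, c l → IsPowerIntegral J (monomialIn w c) := by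
    intro c hc hcs
    refine isPowerIntegral_monomialIn hδ hcs fun l hl => hJpure l ?_
    rintro rfl
    exact hl hc
  have hint : ∀ (n : ℕ) (a : Fin d → ℕ), a ∈ E → ∑ l, T a l = n →
      IsPowerIntegral J (monomialIn w a) := by
    intro n
    induction n using Nat.strong_induction_on with
    | _ n ih =>
      intro a ha hn
      by_cases hmin : Minimal (· ∈ E') (T a)
      · refine .of_mem (Ideal.subset_span (Or.inl ⟨T a, hmin, ?_⟩))
        rw [hmon ha.1, zpow_natCast]
      · obtain ⟨l, hl, hlE⟩ := exists_sub_single_mem_of_not_minimal hE'u ha.2 hmin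
        by_cases haj : a j = 0
        · exact hzero a haj ha.1
        have hse := sum_erase_add_apply j a
        have hsingle : ∀ m : Fin d, 0 < a m → a - Pi.single m 1 + Pi.single m 1 = a := by
          intro m hm
          refine tsub_add_cancel_of_le ?_
          intro i
          by_cases hi : i = m
          · subst hi; rw [Pi.single_eq_same]; exact hm
          · simp [hi]
        by_cases hlj : l = j
        · subst hlj
          have h1 := hsingle l (by omega)
          have h2 := sum_add_single (a - Pi.single l 1) l 1
          rw [h1] at h2
          simp only [hTdef, Function.update_self] at hl
          have h3 : T (a - Pi.single l 1) = T a - Pi.single l 1 := by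
            funext m
            by_cases hm : m = l
            · subst hm
              simp only [hTdef, Function.update_self, Pi.sub_apply, Pi.single_eq_same]
              simp only [Pi.sub_apply] at h2
              omega
            · simp [hTdef, hm]
          have h4 : ∑ m, T (a - Pi.single l 1) m < n := by
            rw [hsumT, ← hn, hsumT]
            have h5 : ∑ m ∈ Finset.univ.erase l, (a - Pi.single l 1 : Fin d → ℕ) m =
                ∑ m ∈ Finset.univ.erase l, a m :=
              Finset.sum_congr rfl fun m hm => by simp [Finset.ne_of_mem_erase hm]
            rw [h5]
            simp only [Pi.sub_apply] at h2 ⊢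
            omega
          have h6 := ih _ h4 (a - Pi.single l 1) ⟨by omega, by rw [h3]; exact hlE⟩ rfl
          rw [← h1, monomialIn_add, mul_comm]
          exact h6.mul_left _
        · have hal : 0 < a l := by
            simpa only [hTdef, Function.update_of_ne hlj] using hl
          have h1 := hsingle l hal
          have h2 := sum_add_single (a - Pi.single l 1) l 1
          rw [h1] at h2
          set a' := a - Pi.single l 1 + Pi.single j 1 with ha'
          have h2' := sum_add_single (a - Pi.single l 1) j 1
          have hsum : ∑ m, a' m = ∑ m, a m := by rw [ha', h2', h2]
          have h3 : T a' = T a - Pi.single l 1 := by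
            funext m
            by_cases hm : m = j
            · subst hm
              simp only [hTdef, Function.update_self, Pi.sub_apply, hsum]
              simp [Ne.symm hlj]
            · simp [hTdef, hm, ha']
          have h4 : ∑ m, T a' m < n := by
            have h5 : T a - Pi.single l 1 + Pi.single l 1 = T a := by
              refine tsub_add_cancel_of_le ?_
              intro i
              by_cases hi : i = l
              · subst hi; rw [Pi.single_eq_same]; exact hl
              · simp [hi]
            have h6 := sum_add_single (T a - Pi.single l 1) l 1
            rw [h5] at h6
            rw [h3]
            omega
          have h7 := ih _ h4 a' ⟨by rw [hsum]; exact ha.1, by rw [h3]; exact hlE⟩ rfl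
          let c : Fin d → ℕ := Function.update (a - Pi.single l 1) j 0 + Pi.single l (a j + 1)
          have hcj : c j = 0 := by simp [c, Ne.symm hlj]
          have hcs : ∑ m, c m = ∑ m, a m := by
            rw [sum_add_single, sum_update_eq]
            have h8 := sum_erase_add_apply j (a - Pi.single l 1)
            have h9 : (a - Pi.single l 1 : Fin d → ℕ) j = a j := by simp [Ne.symm hlj]
            omega
          have h10 := hzero c hcj (by rw [hcs]; exact ha.1)
          refine h7.of_pow_succ_eq (p := a j) h10 ?_
          rw [monomialIn, monomialIn, monomialIn, ← Finset.prod_pow, ← Finset.prod_pow,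
            ← Finset.prod_mul_distrib]
          refine Finset.prod_congr rfl fun m _ => ?_
          rw [← pow_mul, ← pow_mul, ← pow_add]
          congr 1
          by_cases hm : m = j
          · subst hm
            rw [hcj]
            have h9 : a' m = a m + 1 := by simp [ha', Ne.symm hlj]
            rw [h9]; ring
          · by_cases hml : m = l
            · subst hml
              have h9 : a' m = a m - 1 := by simp [ha', hm]
              have h11 : c m = a m - 1 + (a j + 1) := by simp [c, hm]
              obtain ⟨t, ht⟩ := Nat.exists_eq_add_of_le' hal
              rw [h9, h11, ht, Nat.add_sub_cancel]; ring
            · have h9 : a' m = a m := by simp [ha', hm, hml]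
              have h11 : c m = a m := by simp [c, hm, hml]
              rw [h9, h11]; ring
  have hIE : I = Ideal.span (monomialIn w '' E) := by
    apply le_antisymm
    · refine le_trans ?_ hI₀E
      rw [hI]
      intro f hf
      exact hT.mem_scaledContraction_of_isIntegralOverIdeal hw hI'.complete
        (IsIntegralOverIdeal.mono hJI₀ hf)
    · rw [Ideal.span_le, hI]
      rintro _ ⟨a, ha, rfl⟩
      exact (hint _ a ha rfl).isIntegralOverIdeal
  have hII₀ : I = I₀ := hIE.trans (le_antisymm hEI₀ hI₀E)
  have hEe : {a | monomialIn w a ∈ I} = E := by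
    ext a
    rw [Set.mem_ofPred_eq, hIE]
    exact hw.monomialIn_mem_span_iff hEu a
  have hone : (1 : A.toSubring) ∉ I := by
    rw [hII₀]
    rintro ⟨g, -, hg⟩
    have h1 := Ideal.pow_le_self hδ.ne' (hT.mem_pow_of_coe_eq_mul hw hg)
    exact (Ideal.ne_top_iff_one _).1 (maximalIdeal.isMaximal _).ne_top h1
  refine ⟨⟨?_, ?_, ⟨δ + N, ?_⟩, (Ideal.ne_top_iff_one _).2 hone⟩, δ, ⟨hδ, ?_, hE'u, ?_, ?_, ?_, ?_,
    ?_, ?_⟩, fun f => by rw [hII₀]; exact hmemI₀⟩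
  · rw [hEe, hIE]
  · intro f hf
    rw [hII₀] at hf ⊢
    exact hT.mem_scaledContraction_of_isIntegralOverIdeal hw hI'.complete hf
  · rw [hIE]; exact hpow
  · exact isUpperSet_setOf_monomialIn_mem w I
  · intro h0
    change monomialIn v 0 ∈ I' at h0
    rw [monomialIn_zero] at h0
    exact hI'.ne_top ((Ideal.eq_top_iff_one _).2 h0)
  · intro a
    rw [hEe]
    rfl
  · exact hle
  · exact heq
  · intro a haj ha
    rw [hEe]
    refine ⟨ha, hI'.complete _ (IsPowerIntegral.isIntegralOverIdeal ?_)⟩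
    have h1 : a ≤ T a := by
      intro m
      by_cases hm : m = j
      · subst hm; rw [haj]; exact Nat.zero_le _
      · simp [hTdef, hm]
    have h2 : monomialIn v (T a) = monomialIn v (T a - a) * monomialIn v a := by
      rw [← monomialIn_add, tsub_add_cancel_of_le h1]
    rw [h2]
    refine (isPowerIntegral_monomialIn hδ ha fun l hl => hpure l ?_).mul_left _
    rintro rfl
    exact hl haj
  · exact fun l => ⟨N, hNE' _ (by simp)⟩

end Inverse

/-! ### Combinatorics of inverse transforms -/

section Combinatorics

variable {d : ℕ}

theorem Minimal.apply_le_of_mem {E : Set (Fin d → ℕ)} {a b : Fin d → ℕ} (ha : Minimal (· ∈ E) a)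
    (hb : b ∈ E) (hba : b ≤ a) (l : Fin d) : a l ≤ b l := ha.le_of_le hb hba l

theorem exists_minimal_single {E : Set (Fin d → ℕ)} {l : Fin d} {t : ℕ}
    (h : Pi.single l t ∈ E) : ∃ s, Minimal (· ∈ E) (Pi.single l s) := by
  obtain ⟨b, hb, hbm⟩ := exists_minimal_le_of_mem h
  have hbe : b = Pi.single l (b l) := by
    funext m
    by_cases hm : m = l
    · subst hm; simp
    · have h2 : b m ≤ (Pi.single l t : Fin d → ℕ) m := hb m
      rw [Pi.single_eq_of_ne hm] at h2 ⊢
      exact Nat.le_zero.1 h2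
  exact ⟨b l, hbe ▸ hbm⟩

theorem sum_erase_single_of_ne {k l : Fin d} (hl : l ≠ k) (s : ℕ) :
    ∑ m ∈ Finset.univ.erase k, (Pi.single l s : Fin d → ℕ) m = s := by
  have := sum_erase_add_apply k (Pi.single l s)
  rw [Pi.single_eq_of_ne hl.symm] at this
  simpa using this

theorem sub_single_apply_of_ne (a : Fin d → ℕ) {l m : Fin d} (h : m ≠ l) :
    (a - Pi.single l 1 : Fin d → ℕ) m = a m := by
  simp [h]

theorem sum_erase_sub_single (k : Fin d) {l : Fin d} {a : Fin d → ℕ} (hl : l ≠ k) (ha : 0 < a l) :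
    ∑ m ∈ Finset.univ.erase k, (a - Pi.single l 1 : Fin d → ℕ) m + 1 =
      ∑ m ∈ Finset.univ.erase k, a m := by
  have hmem : l ∈ Finset.univ.erase k := Finset.mem_erase.2 ⟨hl, Finset.mem_univ _⟩
  rw [← Finset.add_sum_erase _ _ hmem, ← Finset.add_sum_erase _ a hmem]
  have h1 : ∑ m ∈ (Finset.univ.erase k).erase l, (a - Pi.single l 1 : Fin d → ℕ) m =
      ∑ m ∈ (Finset.univ.erase k).erase l, a m :=
    Finset.sum_congr rfl fun m hm => sub_single_apply_of_ne a (Finset.ne_of_mem_erase hm)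
  rw [h1]
  simp only [Pi.sub_apply, Pi.single_eq_same]
  omega

theorem sum_erase_sub_single_self (k : Fin d) (a : Fin d → ℕ) :
    ∑ m ∈ Finset.univ.erase k, (a - Pi.single k 1 : Fin d → ℕ) m =
      ∑ m ∈ Finset.univ.erase k, a m :=
  Finset.sum_congr rfl fun _ hm => sub_single_apply_of_ne a (Finset.ne_of_mem_erase hm)

theorem sum_sub_single {l : Fin d} {a : Fin d → ℕ} (ha : 0 < a l) :
    ∑ m, (a - Pi.single l 1 : Fin d → ℕ) m + 1 = ∑ m, a m := by
  rw [← sum_erase_add_apply l, sum_erase_sub_single_self, ← sum_erase_add_apply l a]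
  simp only [Pi.sub_apply, Pi.single_eq_same]
  omega

namespace InverseStep

variable {k : Fin d} {δ : ℕ} {E E' : Set (Fin d → ℕ)}

theorem le_sum (h : InverseStep k δ E E') {a : Fin d → ℕ} (ha : a ∈ E) : δ ≤ ∑ l, a l :=
  ((h.mem_iff a).1 ha).1

theorem single_mem (h : InverseStep k δ E E') {l : Fin d} (hl : l ≠ k) : Pi.single l δ ∈ E :=
  h.mem_of_zero _ (Pi.single_eq_of_ne hl.symm _) (by simp)

theorem minimal_of_sum_eq (h : InverseStep k δ E E') {a : Fin d → ℕ} (ha : a ∈ E)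
    (hs : ∑ l, a l = δ) : Minimal (· ∈ E) a := by
  refine ⟨ha, fun c hc hca => ?_⟩
  have h1 := h.le_sum hc
  have h2 := (Finset.sum_eq_sum_iff_of_le fun l _ => hca l).1
    (le_antisymm (Finset.sum_le_sum fun l _ => hca l) (hs.trans_le h1))
  exact fun l => (h2 l (Finset.mem_univ l)).ge

theorem minimal_single (h : InverseStep k δ E E') {l : Fin d} (hl : l ≠ k) :
    Minimal (· ∈ E) (Pi.single l δ) :=
  h.minimal_of_sum_eq (h.single_mem hl) (by simp)

theorem sum_erase_le_of_minimal (h : InverseStep k δ E E') {a : Fin d → ℕ}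
    (ha : Minimal (· ∈ E) a) : ∑ l ∈ Finset.univ.erase k, a l ≤ δ := by
  by_contra hcon
  rw [not_le] at hcon
  obtain ⟨l, hl, hal⟩ : ∃ l ∈ Finset.univ.erase k, 0 < a l := by
    by_contra hc
    push Not at hc
    have := Finset.sum_nonpos hc
    omega
  have hlk := Finset.ne_of_mem_erase hl
  have hb : Function.update (a - Pi.single l 1) k 0 ∈ E := by
    refine h.mem_of_zero _ (Function.update_self _ _ _) ?_
    rw [sum_update_eq]
    have := sum_erase_sub_single k hlk hal
    omega
  have h1 := ha.apply_le_of_mem hb (fun m => by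
    by_cases hm : m = k
    · subst hm; simp
    · rw [Function.update_of_ne hm]; simp) l
  rw [Function.update_of_ne hlk] at h1
  simp only [Pi.sub_apply, Pi.single_eq_same] at h1
  omega

theorem lt_of_single_mem (h : InverseStep k δ E E') {s : ℕ} (hs : Pi.single k s ∈ E) : δ < s := by
  obtain ⟨h1, h2⟩ := (h.mem_iff _).1 hs
  simp only [Finset.sum_pi_single', Finset.mem_univ, if_true] at h1 h2
  by_contra hcon
  have h3 : s - δ = 0 := by omega
  rw [h3] at h2
  apply h.zero_notMem'
  convert h2 using 1
  funext m
  by_cases hm : m = k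
  · subst hm; simp
  · simp [hm]

theorem single_mem_iff (h : InverseStep k δ E E') {s : ℕ} :
    Pi.single k (δ + s) ∈ E ↔ Pi.single k s ∈ E' := by
  rw [h.mem_iff]
  have h1 : ∑ l, (Pi.single k (δ + s) : Fin d → ℕ) l = δ + s := by simp
  have h2 : Function.update (Pi.single k (δ + s) : Fin d → ℕ) k (δ + s - δ) = Pi.single k s := by
    funext m
    by_cases hm : m = k
    · subst hm; simp
    · simp [hm]
  rw [h1, h2]
  exact ⟨fun h => h.2, fun h => ⟨by omega, h⟩⟩

theorem add_sub_single_mem (h : InverseStep k δ E E') {a : Fin d → ℕ} {l : Fin d} (hl : l ≠ k)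
    (ha : a ∈ E) (hak : 0 < a k) : a - Pi.single k 1 + Pi.single l 1 ∈ E := by
  obtain ⟨h1, h2⟩ := (h.mem_iff a).1 ha
  have hs : ∑ m, (a - Pi.single k 1 + Pi.single l 1 : Fin d → ℕ) m = ∑ m, a m := by
    rw [sum_add_single, sum_sub_single hak]
  refine (h.mem_iff _).2 ⟨hs ▸ h1, h.isUpperSet' ?_ h2⟩
  rw [hs]
  intro m
  by_cases hm : m = k
  · subst hm; simp
  · rw [Function.update_of_ne hm, Function.update_of_ne hm, Pi.add_apply,
      sub_single_apply_of_ne a hm]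
    exact Nat.le_add_right _ _

/-- The minimal generators of an inverse transform of order `δ` correspond to the monomials of
degree `δ`. -/
theorem ncard_minimal (h : InverseStep k δ E E') [Nontrivial (Fin d)] :
    {a | Minimal (· ∈ E) a}.ncard = {a : Fin d → ℕ | ∑ l, a l = δ}.ncard := by
  refine Set.ncard_congr (fun a _ =>
    Function.update a k (δ - ∑ l ∈ Finset.univ.erase k, a l)) ?_ ?_ ?_
  · intro a ha
    have := h.sum_erase_le_of_minimal ha
    rw [Set.mem_ofPred_eq, sum_update_eq]
    omega
  · intro a b ha hb hab
    have hoff : ∀ l, l ≠ k → a l = b l := fun l hl => by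
      have := congrFun hab l
      rwa [Function.update_of_ne hl, Function.update_of_ne hl] at this
    have ha' : Minimal (· ∈ E) a := ha
    have hb' : Minimal (· ∈ E) b := hb
    rcases le_total (a k) (b k) with hk | hk
    · refine le_antisymm ?_ (hb'.le_of_le ha'.prop ?_) <;>
      · intro l
        by_cases hl : l = k
        · subst hl; exact hk
        · exact (hoff l hl).le
    · refine le_antisymm (ha'.le_of_le hb'.prop ?_) ?_ <;>
      · intro l
        by_cases hl : l = k
        · subst hl; exact hk
        · exact (hoff l hl).ge
  · intro c hc
    rw [Set.mem_ofPred_eq] at hc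
    have hex : ∃ t, Function.update c k t ∈ E := by
      obtain ⟨t, ht⟩ := h.exists_single k
      have h1 := h.single_mem_iff.2 ht
      refine ⟨δ + t, h.isUpperSet ?_ h1⟩
      intro l
      by_cases hl : l = k
      · subst hl; simp
      · simp [hl]
    classical
    have hfind := Nat.find_spec hex
    set t := Nat.find hex with ht
    have hmin : Minimal (· ∈ E) (Function.update c k t) := by
      refine ⟨hfind, fun b hb hbc => ?_⟩
      by_contra hcon
      have hnm : ¬ Minimal (· ∈ E) (Function.update c k t) := fun hm => hcon (hm.le_of_le hb hbc)
      obtain ⟨l, hl, hlE⟩ := exists_sub_single_mem_of_not_minimal h.isUpperSet hfind hnm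
      have hlast : ∀ s, s < t → Function.update c k s ∉ E := fun s hs => Nat.find_min hex hs
      by_cases hlk : l = k
      · subst hlk
        rw [Function.update_self] at hl
        refine hlast (t - 1) (by omega) ?_
        convert hlE using 1
        funext m
        by_cases hm : m = l
        · subst hm; simp
        · simp [hm]
      · rw [Function.update_of_ne hlk] at hl
        have h1 := h.le_sum hlE
        have h2 := sum_sub_single (l := l) (a := Function.update c k t)
          (by rwa [Function.update_of_ne hlk])
        rw [sum_update_eq] at h2
        have h3 := sum_erase_add_apply k c
        have h4 : c l ≤ ∑ m ∈ Finset.univ.erase k, c m :=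
          Finset.single_le_sum (f := c) (fun _ _ => Nat.zero_le _)
            (Finset.mem_erase.2 ⟨hlk, Finset.mem_univ l⟩)
        have h5 : (Function.update c k t - Pi.single l 1 : Fin d → ℕ) k = t := by
          rw [sub_single_apply_of_ne _ (Ne.symm hlk), Function.update_self]
        have h6 := h.add_sub_single_mem hlk hlE (by omega)
        refine hlast (t - 1) (by omega) ?_
        convert h6 using 1
        funext m
        by_cases hm : m = k
        · subst hm; simp [Ne.symm hlk]
        · by_cases hml : m = l
          · subst hml
            simp only [Function.update_of_ne hm, Pi.add_apply, Pi.sub_apply,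
              Pi.single_eq_of_ne hm, Pi.single_eq_same]
            omega
          · simp [hm, hml]
    refine ⟨Function.update c k t, hmin, ?_⟩
    rw [sum_erase_update, Function.update_idem, Function.update_eq_self_iff]
    have := sum_erase_add_apply k c
    omega

variable {k' : Fin d} {δ' : ℕ} {E'' : Set (Fin d → ℕ)}

theorem eq_of_eq [Nontrivial (Fin d)] (h : InverseStep k δ E E') (h' : InverseStep k δ' E' E'') :
    δ = δ' := by
  apply le_antisymm
  · obtain ⟨b, hb, hbe⟩ := h.exists_eq
    have := h'.sum_erase_le_of_minimal hb
    omega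
  · obtain ⟨l, hl⟩ := exists_ne k
    have := h.le _ (h'.minimal_single hl)
    rw [sum_erase_single_of_ne hl, Pi.single_eq_of_ne hl.symm] at this
    omega

theorem le_of_minimal_single (h : InverseStep k δ E E') (hne : k ≠ k') {s : ℕ}
    (hs : Minimal (· ∈ E') (Pi.single k' s)) : s ≤ δ := by
  have := h.le _ hs
  rw [sum_erase_single_of_ne hne.symm, Pi.single_eq_of_ne hne] at this
  omega

theorem lt_of_ne (h : InverseStep k δ E E') (h' : InverseStep k' δ' E' E'') (hne : k ≠ k') :
    δ' < δ := by
  obtain ⟨t, ht⟩ := h.exists_single k'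
  obtain ⟨s, hs⟩ := exists_minimal_single ht
  exact (h'.lt_of_single_mem hs.prop).trans_le (h.le_of_minimal_single hne hs)

theorem lt_iff_ne [Nontrivial (Fin d)] (h : InverseStep k δ E E')
    (h' : InverseStep k' δ' E' E'') : δ' < δ ↔ k ≠ k' := by
  refine ⟨?_, h.lt_of_ne h'⟩
  rintro hlt rfl
  exact hlt.ne (h.eq_of_eq h').symm

theorem eq_add_iff [Nontrivial (Fin d)] (h : InverseStep k δ E E')
    (h' : InverseStep k' δ' E' E'') {k'' : Fin d} {δ'' : ℕ} {E''' : Set (Fin d → ℕ)}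
    (h'' : InverseStep k'' δ'' E'' E''') : δ = δ' + δ'' ↔ k ≠ k' ∧ k' ≠ k'' := by
  obtain ⟨t, ht⟩ := h.exists_single k'
  obtain ⟨s, hs⟩ := exists_minimal_single ht
  obtain ⟨r, rfl⟩ := Nat.exists_eq_add_of_lt (h'.lt_of_single_mem hs.prop)
  have hr := h'.single_mem_iff.1 (by rw [← add_assoc]; exact hs.prop)
  constructor
  · intro he
    have hne : k ≠ k' := by
      rintro rfl
      have := h.eq_of_eq h'
      have := h''.pos
      omega
    refine ⟨hne, ?_⟩
    rintro rfl
    have h1 := h''.lt_of_single_mem hr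
    have h2 := h.le_of_minimal_single hne hs
    omega
  · rintro ⟨hne, hne'⟩
    have h1 := h''.le_sum hr
    have h2 := h.le_of_minimal_single hne hs
    simp only [Finset.sum_pi_single', Finset.mem_univ, if_true] at h1
    refine le_antisymm ?_ (by omega)
    by_contra hcon
    rw [not_le] at hcon
    obtain ⟨a, ha, hae⟩ := h.exists_eq
    have h3 := sum_erase_add_apply k a
    have h4 := sum_erase_add_apply k' a
    have h5 := h'.sum_erase_le_of_minimal ha
    have h6 : 0 < a k' := by omega
    have h7 := sum_sub_single h6
    have h8 : a - Pi.single k' 1 ∈ E' := by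
      refine (h'.mem_iff _).2 ⟨by omega, h''.isUpperSet ?_ (h''.single_mem hne')⟩
      intro m
      by_cases hm : m = k'
      · subst hm
        rw [Function.update_self, Pi.single_eq_same]
        change δ'' ≤ ∑ l, (a - Pi.single m 1 : Fin d → ℕ) l - δ'
        omega
      · rw [Pi.single_eq_of_ne hm]
        exact Nat.zero_le _
    have h9 := ha.apply_le_of_mem h8 (fun m => by simp) k'
    simp only [Pi.sub_apply, Pi.single_eq_same] at h9
    omega

end InverseStep

theorem finite_setOf_sum_eq (δ : ℕ) : {a : Fin d → ℕ | ∑ l, a l = δ}.Finite :=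
  (Finset.piAntidiag Finset.univ δ).finite_toSet.subset fun a ha => by
    simpa [Finset.mem_piAntidiag] using ha

theorem ncard_sum_eq_strictMono [Nontrivial (Fin d)] :
    StrictMono fun δ => {a : Fin d → ℕ | ∑ l, a l = δ}.ncard := by
  refine strictMono_nat_of_lt_succ fun δ => ?_
  obtain ⟨l, m, hlm⟩ := exists_pair_ne (Fin d)
  have hinj : Function.Injective fun a : Fin d → ℕ => a + Pi.single l 1 :=
    fun a b hab => add_right_cancel hab
  rw [← Set.ncard_image_of_injective _ hinj]
  refine Set.ncard_lt_ncard ⟨?_, ?_⟩ (finite_setOf_sum_eq _)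
  · rintro _ ⟨a, ha, rfl⟩
    rw [Set.mem_ofPred_eq] at ha ⊢
    rw [sum_add_single, ha]
  · intro hsub
    obtain ⟨a, -, ha⟩ := hsub (show Pi.single m (δ + 1) ∈ _ by simp)
    have := congrFun ha l
    simp [Pi.single_eq_of_ne hlm] at this

end Combinatorics

/-! ### The order valuation -/

section OrderRing

variable {K : Type*} [Field K] {d : ℕ} {A : LocalSubring K} {w : Fin d → A.toSubring}

theorem exists_notMem_maximalIdeal_pow {R : Type*} [CommRing R] [IsLocalRing R] [IsNoetherianRing R]
    {f : R} (hf : f ≠ 0) : ∃ r, f ∈ maximalIdeal R ^ r ∧ f ∉ maximalIdeal R ^ (r + 1) := by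
  have h : ∃ r, f ∉ maximalIdeal R ^ r := by
    by_contra hcon
    push Not at hcon
    apply hf
    have := Ideal.iInf_pow_eq_bot_of_isLocalRing (maximalIdeal R) (maximalIdeal.isMaximal R).ne_top
    rw [← Ideal.mem_bot, ← this, Ideal.mem_iInf]
    exact hcon
  obtain ⟨r, hr⟩ := h
  obtain ⟨r', -, h'⟩ := exists_mem_pow_notMem_pow_succ
    (fun h => hr (Ideal.pow_le_pow_right (Nat.le_succ r) h))
  exact ⟨r', h'⟩

theorem idealOrd_span_singleton_le_iff {R : Type*} [CommRing R] [IsLocalRing R] {f g : R} {r : ℕ}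
    (hg : g ∈ maximalIdeal R ^ r) (hg' : g ∉ maximalIdeal R ^ (r + 1)) :
    idealOrd (Ideal.span {g}) ≤ idealOrd (Ideal.span {f}) ↔ f ∈ maximalIdeal R ^ r := by
  have : idealOrd (Ideal.span {g}) = r := by
    rw [idealOrd_eq_iff, Ideal.span_singleton_le_iff_mem, Ideal.span_singleton_le_iff_mem]
    exact ⟨hg, hg'⟩
  rw [this, le_idealOrd_span_singleton_iff]

/-- The elements of `K` of nonnegative order. -/
def orderSet (A : LocalSubring K) : Set K :=
  {z | ∃ (r : ℕ) (f g : A.toSubring), f ∈ maximalIdeal A.toSubring ^ r ∧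
    g ∈ maximalIdeal A.toSubring ^ r ∧ g ∉ maximalIdeal A.toSubring ^ (r + 1) ∧ z * g = f}

theorem mem_orderSet_of_mul_eq {z : K} {f g : A.toSubring} {r : ℕ}
    (hf : f ∈ maximalIdeal A.toSubring ^ r) (hg : g ∉ maximalIdeal A.toSubring ^ (r + 1))
    (h : z * g = f) : z ∈ orderSet A := by
  obtain ⟨s, hs, h1, h2⟩ := exists_mem_pow_notMem_pow_succ hg
  exact ⟨s, f, g, Ideal.pow_le_pow_right hs hf, h1, h2, h⟩

theorem IsQR.mem_pow_of_mem_orderSet (hw : IsQR w) {z : K} (hz : z ∈ orderSet A)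
    {f g : A.toSubring} {r : ℕ} (hg : g ∈ maximalIdeal A.toSubring ^ r) (h : z * g = f) :
    f ∈ maximalIdeal A.toSubring ^ r := by
  rcases r with _ | r
  · simp
  obtain ⟨s, f₀, g₀, hf₀, -, hg₀, h₀⟩ := hz
  by_contra hf
  refine hw.mul_notMem_pow hf hg₀ ?_
  have : f * g₀ = g * f₀ := Subtype.ext (by push_cast; rw [← h, ← h₀]; ring)
  rw [this, show r + s + 1 = r + 1 + s by omega, pow_add]
  exact Ideal.mul_mem_mul hg hf₀

theorem ne_zero_of_notMem_pow {R : Type*} [CommRing R] {I : Ideal R} {f : R} {r : ℕ}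
    (hf : f ∉ I ^ r) : f ≠ 0 := fun h => hf (h ▸ zero_mem _)

theorem mem_pow_succ_of_inv_notMem_orderSet {z : K} (hz : z = 0 ∨ z⁻¹ ∉ orderSet A)
    {f g : A.toSubring} {r : ℕ} (hg : g ∈ maximalIdeal A.toSubring ^ r) (h : z * g = f) :
    f ∈ maximalIdeal A.toSubring ^ (r + 1) := by
  by_contra hf
  have hf0 : (f : K) ≠ 0 := fun h0 => ne_zero_of_notMem_pow hf (Subtype.ext h0)
  have hz0 : z ≠ 0 := by
    rintro rfl
    rw [zero_mul] at h
    exact hf0 h.symm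
  refine hz.resolve_left hz0 (mem_orderSet_of_mul_eq hg hf ?_)
  rw [← h, inv_mul_cancel_left₀ hz0]

theorem IsQR.inv_notMem_orderSet (hw : IsQR w) {z : K} {f g : A.toSubring} {r : ℕ}
    (hf : f ∈ maximalIdeal A.toSubring ^ (r + 1)) (hg : g ∉ maximalIdeal A.toSubring ^ (r + 1))
    (h : z * g = f) : z = 0 ∨ z⁻¹ ∉ orderSet A := by
  by_contra hcon
  push Not at hcon
  refine hg (hw.mem_pow_of_mem_orderSet hcon.2 hf ?_)
  rw [← h, inv_mul_cancel_left₀ hcon.1]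

theorem IsQR.mul_mem_orderSet (hw : IsQR w) {y z : K} (hy : y ∈ orderSet A) (hz : z ∈ orderSet A) :
    y * z ∈ orderSet A := by
  obtain ⟨r, f, g, hf, -, hg, h⟩ := hy
  obtain ⟨s, f', g', hf', -, hg', h'⟩ := hz
  refine mem_orderSet_of_mul_eq (r := r + s) (f := f * f') (g := g * g') ?_
    (hw.mul_notMem_pow hg hg') ?_
  · rw [pow_add]; exact Ideal.mul_mem_mul hf hf'
  · push_cast
    rw [← h, ← h']; ring

theorem IsQR.add_mem_orderSet (hw : IsQR w) {y z : K} (hy : y ∈ orderSet A) (hz : z ∈ orderSet A) :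
    y + z ∈ orderSet A := by
  obtain ⟨r, f, g, hf, hg₁, hg, h⟩ := hy
  obtain ⟨s, f', g', hf', hg₁', hg', h'⟩ := hz
  refine mem_orderSet_of_mul_eq (r := r + s) (f := f * g' + g * f') (g := g * g') ?_
    (hw.mul_notMem_pow hg hg') ?_
  · rw [pow_add]; exact add_mem (Ideal.mul_mem_mul hf hg₁') (Ideal.mul_mem_mul hg₁ hf')
  · push_cast
    rw [← h, ← h']; ring

theorem coe_mem_orderSet (f : A.toSubring) : (f : K) ∈ orderSet A :=
  mem_orderSet_of_mul_eq (r := 0) (f := f) (g := 1) (by simp)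
    (by simp)
    (by simp)

/-- The order valuation ring. -/
def orderRing (hw : IsQR w) [IsNoetherianRing A.toSubring]
    (hK : ∀ z : K, ∃ f g : A.toSubring, g ≠ 0 ∧ z * g = f) : ValuationSubring K where
  carrier := orderSet A
  mul_mem' := hw.mul_mem_orderSet
  one_mem' := coe_mem_orderSet 1
  add_mem' := hw.add_mem_orderSet
  zero_mem' := coe_mem_orderSet 0
  neg_mem' := by
    rintro z ⟨r, f, g, hf, hg, hg', h⟩
    exact ⟨r, -f, g, neg_mem hf, hg, hg', by push_cast; rw [← h]; ring⟩
  mem_or_inv_mem' := by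
    intro z
    obtain ⟨f, g, hg, h⟩ := hK z
    by_cases hf : f = 0
    · refine Or.inl ?_
      have : z = 0 := by
        rw [hf] at h
        exact (mul_eq_zero.1 h).resolve_right fun h0 => hg (Subtype.ext h0)
      rw [this]
      exact coe_mem_orderSet 0
    have hz : z ≠ 0 := by
      rintro rfl
      rw [zero_mul] at h
      exact hf (Subtype.ext h.symm)
    obtain ⟨r, hr, hr'⟩ := exists_notMem_maximalIdeal_pow hf
    obtain ⟨s, hs, hs'⟩ := exists_notMem_maximalIdeal_pow hg
    rcases le_total s r with hle | hle
    · exact Or.inl (mem_orderSet_of_mul_eq (Ideal.pow_le_pow_right hle hr) hs' h)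
    · exact Or.inr (mem_orderSet_of_mul_eq (Ideal.pow_le_pow_right hle hs) hr'
        (by rw [← h, inv_mul_cancel_left₀ hz]))

variable [IsNoetherianRing A.toSubring]

theorem isOrderValuationRing_iff {V : Subring K} :
    IsOrderValuationRing A V ↔ ∀ z, z ∈ V ↔ z ∈ orderSet A := by
  refine forall_congr' fun z => ?_
  have : z ∈ orderSet A ↔ ∃ f g : A.toSubring, g ≠ 0 ∧
      idealOrd (Ideal.span {g}) ≤ idealOrd (Ideal.span {f}) ∧ z = (f : K) / (g : K) := by
    constructor
    · rintro ⟨r, f, g, hf, hg, hg', h⟩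
      have hg0 := ne_zero_of_notMem_pow hg'
      refine ⟨f, g, hg0, (idealOrd_span_singleton_le_iff hg hg').2 hf, ?_⟩
      exact eq_div_of_mul_eq (fun h0 => hg0 (Subtype.ext h0)) h
    · rintro ⟨f, g, hg0, hle, h⟩
      obtain ⟨r, hg, hg'⟩ := exists_notMem_maximalIdeal_pow hg0
      refine mem_orderSet_of_mul_eq ((idealOrd_span_singleton_le_iff hg hg').1 hle) hg' ?_
      rw [h, div_mul_cancel₀]
      exact fun h0 => hg0 (Subtype.ext h0)
  rw [this]

end OrderRing

/-! ### Iterated transforms -/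

section Sequence

theorem InverseStep.exists_minimal {d : ℕ} {k : Fin d} {δ : ℕ} {E E' : Set (Fin d → ℕ)}
    (h : InverseStep k δ E E') {a : Fin d → ℕ} (ha : Minimal (· ∈ E') a) :
    ∃ b, Minimal (· ∈ E) b ∧ δ ≤ ∑ l, b l ∧ Function.update b k (∑ l, b l - δ) = a := by
  have hle := h.le a ha
  set b := Function.update a k (δ + a k - ∑ l ∈ Finset.univ.erase k, a l) with hb
  have hsum : ∑ l, b l = δ + a k := by
    rw [hb, sum_update_eq]; omega
  have hTb : Function.update b k (∑ l, b l - δ) = a := by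
    rw [hsum, Nat.add_sub_cancel_left, hb, Function.update_idem, Function.update_eq_self]
  have hbE : b ∈ E := (h.mem_iff b).2 ⟨by omega, by rw [hTb]; exact ha.prop⟩
  refine ⟨b, ?_, by omega, hTb⟩
  by_contra hmin
  obtain ⟨l, hl, hlE⟩ := exists_sub_single_mem_of_not_minimal h.isUpperSet hbE hmin
  obtain ⟨h1, h2⟩ := (h.mem_iff _).1 hlE
  have hs := sum_sub_single hl
  have hk : a k ≤ _ := ha.2 h2 (by
    intro m
    by_cases hm : m = k
    · subst hm
      rw [Function.update_self]
      change _ - δ ≤ a m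
      omega
    · rw [Function.update_of_ne hm]
      refine (Nat.sub_le _ _).trans ?_
      rw [hb, Function.update_of_ne hm]) k
  rw [Function.update_self] at hk
  omega

variable {K : Type*} [Field K] {d : ℕ}

/-- The relation between a monomial ideal `I` in the last ring `A` of a sequence of monomial
quadratic transforms starting in `A₀`, and its iterated complete inverse transform `I₀`. -/
structure IsIteratedTransform (A₀ : LocalSubring K) (I₀ : Ideal A₀.toSubring)
    (A : LocalSubring K) (w : Fin d → A.toSubring) (I : Ideal A.toSubring) (M : K) : Prop where
  le : A₀.toSubring ≤ A.toSubring
  ne_zero : M ≠ 0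
  exists_eq_mul : ∀ b ∈ I₀, ∃ h ∈ I, (b : K) = M * h
  exists_of_minimal : ∀ a, Minimal (· ∈ {a | monomialIn w a ∈ I}) a →
    ∃ b ∈ I₀, (b : K) = M * (monomialIn w a : A.toSubring)
  exists_monomial : ∃ (b : A₀.toSubring) (c : Fin d → ℕ), 1 ≤ ∑ l, c l ∧
    (b : K) = (monomialIn w c : A.toSubring)
  mem_maximalIdeal : ∀ f ∈ maximalIdeal A₀.toSubring, Subring.inclusion le f ∈
    maximalIdeal A.toSubring
  subring_le : ∀ L : Subring K, A₀.toSubring ≤ L → (∀ l, (w l : K) ∈ L) →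
    (∀ t ∈ L, t⁻¹ ∈ A.toSubring → t⁻¹ ∈ L) → A.toSubring ≤ L

theorem IsIteratedTransform.refl (A : LocalSubring K) (w : Fin d → A.toSubring)
    (I : Ideal A.toSubring) (l : Fin d) : IsIteratedTransform A I A w I 1 where
  le := le_rfl
  ne_zero := one_ne_zero
  exists_eq_mul b hb := ⟨b, hb, (one_mul _).symm⟩
  exists_of_minimal a ha := ⟨_, ha.prop, (one_mul _).symm⟩
  exists_monomial := ⟨w l, Pi.single l 1, by simp, by rw [monomialIn_single, pow_one]⟩
  mem_maximalIdeal f hf := hf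
  subring_le L hL _ _ := hL

variable {A₀ A B : LocalSubring K} {I₀ : Ideal A₀.toSubring} {w : Fin d → A.toSubring} {j : Fin d}
  {v : Fin d → B.toSubring} {I : Ideal A.toSubring} {I' : Ideal B.toSubring}

theorem IsQR.blowupSubring_maximalIdeal_le (hw : IsQR w) {L : Subring K} (hA : A.toSubring ≤ L)
    (j : Fin d) (h : ∀ l, (w l : K) / w j ∈ L) :
    blowupSubring A.toSubring (maximalIdeal A.toSubring) (w j) ≤ L := by
  refine Subring.closure_le.2 ?_
  rintro z (hz | ⟨b, hb, rfl⟩)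
  · exact hA hz
  · rw [← hw.span_range] at hb
    obtain ⟨g, rfl⟩ := Ideal.mem_span_range_iff_exists_fun.1 hb
    push_cast
    rw [Finset.sum_div]
    refine Subring.sum_mem _ fun l _ => ?_
    rw [mul_div_assoc]
    exact mul_mem (hA (g l).2) (h l)

theorem IsMonomialTransform.subring_le (hT : IsMonomialTransform A w j B v) (hw : IsQR w)
    {L : Subring K} (hA : A.toSubring ≤ L) (hv : ∀ l, (v l : K) ∈ L)
    (hL : ∀ t ∈ L, t⁻¹ ∈ B.toSubring → t⁻¹ ∈ L) : B.toSubring ≤ L := by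
  have hblow := hw.blowupSubring_maximalIdeal_le hA j fun l => by
    by_cases hl : l = j
    · rw [hl, div_self (hw.coe_param_ne_zero j)]
      exact one_mem L
    · rw [← hT.coe_of_ne hl]
      exact hv l
  obtain ⟨-, P, -, _, rfl⟩ := hT
  intro z hz
  obtain ⟨a, s, hs, h⟩ := mem_ofPrime_iff.1 hz
  have hs0 : (s : K) ≠ 0 := fun h0 => hs (by
    have : s = 0 := Subtype.ext h0
    rw [this]; exact zero_mem _)
  rw [(eq_mul_inv_iff_mul_eq₀ hs0).2 h]
  refine mul_mem (hblow a.2) (hL s (hblow s.2) ?_)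
  exact mem_ofPrime_iff.2 ⟨1, s, hs, by rw [inv_mul_cancel₀ hs0]; rfl⟩

theorem IsIteratedTransform.step {M : K} (h : IsIteratedTransform A₀ I₀ A w I M)
    (hT : IsMonomialTransform A w j B v) (hw : IsQR w) {δ : ℕ}
    (hδ : InverseStep j δ {a | monomialIn w a ∈ I} {a | monomialIn v a ∈ I'})
    (hI : ∀ f : A.toSubring, f ∈ I ↔ ∃ g ∈ I', (f : K) = (w j : K) ^ δ * g) :
    IsIteratedTransform A₀ I₀ B v I' (M * (w j : K) ^ δ) where
  le := h.le.trans hT.le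
  ne_zero := mul_ne_zero h.ne_zero (pow_ne_zero _ (hw.coe_param_ne_zero j))
  exists_eq_mul b hb := by
    obtain ⟨f, hf, hbf⟩ := h.exists_eq_mul b hb
    obtain ⟨g, hg, hfg⟩ := (hI f).1 hf
    exact ⟨g, hg, by rw [hbf, hfg, mul_assoc]⟩
  exists_of_minimal a ha := by
    obtain ⟨c, hc, hsum, rfl⟩ := hδ.exists_minimal ha
    obtain ⟨b, hb, hbe⟩ := h.exists_of_minimal c hc
    exact ⟨b, hb, by rw [hbe, hT.coe_monomialIn hw hsum, mul_assoc]⟩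
  exists_monomial := by
    obtain ⟨b, c, hc, hbc⟩ := h.exists_monomial
    refine ⟨b, _, ?_, by rw [hbc, hT.coe_monomialIn hw (Nat.zero_le _), pow_zero, one_mul]⟩
    rw [sum_update_eq]
    omega
  mem_maximalIdeal f hf := hT.coe_mem_maximalIdeal hw (h.mem_maximalIdeal f hf)
  subring_le L hL hv hinv := by
    refine hT.subring_le hw (h.subring_le L hL (fun l => ?_) fun t ht ht' =>
      hinv t ht (hT.le ht')) hv hinv
    by_cases hl : l = j
    · rw [hl, ← hT.coe_self]
      exact hv j
    · rw [hT.coe_mul_coe_self hw hl, ← hT.coe_self]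
      exact mul_mem (hv j) (hv l)

/-! ### Change of direction and order -/

theorem IsMonomialTransform.changeOfDirection_iff {C : LocalSubring K} {u : Fin d → C.toSubring}
    {j' : Fin d} [IsNoetherianRing A.toSubring]
    (hT : IsMonomialTransform A w j B v) (hT' : IsMonomialTransform B v j' C u) (hw : IsQR w) :
    ChangeOfDirection A C ↔ j ≠ j' := by
  have hv := hT.isQR hw
  have := hT.isNoetherianRing hw
  have hu := hT'.isQR hv
  constructor
  · rintro h rfl
    obtain ⟨g, hg, hgw⟩ := h (w j) (hw.param_mem j)
    rw [← hT.coe_self, ← hT'.coe_self] at hgw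
    rw [Subtype.ext hgw] at hg
    refine hu.monomialIn_notMem_pow (Pi.single j 1) ?_
    simpa [monomialIn_single] using hg
  · intro hj f hf
    rw [← hw.span_range] at hf
    obtain ⟨g, rfl⟩ := Ideal.mem_span_range_iff_exists_fun.1 hf
    have hle := hT.le.trans hT'.le
    refine ⟨Subring.inclusion hle (∑ l, g l * w l), ?_, rfl⟩
    rw [map_sum]
    refine Ideal.sum_mem _ fun l _ => ?_
    rw [map_mul]
    refine Ideal.mul_mem_left _ _ ?_
    have hmul : ∀ {x y : C.toSubring}, x ∈ maximalIdeal C.toSubring →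
        y ∈ maximalIdeal C.toSubring → x * y ∈ maximalIdeal C.toSubring ^ 2 := fun hx hy => by
      rw [pow_two]; exact Ideal.mul_mem_mul hx hy
    by_cases hl : l = j
    · have : Subring.inclusion hle (w l) = u j' * u j := Subtype.ext (by
        change (w l : K) = u j' * u j
        rw [hl, ← hT.coe_self, hT'.coe_mul_coe_self hv hj, hT'.coe_self])
      rw [this]
      exact hmul (hu.param_mem _) (hu.param_mem _)
    · have : Subring.inclusion hle (w l) = Subring.inclusion hT'.le (v j) *
          Subring.inclusion hT'.le (v l) := Subtype.ext (by
        change (w l : K) = v j * v l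
        rw [hT.coe_mul_coe_self hw hl, hT.coe_self])
      rw [this]
      exact hmul (hT'.coe_mem_maximalIdeal hv (hv.param_mem _))
        (hT'.coe_mem_maximalIdeal hv (hv.param_mem _))

theorem IsCompleteMonomial.le_pow {R : Type*} [CommRing R] [IsLocalRing R] {w : Fin d → R}
    (hw : IsQR w) {I : Ideal R} (hI : IsCompleteMonomial w I) {δ : ℕ} {E' : Set (Fin d → ℕ)}
    (hδ : InverseStep j δ {a | monomialIn w a ∈ I} E') : I ≤ maximalIdeal R ^ δ := by
  rw [hI.eq_span, Ideal.span_le]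
  rintro _ ⟨a, ha, rfl⟩
  exact Ideal.pow_le_pow_right (hδ.le_sum ha) (monomialIn_mem_maximalIdeal_pow hw.span_range a)

theorem IsCompleteMonomial.idealOrd_eq [Nontrivial (Fin d)] {R : Type*} [CommRing R] [IsLocalRing R]
    {w : Fin d → R} (hw : IsQR w) {I : Ideal R} (hI : IsCompleteMonomial w I) {δ : ℕ}
    {E' : Set (Fin d → ℕ)} (hδ : InverseStep j δ {a | monomialIn w a ∈ I} E') :
    idealOrd I = δ := by
  rw [idealOrd_eq_iff]
  refine ⟨hI.le_pow hw hδ, fun hle => ?_⟩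
  obtain ⟨l, hl⟩ := exists_ne j
  refine hw.monomialIn_notMem_pow (Pi.single l δ) ?_
  have := hle (hδ.single_mem hl)
  simpa using this

end Sequence

/-! ### Rees valuations: existence -/

section Rees

variable {K : Type*} [Field K] {d : ℕ} {A₀ A : LocalSubring K} {I₀ : Ideal A₀.toSubring}
  {w : Fin d → A.toSubring} {I : Ideal A.toSubring} {M : K}

theorem mem_integralClosure_toSubring_iff {S : Subring K} {z : K} :
    z ∈ (integralClosure S K).toSubring ↔ IsIntegral S z := Iff.rfl

theorem le_integralClosure (S : Subring K) : S ≤ (integralClosure S K).toSubring :=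
  fun z hz => isIntegral_algebraMap (R := S) (x := ⟨z, hz⟩)

theorem ValuationSubring.integralClosure_le (V : ValuationSubring K) {S : Subring K}
    (h : S ≤ V.toSubring) : (integralClosure S K).toSubring ≤ V.toSubring := by
  intro z hz
  have h1 : IsIntegral V z :=
    IsIntegral.map_of_comp_eq (Subring.inclusion h) (RingHom.id K) (by ext; rfl)
      (mem_integralClosure_toSubring_iff.1 hz)
  obtain ⟨y, rfl⟩ := IsIntegrallyClosed.isIntegral_iff.1 h1
  exact y.2

theorem Subring.mem_maximalIdeal_iff (W : Subring K) [IsLocalRing W] (z : W) :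
    z ∈ maximalIdeal W ↔ (z : K) = 0 ∨ (z : K)⁻¹ ∉ W := by
  rw [IsLocalRing.mem_maximalIdeal, mem_nonunits_iff, ← not_iff_not, not_not, not_or, not_not]
  constructor
  · intro hz
    obtain ⟨y, hy⟩ := hz.exists_right_inv
    have hy' : (z : K) * y = 1 := congrArg Subtype.val hy
    exact ⟨left_ne_zero_of_mul_eq_one hy', by rw [← eq_inv_of_mul_eq_one_right hy']; exact y.2⟩
  · rintro ⟨h0, hi⟩
    exact IsUnit.of_mul_eq_one ⟨_, hi⟩ (Subtype.ext (mul_inv_cancel₀ h0))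

/-- The center of a valuation ring on a subring. -/
def center {S : Subring K} (V : ValuationSubring K) (h : S ≤ V.toSubring) : Ideal S :=
  (maximalIdeal V).comap (Subring.inclusion h)

instance {S : Subring K} (V : ValuationSubring K) (h : S ≤ V.toSubring) : (center V h).IsPrime :=
  Ideal.IsPrime.comap _

section Center

variable {S : Subring K} {V : ValuationSubring K} {h : S ≤ V.toSubring}

theorem mem_center_iff {z : S} : z ∈ center V h ↔ (z : K) = 0 ∨ (z : K)⁻¹ ∉ V :=
  letI : IsLocalRing V.toSubring := inferInstanceAs (IsLocalRing V)
  V.toSubring.mem_maximalIdeal_iff _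

theorem notMem_center_iff {z : S} : z ∉ center V h ↔ (z : K) ≠ 0 ∧ (z : K)⁻¹ ∈ V := by
  rw [mem_center_iff, not_or, not_not]

theorem ofPrime_center_le : (LocalSubring.ofPrime S (center V h)).toSubring ≤ V.toSubring := by
  intro z hz
  obtain ⟨a, s, hs, e⟩ := mem_ofPrime_iff.1 hz
  rw [notMem_center_iff] at hs
  rw [(eq_mul_inv_iff_mul_eq₀ hs.1).2 e]
  exact V.mul_mem _ _ (h a.2) hs.2

theorem inv_mem_ofPrime_center {t : K} (ht : t ∈ (LocalSubring.ofPrime S (center V h)).toSubring)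
    (ht' : t⁻¹ ∈ V) : t⁻¹ ∈ (LocalSubring.ofPrime S (center V h)).toSubring := by
  by_cases h0 : t = 0
  · rw [h0, inv_zero]; exact zero_mem _
  obtain ⟨a, s, hs, e⟩ := mem_ofPrime_iff.1 ht
  rw [notMem_center_iff] at hs
  refine mem_ofPrime_iff.2 ⟨s, a, notMem_center_iff.2 ⟨?_, ?_⟩, ?_⟩
  · rw [← e]; exact mul_ne_zero h0 hs.1
  · rw [← e, mul_inv]; exact V.mul_mem _ _ ht' hs.2
  · rw [← e, inv_mul_cancel_left₀ h0]

end Center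

theorem mem_ofPrime_of_pow_mem {S : Subring K} {P : Ideal (integralClosure S K).toSubring}
    [P.IsPrime] {z : K} {n : ℕ} (hn : 0 < n)
    (hz : z ^ n ∈ (LocalSubring.ofPrime _ P).toSubring) :
    z ∈ (LocalSubring.ofPrime _ P).toSubring := by
  obtain ⟨a, s, hs, e⟩ := mem_ofPrime_iff.1 hz
  have h1 : (z * s) ^ n ∈ (integralClosure S K).toSubring := by
    obtain ⟨m, rfl⟩ := Nat.exists_eq_add_of_lt hn
    rw [zero_add] at e ⊢
    rw [mul_pow, pow_succ' (s : K), ← mul_assoc, e]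
    exact mul_mem a.2 (pow_mem s.2 m)
  exact mem_ofPrime_iff.2 ⟨⟨z * s, IsIntegral.of_pow hn h1⟩, s, hs, rfl⟩

theorem monomialIn_coe_div_pow (c : Fin d → ℕ) (l : Fin d) :
    ((monomialIn w c : A.toSubring) : K) / (w l : K) ^ (∑ m, c m) =
      ∏ m, ((w m : K) / w l) ^ c m := by
  rw [monomialIn, ← Finset.prod_pow_eq_pow_sum]
  push_cast
  rw [← Finset.prod_div_distrib]
  exact Finset.prod_congr rfl fun m _ => (div_pow _ _ _).symm

variable [IsNoetherianRing A.toSubring]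

/-- The center of the order valuation ring on a subring `S` has height one if the localization of
`S` there is the order valuation ring. -/
theorem IsQR.height_center_orderRing (hw : IsQR w)
    (hK : ∀ z : K, ∃ f g : A.toSubring, g ≠ 0 ∧ z * g = f) {S : Subring K}
    (h : S ≤ (orderRing hw hK).toSubring)
    (hV : (orderRing hw hK).toSubring ≤
      (LocalSubring.ofPrime S (center (orderRing hw hK) h)).toSubring)
    (hne : center (orderRing hw hK) h ≠ ⊥) : (center (orderRing hw hK) h).height = 1 := by
  set Q := center (orderRing hw hK) h with hQ
  have hbot : ∀ p : Ideal S, p.IsPrime → p < Q → p = ⊥ := by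
    intro p hp hpQ
    by_contra hp0
    obtain ⟨x, hx, hx0⟩ := Submodule.exists_mem_ne_zero_of_ne_bot hp0
    obtain ⟨y, hyQ, hyp⟩ := SetLike.exists_of_lt hpQ
    have hx0' : (x : K) ≠ 0 := fun h0 => hx0 (Subtype.ext h0)
    obtain ⟨f, g, hg0, hxe⟩ := hK x
    have hf0 : f ≠ 0 := by
      rintro rfl
      exact (mul_ne_zero hx0' fun h0 => hg0 (Subtype.ext h0)) hxe
    obtain ⟨r, -, hf⟩ := exists_notMem_maximalIdeal_pow hf0
    obtain ⟨s, f', g', -, hg's, hg', hye⟩ := h y.2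
    have hf' := mem_pow_succ_of_inv_notMem_orderSet (mem_center_iff.1 hyQ) hg's hye
    have hz : (y : K) ^ r * (x : K)⁻¹ ∈ orderSet A := by
      refine mem_orderSet_of_mul_eq (r := r * s + r) (f := f' ^ r * g) (g := g' ^ r * f) ?_
        (hw.mul_notMem_pow (hw.pow_notMem_pow hg' r) hf) ?_
      · refine Ideal.mul_mem_right _ _ ?_
        have := Ideal.pow_mem_pow hf' r
        rw [← pow_mul] at this
        convert this using 2
        ring
      · push_cast
        rw [← hye, ← hxe]
        field_simp
        ring
    obtain ⟨a, t, ht, e⟩ := mem_ofPrime_iff.1 (hV hz)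
    have e' : y ^ r * t = a * x := Subtype.ext (by
      push_cast
      rw [← e]
      field_simp)
    have h1 : y ^ r * t ∈ p := e' ▸ Ideal.mul_mem_left _ _ hx
    rcases hp.mem_or_mem h1 with h2 | h2
    · exact hyp (hp.mem_of_pow_mem _ h2)
    · exact ht (hpQ.le h2)
  apply le_antisymm
  · refine (Ideal.height_le_iff (n := 1)).2 fun p hp hpQ => ?_
    rw [hbot p hp hpQ, Ideal.height_bot]
    exact_mod_cast one_pos
  · rw [Order.one_le_iff_ne_zero]
    intro h0
    exact hne (Ideal.height_eq_zero_iff_eq_bot.1 h0)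

/-- The order valuation is a Rees valuation if, up to a multiple, the ideal contains enough
monomials of minimal degree. -/
theorem IsIteratedTransform.ordIsReesValuation (h : IsIteratedTransform A₀ I₀ A w I M)
    (hw : IsQR w) (hK : ∀ z : K, ∃ f g : A.toSubring, g ≠ 0 ∧ z * g = f)
    (hI₀ : I₀ ≤ maximalIdeal A₀.toSubring) {δ : ℕ} (hI : I ≤ maximalIdeal A.toSubring ^ δ)
    (l : Fin d) (hl : ∀ l', ∃ q, 0 < q ∧ q ≤ δ ∧
      Minimal (· ∈ {a | monomialIn w a ∈ I}) (Pi.single l (δ - q) + Pi.single l' q)) :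
    OrdIsReesValuation A A₀ I₀ := by
  set V := orderRing hw hK
  have hw0 := hw.coe_param_ne_zero
  have hAV : A.toSubring ≤ V.toSubring := fun z hz => coe_mem_orderSet ⟨z, hz⟩
  have hmem : ∀ l', ∃ q, 0 < q ∧ ∃ b ∈ I₀,
      (b : K) = M * ((w l : K) ^ δ * ((w l' : K) / w l) ^ q) := by
    intro l'
    obtain ⟨q, hq, hqδ, hmin⟩ := hl l'
    obtain ⟨b, hb, e⟩ := h.exists_of_minimal _ hmin
    refine ⟨q, hq, b, hb, ?_⟩
    rw [e, monomialIn_add, monomialIn_single, monomialIn_single]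
    push_cast
    have := hw0 l
    obtain ⟨s, rfl⟩ := Nat.exists_eq_add_of_le hqδ
    rw [Nat.add_sub_cancel_left, div_pow, pow_add]
    field_simp
  obtain ⟨a, ha, hae⟩ : ∃ a ∈ I₀, (a : K) = M * (w l : K) ^ δ := by
    obtain ⟨q, -, a, ha, e⟩ := hmem l
    exact ⟨a, ha, by rw [e, div_self (hw0 l), one_pow, mul_one]⟩
  have ha0' : (a : K) ≠ 0 := hae ▸ mul_ne_zero h.ne_zero (pow_ne_zero _ (hw0 l))
  have ha0 : a ≠ 0 := fun h0 => ha0' (by rw [h0]; rfl)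
  have hwn := hw.param_pow_notMem_pow
  have hblow : blowupSubring A₀.toSubring I₀ a ≤ V.toSubring := by
    refine Subring.closure_le.2 ?_
    rintro z (hz | ⟨b, hb, rfl⟩)
    · exact hAV (h.le hz)
    · obtain ⟨f, hf, e⟩ := h.exists_eq_mul b hb
      refine mem_orderSet_of_mul_eq (f := f) (g := w l ^ δ) (hI hf) (hwn l δ) ?_
      have := h.ne_zero
      have := hw0 l
      rw [e, hae]
      push_cast
      field_simp
  have hS := V.integralClosure_le hblow
  set L := (LocalSubring.ofPrime _ (center V hS)).toSubring
  have hblowL : blowupSubring A₀.toSubring I₀ a ≤ L :=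
    (le_integralClosure _).trans (LocalSubring.le_ofPrime _ _)
  have hratio : ∀ l', (w l' : K) / w l ∈ L := by
    intro l'
    obtain ⟨q, hq, b, hb, e⟩ := hmem l'
    refine mem_ofPrime_of_pow_mem hq (hblowL ?_)
    have : ((w l' : K) / w l) ^ q = (b : K) / a := by
      rw [e, hae, ← mul_assoc, mul_div_cancel_left₀]
      exact mul_ne_zero h.ne_zero (pow_ne_zero _ (hw0 l))
    rw [this]
    exact div_mem_blowupSubring a hb
  have hratio' : ∀ l', ((w l' : K) / w l)⁻¹ ∈ L := by
    intro l'
    refine inv_mem_ofPrime_center (hratio l') ?_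
    refine mem_orderSet_of_mul_eq (r := 1) (f := w l) (g := w l') ?_ ?_ ?_
    · simpa using hw.param_mem l
    · simpa using hwn l' 1
    · rw [inv_div, div_mul_cancel₀ _ (hw0 l')]
  have hwl : (w l : K) ∈ L := by
    obtain ⟨b, c, hc, e⟩ := h.exists_monomial
    refine mem_ofPrime_of_pow_mem hc ?_
    have h1 := monomialIn_coe_div_pow (w := w) c l
    have h2 : (w l : K) ^ (∑ m, c m) = b * ∏ m, (((w m : K) / w l)⁻¹) ^ c m := by
      have h3 : ∏ m, (((w m : K) / w l)⁻¹) ^ c m = (∏ m, ((w m : K) / w l) ^ c m)⁻¹ := by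
        rw [← Finset.prod_inv_distrib]
        exact Finset.prod_congr rfl fun m _ => inv_pow _ _
      rw [h3, ← h1, e, inv_div, mul_div_cancel₀]
      rw [← e]
      intro h0
      have h4 := hw.monomialIn_notMem_pow c
      rw [Subtype.ext (a1 := (monomialIn w c : A.toSubring)) (a2 := 0) (by rw [← e, h0]; rfl)] at h4
      exact h4 (zero_mem _)
    rw [h2]
    exact mul_mem (hblowL (le_blowupSubring _ _ _ b.2))
      (prod_mem fun m _ => pow_mem (hratio' m) _)
  have hwL : ∀ l', (w l' : K) ∈ L := fun l' => by
    rw [← div_mul_cancel₀ (w l' : K) (hw0 l)]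
    exact mul_mem (hratio l') hwl
  have hAL : A.toSubring ≤ L := h.subring_le L ((le_blowupSubring _ _ _).trans hblowL) hwL
    fun t ht ht' => inv_mem_ofPrime_center ht (hAV ht')
  have hAblow := hw.blowupSubring_maximalIdeal_le hAL l hratio
  have hVL : V.toSubring ≤ L := by
    rintro z ⟨r, f, g, hf, hg, hg', e⟩
    have hg0 : (g : K) ≠ 0 := fun h0 => ne_zero_of_notMem_pow hg' (Subtype.ext h0)
    have h1 := hAblow (div_pow_mem_blowupSubring (hw0 l) r hf)
    have h2 := hAblow (div_pow_mem_blowupSubring (hw0 l) r hg)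
    have h3 : ((g : K) / (w l : K) ^ r)⁻¹ ∈ L := by
      refine inv_mem_ofPrime_center h2 ?_
      refine mem_orderSet_of_mul_eq (r := r) (f := w l ^ r) (g := g)
        (Ideal.pow_mem_pow (hw.param_mem l) r) hg' ?_
      rw [inv_div, div_mul_cancel₀ _ hg0]
      rfl
    have : z = (f : K) / (w l : K) ^ r * ((g : K) / (w l : K) ^ r)⁻¹ := by
      have := hw0 l
      rw [← e]
      field_simp
    rw [this]
    exact mul_mem h1 h3
  have hI₀Q : ∀ b ∈ I₀, ∃ q ∈ center V hS, (q : K) = b := by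
    intro b hb
    refine ⟨⟨b, le_integralClosure _ (le_blowupSubring _ _ _ b.2)⟩, mem_center_iff.2 ?_, rfl⟩
    have := h.mem_maximalIdeal b (hI₀ hb)
    refine hw.inv_notMem_orderSet (r := 0) (f := Subring.inclusion h.le b) (g := 1) ?_ ?_ ?_
    · simpa using this
    · simp
    · simp
  refine ⟨V.toSubring, isOrderValuationRing_iff.2 fun z => Iff.rfl, a, ha, ha0, center V hS,
    inferInstance, hw.height_center_orderRing hK hS hVL ?_, hI₀Q, le_antisymm hVL ofPrime_center_le⟩
  intro hbot
  obtain ⟨q, hq, e⟩ := hI₀Q a ha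
  have hq' : q = 0 := Ideal.mem_bot.1 (hbot ▸ hq)
  exact ha0' (by rw [← e, hq']; rfl)

end Rees

/-! ### Rees valuations: nonexistence -/

section Tangent

variable {A : Type*} [CommRing A] [IsLocalRing A] {d : ℕ} {w : Fin d → A} {k : Fin d}

/-- The elements of order at least `s` whose leading form of degree `s` does not involve the
parameter `w k`. -/
def leadingFormIdeal (w : Fin d → A) (k : Fin d) (s : ℕ) : Ideal A :=
  Ideal.span (monomialIn w '' {a | a k = 0 ∧ ∑ l, a l = s}) ⊔ maximalIdeal A ^ (s + 1)

theorem monomialIn_mem_leadingFormIdeal {a : Fin d → ℕ} {s : ℕ} (h0 : a k = 0)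
    (hs : ∑ l, a l = s) : monomialIn w a ∈ leadingFormIdeal w k s :=
  Ideal.mem_sup_left (Ideal.subset_span ⟨a, ⟨h0, hs⟩, rfl⟩)

theorem pow_mem_leadingFormIdeal {l : Fin d} (hl : l ≠ k) (s : ℕ) :
    w l ^ s ∈ leadingFormIdeal w k s := by
  rw [← monomialIn_single]
  exact monomialIn_mem_leadingFormIdeal (Pi.single_eq_of_ne hl.symm _) (by simp)

theorem leadingFormIdeal_zero : leadingFormIdeal w k 0 = ⊤ := by
  rw [Ideal.eq_top_iff_one, ← monomialIn_zero w]
  exact monomialIn_mem_leadingFormIdeal rfl (by simp)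

theorem span_monomialIn_le_pow (hw : Ideal.span (Set.range w) = maximalIdeal A) (s : ℕ) :
    Ideal.span (monomialIn w '' {a | a k = 0 ∧ ∑ l, a l = s}) ≤ maximalIdeal A ^ s := by
  rw [Ideal.span_le]
  rintro _ ⟨a, ⟨-, rfl⟩, rfl⟩
  exact monomialIn_mem_maximalIdeal_pow hw a

theorem leadingFormIdeal_le_pow (hw : Ideal.span (Set.range w) = maximalIdeal A) (s : ℕ) :
    leadingFormIdeal w k s ≤ maximalIdeal A ^ s :=
  sup_le (span_monomialIn_le_pow hw s) (Ideal.pow_le_pow_right (Nat.le_succ s))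

theorem mul_mem_leadingFormIdeal (hw : Ideal.span (Set.range w) = maximalIdeal A) {s t : ℕ}
    {f g : A} (hf : f ∈ leadingFormIdeal w k s) (hg : g ∈ leadingFormIdeal w k t) :
    f * g ∈ leadingFormIdeal w k (s + t) := by
  have hgt := leadingFormIdeal_le_pow hw t hg
  obtain ⟨f₁, hf₁, f₂, hf₂, rfl⟩ := Submodule.mem_sup.1 hf
  obtain ⟨g₁, hg₁, g₂, hg₂, rfl⟩ := Submodule.mem_sup.1 hg
  have e : (f₁ + f₂) * (g₁ + g₂) = f₁ * g₁ + (f₁ * g₂ + f₂ * (g₁ + g₂)) := by ring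
  rw [e]
  refine add_mem (Ideal.mem_sup_left ?_) (Ideal.mem_sup_right (add_mem ?_ ?_))
  · have h := Ideal.mul_mem_mul hf₁ hg₁
    rw [Ideal.span_mul_span'] at h
    refine Ideal.span_mono ?_ h
    rintro _ ⟨_, ⟨a, ⟨ha, rfl⟩, rfl⟩, _, ⟨b, ⟨hb, rfl⟩, rfl⟩, rfl⟩
    refine ⟨a + b, ⟨by rw [Pi.add_apply, ha, hb], ?_⟩, monomialIn_add w a b⟩
    exact Finset.sum_add_distrib
  · have h := Ideal.mul_mem_mul (span_monomialIn_le_pow hw s hf₁) hg₂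
    rwa [← pow_add] at h
  · have h := Ideal.mul_mem_mul hf₂ hgt
    rw [← pow_add] at h
    convert h using 2
    omega

theorem IsQR.mem_pow_succ_of_mem_leadingFormIdeal (h : IsQR w) {s : ℕ} {f : A}
    (hf : f ∈ leadingFormIdeal w k s) (hf' : f ∈ Ideal.span {w k} ⊔ maximalIdeal A ^ (s + 1)) :
    f ∈ maximalIdeal A ^ (s + 1) := by
  classical
  obtain ⟨f₁, hf₁, f₂, hf₂, rfl⟩ := Submodule.mem_sup.1 hf
  refine add_mem ?_ hf₂
  have hf₁' : f₁ ∈ Ideal.span {w k} ⊔ maximalIdeal A ^ (s + 1) :=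
    (Submodule.add_mem_iff_left _ (Ideal.mem_sup_right hf₂)).1 hf'
  obtain ⟨t, c, ht, rfl⟩ := exists_sum_of_mem_span_monomialIn hf₁
  have hsplit := Finset.sum_filter_add_sum_filter_not t (fun a => IsUnit (c a))
    (fun a => c a * monomialIn w a)
  have hnon : ∑ a ∈ t.filter (fun a => ¬ IsUnit (c a)), c a * monomialIn w a ∈
      maximalIdeal A ^ (s + 1) := by
    refine Ideal.sum_mem _ fun a ha => ?_
    obtain ⟨ha, hc⟩ := Finset.mem_filter.1 ha
    have h1 := monomialIn_mem_maximalIdeal_pow h.span_range a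
    rw [(ht a ha).2] at h1
    rw [pow_succ']
    exact Ideal.mul_mem_mul ((IsLocalRing.mem_maximalIdeal _).2 hc) h1
  have hE : IsUpperSet {a : Fin d → ℕ | 1 ≤ a k ∨ s + 1 ≤ ∑ l, a l} := by
    rintro a b hab (ha | ha)
    · exact Or.inl (ha.trans (hab k))
    · exact Or.inr (ha.trans (Finset.sum_le_sum fun l _ => hab l))
  have hle : Ideal.span {w k} ⊔ maximalIdeal A ^ (s + 1) ≤
      Ideal.span (monomialIn w '' {a : Fin d → ℕ | 1 ≤ a k ∨ s + 1 ≤ ∑ l, a l}) := by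
    refine sup_le ?_ fun f hf => ?_
    · rw [Ideal.span_singleton_le_iff_mem]
      refine Ideal.subset_span ⟨Pi.single k 1, Or.inl (by simp), ?_⟩
      rw [monomialIn_single, pow_one]
    · obtain ⟨u, e, hu, rfl⟩ := exists_sum_of_mem_maximalIdeal_pow h.span_range hf
      exact Ideal.sum_mem _ fun a ha =>
        Ideal.mul_mem_left _ _ (Ideal.subset_span ⟨a, Or.inr (hu a ha).ge, rfl⟩)
  have hempty : t.filter (fun a => IsUnit (c a)) = ∅ := by
    refine Finset.eq_empty_of_forall_notMem fun a ha => ?_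
    have hmem : ∑ a ∈ t.filter (fun a => IsUnit (c a)), c a * monomialIn w a ∈
        Ideal.span {w k} ⊔ maximalIdeal A ^ (s + 1) := by
      rw [← hsplit] at hf₁'
      exact (Submodule.add_mem_iff_left _ (Ideal.mem_sup_right hnon)).1 hf₁'
    have h1 := h.mem_of_sum_mem_span hE (fun a ha => (Finset.mem_filter.1 ha).2) (hle hmem) a ha
    have h2 := ht a (Finset.mem_filter.1 ha).1
    rcases h1 with h1 | h1
    · have := h2.1; omega
    · have := h2.2; omega
  rw [← hsplit, hempty, Finset.sum_empty, zero_add]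
  exact hnon

/-- The leading form of `w k / w l` is transcendental over the forms not involving `w k`. -/
theorem IsQR.mem_pow_of_sum_mem_pow (h : IsQR w) {l : Fin d} (hl : l ≠ k) {s : ℕ} (n : ℕ) :
    ∀ g : ℕ → A, (∀ i ≤ n, g i ∈ leadingFormIdeal w k s) →
      ∑ i ∈ Finset.range (n + 1), g i * (w k ^ i * w l ^ (n - i)) ∈ maximalIdeal A ^ (s + n + 1) →
      ∀ i ≤ n, g i ∈ maximalIdeal A ^ (s + 1) := by
  have hpow := h.param_pow_notMem_pow
  induction n with
  | zero =>
    intro g _ hm i hi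
    obtain rfl := Nat.le_zero.1 hi
    simpa using hm
  | succ n ih =>
    intro g hg hm
    have e : ∑ i ∈ Finset.range (n + 1 + 1), g i * (w k ^ i * w l ^ (n + 1 - i)) =
        w k * (∑ i ∈ Finset.range (n + 1), g (i + 1) * (w k ^ i * w l ^ (n - i))) +
          g 0 * w l ^ (n + 1) := by
      rw [Finset.sum_range_succ', Finset.mul_sum]
      congr 1
      · refine Finset.sum_congr rfl fun i _ => ?_
        rw [Nat.add_sub_add_right]
        ring
      · simp
    rw [e] at hm
    have h0 : g 0 * w l ^ (n + 1) ∈ maximalIdeal A ^ (s + (n + 1) + 1) := by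
      refine h.mem_pow_succ_of_mem_leadingFormIdeal (k := k)
        (mul_mem_leadingFormIdeal h.span_range (hg 0 (Nat.zero_le _))
          (pow_mem_leadingFormIdeal hl _)) ?_
      have h5 : w k * (∑ i ∈ Finset.range (n + 1), g (i + 1) * (w k ^ i * w l ^ (n - i))) ∈
          Ideal.span {w k} ⊔ maximalIdeal A ^ (s + (n + 1) + 1) :=
        Ideal.mem_sup_left (Ideal.mul_mem_right _ _ (Ideal.mem_span_singleton_self _))
      exact (Submodule.add_mem_iff_right _ h5).1 (Ideal.mem_sup_right hm)
    have h1 := (Submodule.add_mem_iff_left _ h0).1 hm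
    have h2 : g 0 ∈ maximalIdeal A ^ (s + 1) := by
      by_contra hcon
      exact h.mul_notMem_pow hcon (hpow l (n + 1)) h0
    have h3 : ∑ i ∈ Finset.range (n + 1), g (i + 1) * (w k ^ i * w l ^ (n - i)) ∈
        maximalIdeal A ^ (s + n + 1) := by
      by_contra hcon
      have hk : w k ∉ maximalIdeal A ^ (1 + 1) := by simpa only [pow_one] using hpow k 1
      have h4 := h.mul_notMem_pow hk hcon
      rw [show 1 + (s + n) + 1 = s + (n + 1) + 1 by omega] at h4
      exact h4 h1
    intro i hi
    rcases i with _ | i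
    · exact h2
    · exact ih (fun i => g (i + 1)) (fun i hi => hg _ (by omega)) h3 i (by omega)

end Tangent

section Rees

variable {K : Type*} [Field K]

/-- Elements of the localization at a prime of the integral closure of `S` are, modulo the maximal
ideal, algebraic over `S`. -/
theorem exists_sum_mem_maximalIdeal_ofPrime {S : Subring K}
    (P : Ideal (integralClosure S K).toSubring) [P.IsPrime] :
    ∀ y : (LocalSubring.ofPrime _ P).toSubring,
    ∃ (n : ℕ) (c : ℕ → (LocalSubring.ofPrime _ P).toSubring), (∀ i, (c i : K) ∈ S) ∧
      (∃ i ≤ n, c i ∉ maximalIdeal (LocalSubring.ofPrime _ P).toSubring) ∧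
      ∑ i ∈ Finset.range (n + 1), c i * y ^ i ∈
        maximalIdeal (LocalSubring.ofPrime _ P).toSubring := by
  intro y
  let W := (LocalSubring.ofPrime _ P).toSubring
  have hTW : (integralClosure S K).toSubring ≤ W := LocalSubring.le_ofPrime _ _
  have hSW : S ≤ W := (le_integralClosure S).trans hTW
  let φ : S →+* ResidueField W := (residue W).comp (Subring.inclusion hSW)
  let ψ : integralClosure S K →+* ResidueField W :=
    (residue W).comp ((integralClosure S K).val.toRingHom.codRestrict W fun z => hTW z.2)
  have hint : ∀ z : integralClosure S K, IsIntegral φ.range (ψ z) := fun z =>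
    IsIntegral.map_of_comp_eq φ.rangeRestrict ψ (by ext; rfl) (integralClosure.isIntegral z)
  obtain ⟨a, s, hs, e⟩ := mem_ofPrime_iff.1 y.2
  let a' : integralClosure S K := ⟨a, a.2⟩
  let s' : integralClosure S K := ⟨s, s.2⟩
  have hs' : ψ s' ≠ 0 := by
    intro h0
    exact hs ((coe_mem_maximalIdeal_ofPrime_iff s ⟨s, hTW s.2⟩ rfl).1 ((residue_eq_zero_iff _).1 h0))
  have he : residue W y * ψ s' = ψ a' := by
    change residue W y * residue W _ = residue W _
    rw [← map_mul]
    exact congrArg _ (Subtype.ext e)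
  have halg : IsAlgebraic φ.range (residue W y) := by
    rw [(eq_mul_inv_iff_mul_eq₀ hs').2 he]
    exact (hint a').isAlgebraic.mul (hint s').isAlgebraic.inv
  obtain ⟨p, hp, hpy⟩ := halg
  have hc : ∀ i, ∃ c : S, φ c = p.coeff i := fun i => (p.coeff i).2
  choose c hc using hc
  refine ⟨p.natDegree, fun i => Subring.inclusion hSW (c i), fun i => (c i).2,
    ⟨p.natDegree, le_rfl, fun h0 => ?_⟩, ?_⟩
  · rw [← residue_eq_zero_iff] at h0
    refine hp (Polynomial.leadingCoeff_eq_zero.1 (Subtype.ext ?_))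
    exact (hc _).symm.trans h0
  · rw [← residue_eq_zero_iff, map_sum, ← hpy, Polynomial.aeval_eq_sum_range]
    refine Finset.sum_congr rfl fun i _ => ?_
    rw [map_mul, map_pow, Algebra.smul_def]
    congr 1
    exact hc i

variable {d : ℕ} {A₀ A : LocalSubring K} {I₀ : Ideal A₀.toSubring}
  {w : Fin d → A.toSubring} {I : Ideal A.toSubring} {M : K}

theorem IsIteratedTransform.exists_mem_leadingFormIdeal (h : IsIteratedTransform A₀ I₀ A w I M)
    (hw : IsQR w) {k : Fin d} {δ : ℕ} (hI : I ≤ leadingFormIdeal w k δ) (N : ℕ) :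
    ∀ F ∈ I₀ ^ N, ∃ f ∈ leadingFormIdeal w k (N * δ), (F : K) = M ^ N * f := by
  induction N with
  | zero =>
    intro F _
    refine ⟨Subring.inclusion h.le F, ?_, by simp⟩
    rw [zero_mul, leadingFormIdeal_zero]
    trivial
  | succ N ih =>
    intro F hF
    rw [pow_succ] at hF
    refine Submodule.mul_induction_on hF (fun a ha b hb => ?_) (fun a b ha hb => ?_)
    · obtain ⟨f, hf, e⟩ := ih a ha
      obtain ⟨g, hg, e'⟩ := h.exists_eq_mul b hb
      refine ⟨f * g, ?_, by push_cast; rw [e, e']; ring⟩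
      rw [add_mul, one_mul]
      exact mul_mem_leadingFormIdeal hw.span_range hf (hI hg)
    · obtain ⟨f, hf, e⟩ := ha
      obtain ⟨g, hg, e'⟩ := hb
      exact ⟨f + g, add_mem hf hg, by push_cast; rw [e, e']; ring⟩

/-- The order valuation is not a Rees valuation if the leading forms of minimal degree of the ideal
do not involve one of the parameters. -/
theorem IsIteratedTransform.not_ordIsReesValuation [IsNoetherianRing A.toSubring]
    (h : IsIteratedTransform A₀ I₀ A w I M) (hw : IsQR w) {k l : Fin d} (hl : l ≠ k) {δ : ℕ}
    (hI : I ≤ leadingFormIdeal w k δ)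
    (hmin : Minimal (· ∈ {a | monomialIn w a ∈ I}) (Pi.single l δ)) :
    ¬ OrdIsReesValuation A A₀ I₀ := by
  rintro ⟨V, hV, a, ha, ha0, Q, _, -, -, hVQ⟩
  rw [isOrderValuationRing_iff] at hV
  have hw0 := hw.coe_param_ne_zero
  have ha0' : (a : K) ≠ 0 := fun h0 => ha0 (Subtype.ext h0)
  have hwn := hw.param_pow_notMem_pow
  have hblow : blowupSubring A₀.toSubring I₀ a ≤ V := by
    rw [hVQ]
    exact (le_integralClosure _).trans (LocalSubring.le_ofPrime _ _)
  obtain ⟨f, hf, hae⟩ := h.exists_eq_mul a ha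
  have hfδ := leadingFormIdeal_le_pow hw.span_range δ (hI hf)
  have hf' : f ∉ maximalIdeal A.toSubring ^ (δ + 1) := by
    intro hf'
    obtain ⟨b, hb, hbe⟩ := h.exists_of_minimal _ hmin
    refine hwn l δ (hw.mem_pow_of_mem_orderSet
      ((hV _).1 (hblow (div_mem_blowupSubring a hb))) hf' ?_)
    have hf0 : (f : K) ≠ 0 := fun h0 => ha0' (by rw [hae, h0, mul_zero])
    have := h.ne_zero
    rw [hbe, hae, monomialIn_single]
    field_simp
  have hc : ∀ c ∈ blowupSubring A₀.toSubring I₀ a, ∃ N : ℕ, ∀ N', N ≤ N' →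
      ∃ g ∈ leadingFormIdeal w k (N' * δ), c * (f : K) ^ N' = g := by
    intro c hc
    obtain ⟨N, hN⟩ := exists_mul_pow_eq_of_mem_blowupSubring ha0' ha hc
    refine ⟨N, fun N' hN' => ?_⟩
    obtain ⟨F, hF, e⟩ := hN N' hN'
    obtain ⟨g, hg, e'⟩ := h.exists_mem_leadingFormIdeal hw hI N' F hF
    refine ⟨g, hg, mul_left_cancel₀ (pow_ne_zero N' h.ne_zero) ?_⟩
    rw [← e', ← e, hae, mul_pow]
    ring
  subst hVQ
  set W := (LocalSubring.ofPrime _ Q).toSubring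
  have hmax : ∀ z : W, z ∈ maximalIdeal W ↔ (z : K) = 0 ∨ (z : K)⁻¹ ∉ orderSet A := fun z => by
    rw [W.mem_maximalIdeal_iff, hV]
  have hy : (w k : K) / w l ∈ W := (hV _).2
    (mem_orderSet_of_mul_eq (r := 1) (f := w k) (g := w l) (by simpa using hw.param_mem k)
      (by simpa using hwn l 1) (div_mul_cancel₀ _ (hw0 l)))
  obtain ⟨n, c, hcS, ⟨i₀, hi₀, hci₀⟩, hsum⟩ := exists_sum_mem_maximalIdeal_ofPrime Q ⟨_, hy⟩
  choose N hN using fun i => hc _ (hcS i)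
  set N' := ∑ i ∈ Finset.range (n + 1), N i
  have hg : ∀ i, ∃ g : A.toSubring, i ≤ n → g ∈ leadingFormIdeal w k (N' * δ) ∧
      (c i : K) * (f : K) ^ N' = g := by
    intro i
    by_cases hi : i ≤ n
    · obtain ⟨g, hg, e⟩ := hN i N' (Finset.single_le_sum (f := N) (fun _ _ => Nat.zero_le _)
        (Finset.mem_range.2 (by omega)))
      exact ⟨g, fun _ => ⟨hg, e⟩⟩
    · exact ⟨0, fun h => absurd h hi⟩
  choose g hg using hg
  have key := hw.mem_pow_of_sum_mem_pow hl n g (fun i hi => (hg i hi).1) ?_ i₀ hi₀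
  · refine hci₀ ((hmax _).2 (hw.inv_notMem_orderSet (r := N' * δ) (g := f ^ N') key
      (hw.pow_notMem_pow hf' N') ?_))
    push_cast
    exact (hg i₀ hi₀).2
  · refine mem_pow_succ_of_inv_notMem_orderSet (r := N' * δ + n) (g := f ^ N' * w l ^ n)
      ((hmax _).1 hsum) ?_ ?_
    · rw [pow_add, mul_comm N', pow_mul]
      exact Ideal.mul_mem_mul (Ideal.pow_mem_pow hfδ N') (Ideal.pow_mem_pow (hw.param_mem l) n)
    · push_cast
      rw [Finset.sum_mul]
      refine Finset.sum_congr rfl fun i hi => ?_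
      have hi' : i ≤ n := by have := Finset.mem_range.1 hi; omega
      obtain ⟨m, rfl⟩ := Nat.exists_eq_add_of_le hi'
      have := hw0 l
      rw [← (hg i hi').2, Nat.add_sub_cancel_left, div_pow, pow_add]
      field_simp

end Rees

section Main

variable {K : Type*} [Field K] {d : ℕ}

theorem IsCompleteMonomial.le_leadingFormIdeal {A : Type*} [CommRing A] [IsLocalRing A]
    {w : Fin d → A} (hw : IsQR w) {I : Ideal A} (hI : IsCompleteMonomial w I) {k k' : Fin d} {δ : ℕ}
    {E' E'' : Set (Fin d → ℕ)} (hδ : InverseStep k δ {a | monomialIn w a ∈ I} E')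
    (hδ' : InverseStep k' δ E' E'') : I ≤ leadingFormIdeal w k δ := by
  rw [hI.eq_span, Ideal.span_le]
  rintro _ ⟨a, ha, rfl⟩
  have hle := hδ.le_sum ha
  by_cases hs : ∑ l, a l = δ
  · refine monomialIn_mem_leadingFormIdeal ?_ hs
    have h1 := hδ'.le_sum ((hδ.mem_iff a).1 ha).2
    rw [sum_update_eq] at h1
    have h2 := sum_erase_add_apply k a
    omega
  · exact Ideal.mem_sup_right (Ideal.pow_le_pow_right (by omega)
      (monomialIn_mem_maximalIdeal_pow hw.span_range a))

theorem InverseStep.exists_minimal_single_add_single {k k' : Fin d} {δ δ' : ℕ}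
    {E E' E'' : Set (Fin d → ℕ)} (h : InverseStep k δ E E') (h' : InverseStep k' δ' E' E'')
    (hk : k ≠ k') {l : Fin d} (hl : l ≠ k) (hl' : l ≠ k') (m : Fin d) :
    ∃ q, 0 < q ∧ q ≤ δ ∧ Minimal (· ∈ E) (Pi.single l (δ - q) + Pi.single m q) := by
  have hlt := h.lt_of_ne h' hk
  have hsum : ∀ q, q ≤ δ → ∑ i, (Pi.single l (δ - q) + Pi.single m q : Fin d → ℕ) i = δ := by
    intro q hq
    rw [sum_add_single]
    simp only [Finset.sum_pi_single', Finset.mem_univ, if_true]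
    omega
  by_cases hm : m = k
  · refine ⟨δ - δ', by omega, by omega, h.minimal_of_sum_eq ?_ (hsum _ (by omega))⟩
    rw [h.mem_iff, hsum _ (by omega)]
    refine ⟨le_rfl, ?_⟩
    convert h'.single_mem hl' using 1
    subst hm
    funext i
    by_cases hi : i = m
    · subst hi
      rw [Function.update_self, Pi.single_eq_of_ne hl.symm, Nat.sub_self]
    · rw [Function.update_of_ne hi, Pi.add_apply, Pi.single_eq_of_ne hi, add_zero]
      congr 1
      omega
  · refine ⟨1, one_pos, h.pos, h.minimal_of_sum_eq (h.mem_of_zero _ ?_ ?_) (hsum 1 h.pos)⟩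
    · rw [Pi.add_apply, Pi.single_eq_of_ne hl.symm, Pi.single_eq_of_ne (Ne.symm hm),
        add_zero]
    · exact (hsum 1 h.pos).ge

theorem IsIteratedTransform.ordIsReesValuation_iff {A₀ A : LocalSubring K}
    {I₀ : Ideal A₀.toSubring} {w : Fin d → A.toSubring} {I : Ideal A.toSubring} {M : K}
    [IsNoetherianRing A.toSubring] (h : IsIteratedTransform A₀ I₀ A w I M) (hd : 3 ≤ d)
    (hw : IsQR w) (hK : ∀ z : K, ∃ f g : A.toSubring, g ≠ 0 ∧ z * g = f)
    (hI₀ : I₀ ≤ maximalIdeal A₀.toSubring) (hI : IsCompleteMonomial w I) {k k' : Fin d} {δ δ' : ℕ}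
    {E' E'' : Set (Fin d → ℕ)} (hδ : InverseStep k δ {a | monomialIn w a ∈ I} E')
    (hδ' : InverseStep k' δ' E' E'') : OrdIsReesValuation A A₀ I₀ ↔ k ≠ k' := by
  obtain ⟨l, hl⟩ : ∃ l : Fin d, l ∉ ({k, k'} : Finset (Fin d)) := by
    by_contra hcon
    push Not at hcon
    have h1 := Finset.card_le_card (fun l _ => hcon l : Finset.univ ⊆ ({k, k'} : Finset (Fin d)))
    rw [Finset.card_univ, Fintype.card_fin] at h1
    have := h1.trans Finset.card_le_two
    omega
  simp only [Finset.mem_insert, Finset.mem_singleton, not_or] at hl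
  have : Nontrivial (Fin d) := ⟨l, k, hl.1⟩
  constructor
  · rintro hR rfl
    obtain rfl := hδ.eq_of_eq hδ'
    exact h.not_ordIsReesValuation hw hl.1 (hI.le_leadingFormIdeal hw hδ hδ')
      (hδ.minimal_single hl.1) hR
  · intro hk
    exact h.ordIsReesValuation hw hK hI₀ (hI.le_pow hw hδ) l
      (hδ.exists_minimal_single_add_single hδ' hk hl.1 hl.2)

theorem isCompleteMonomial_of_isPrimary {A : Type*} [CommRing A] [IsLocalRing A]
    [IsNoetherianRing A] {w : Fin d → A} {I : Ideal A} (hmonomial : IsMonomialIdeal w I)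
    (hcomplete : idealClosure I = I) (hprimary : I.IsPrimary ∧ I.radical = maximalIdeal A) :
    IsCompleteMonomial w I where
  eq_span := by
    obtain ⟨E, hE⟩ := hmonomial
    apply le_antisymm
    · conv_lhs => rw [hE]
      refine Ideal.span_mono (Set.image_mono fun a ha => ?_)
      change monomialIn w a ∈ I
      rw [hE]
      exact Ideal.subset_span ⟨a, ha, rfl⟩
    · rw [Ideal.span_le]
      rintro _ ⟨a, ha, rfl⟩
      exact ha
  complete f hf := by
    rw [← hcomplete]
    exact hf
  pow_le := Ideal.exists_pow_le_of_le_radical_of_fg hprimary.2.ge (IsNoetherian.noetherian _)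
  ne_top := hprimary.1.ne_top

/-- Change of direction, decrease of the number of generators, additivity of orders and being a Rees
valuation, expressed by the directions of the transforms. -/
theorem monomialTransforms_iff_dir_ne (n : ℕ) (hd : 3 ≤ d)
    (R : ℕ → LocalSubring K) (w : ∀ i, Fin d → (R i).toSubring) (dir : ℕ → Fin d)
    (hfrac : IsFractionRing (R 0).toSubring K)
    (hreg : IsRegularLocalRing (R 0).toSubring)
    (hdim : ringKrullDim (R 0).toSubring = d)
    (hparam : Ideal.span (Set.range (w 0)) = maximalIdeal (R 0).toSubring)
    (hstep : ∀ i < n, IsMonomialTransform (R i) (w i) (dir i) (R (i + 1)) (w (i + 1)))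
    (I : ∀ i, Ideal (R i).toSubring)
    (hmonomial : IsMonomialIdeal (w n) (I n))
    (hcomplete : idealClosure (I n) = I n)
    (hprimary : (I n).IsPrimary ∧ (I n).radical = maximalIdeal (R n).toSubring)
    (hI : ∀ i < n, I i =
      completeInverseTransform (R i) (w i) (dir i) (R (i + 1)) (w (i + 1)) (I (i + 1))) :
    (∀ i, i + 2 ≤ n → (ChangeOfDirection (R i) (R (i + 2)) ↔ dir i ≠ dir (i + 1))) ∧
    (∀ i, i + 2 ≤ n → ((I i).spanFinrank > (I (i + 1)).spanFinrank ↔ dir i ≠ dir (i + 1))) ∧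
    (∀ i, i + 3 ≤ n → (idealOrd (I i) = idealOrd (I (i + 1)) + idealOrd (I (i + 2)) ↔
      dir i ≠ dir (i + 1) ∧ dir (i + 1) ≠ dir (i + 2))) ∧
    (∀ i, i + 2 ≤ n → (OrdIsReesValuation (R i) (R 0) (I 0) ↔ dir i ≠ dir (i + 1))) := by
  have : Nontrivial (Fin d) := Fin.nontrivial_iff_two_le.2 (by omega)
  have hqr : ∀ i ≤ n, IsNoetherianRing (R i).toSubring ∧ IsQR (w i) := by
    intro i
    induction i with
    | zero =>
      intro _
      have hN : IsNoetherianRing (R 0).toSubring := inferInstance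
      exact ⟨hN, isQR_of_span_range_eq_maximalIdeal d _ (w 0) hparam hdim.ge⟩
    | succ i ih =>
      intro hi
      obtain ⟨h1, h2⟩ := ih (by omega)
      exact ⟨(hstep i hi).isNoetherianRing h2, (hstep i hi).isQR h2⟩
  have hcm : ∀ m i, i + m = n → IsCompleteMonomial (w i) (I i) := by
    intro m
    induction m with
    | zero =>
      intro i hi
      obtain rfl : i = n := hi
      have := (hqr i le_rfl).1
      exact isCompleteMonomial_of_isPrimary hmonomial hcomplete hprimary
    | succ m ih =>
      intro i hi
      have := (hqr i (by omega)).1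
      exact ((hstep i (by omega)).inverseStep (hqr i (by omega)).2 (ih (i + 1) (by omega))
        (hI i (by omega))).1
  have hcm' : ∀ i ≤ n, IsCompleteMonomial (w i) (I i) := fun i hi => hcm (n - i) i (by omega)
  have hδ : ∀ i, ∃ δ : ℕ, i < n → InverseStep (dir i) δ {a | monomialIn (w i) a ∈ I i}
      {a | monomialIn (w (i + 1)) a ∈ I (i + 1)} ∧ ∀ f : (R i).toSubring, f ∈ I i ↔
        ∃ g ∈ I (i + 1), (f : K) = (w i (dir i) : K) ^ δ * g := by
    intro i
    by_cases hi : i < n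
    · have := (hqr i hi.le).1
      obtain ⟨-, δ, h⟩ := (hstep i hi).inverseStep (hqr i hi.le).2 (hcm' (i + 1) hi) (hI i hi)
      exact ⟨δ, fun _ => h⟩
    · exact ⟨0, fun h => absurd h hi⟩
  choose δ hδ using hδ
  have hit : ∀ i ≤ n, ∃ M, IsIteratedTransform (R 0) (I 0) (R i) (w i) (I i) M := by
    intro i
    induction i with
    | zero => exact fun _ => ⟨1, .refl _ _ _ (dir 0)⟩
    | succ i ih =>
      intro hi
      obtain ⟨M, hM⟩ := ih (by omega)
      exact ⟨_, hM.step (hstep i hi) (hqr i (by omega)).2 (hδ i hi).1 (hδ i hi).2⟩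
  have hord : ∀ i < n, idealOrd (I i) = δ i := fun i hi =>
    (hcm' i hi.le).idealOrd_eq (hqr i hi.le).2 (hδ i hi).1
  have hμ : ∀ i < n, (I i).spanFinrank = {a : Fin d → ℕ | ∑ l, a l = δ i}.ncard := by
    intro i hi
    have := (hqr i hi.le).1
    rw [(hqr i hi.le).2.spanFinrank_eq_ncard (hcm' i hi.le).eq_span, (hδ i hi).1.ncard_minimal]
  refine ⟨fun i hi => ?_, fun i hi => ?_, fun i hi => ?_, fun i hi => ?_⟩
  · have := (hqr i (by omega)).1
    exact (hstep i (by omega)).changeOfDirection_iff (hstep (i + 1) (by omega))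
      (hqr i (by omega)).2
  · rw [hμ i (by omega), hμ (i + 1) (by omega),
      ← (hδ i (by omega)).1.lt_iff_ne (hδ (i + 1) (by omega)).1]
    exact ncard_sum_eq_strictMono.lt_iff_lt
  · rw [hord i (by omega), hord (i + 1) (by omega), hord (i + 2) (by omega),
      ← (hδ i (by omega)).1.eq_add_iff (hδ (i + 1) (by omega)).1 (hδ (i + 2) (by omega)).1]
    norm_cast
  · obtain ⟨M, hM⟩ := hit i (by omega)
    have := (hqr i (by omega)).1
    refine hM.ordIsReesValuation_iff hd (hqr i (by omega)).2 (fun z => ?_)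
      (le_maximalIdeal (hcm' 0 (by omega)).ne_top) (hcm' i (by omega)) (hδ i (by omega)).1
      (hδ (i + 1) (by omega)).1
    obtain ⟨f, g, hg, rfl⟩ := IsFractionRing.div_surjective (A := (R 0).toSubring) z
    have hg0 : (g : K) ≠ 0 := fun h0 => nonZeroDivisors.ne_zero hg (Subtype.ext h0)
    refine ⟨Subring.inclusion hM.le f, Subring.inclusion hM.le g,
      fun h0 => hg0 (congrArg Subtype.val h0), ?_⟩
    exact div_mul_cancel₀ (f : K) hg0

end Main
theorem mainTheorem9 {K : Type*} [Field K] (d n : ℕ) (hd : 3 ≤ d) (hn : 3 ≤ n)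
    -- the sequence of local rings inside the common field of fractions, with their parameters
    (R : ℕ → LocalSubring K) (w : ∀ i, Fin d → (R i).toSubring) (dir : ℕ → Fin d)
    (hfrac : IsFractionRing (R 0).toSubring K)
    (hreg : IsRegularLocalRing (R 0).toSubring)
    (hdim : ringKrullDim (R 0).toSubring = d)
    (hequi : IsEquicharacteristic (R 0).toSubring)
    (hparam : Ideal.span (Set.range (w 0)) = maximalIdeal (R 0).toSubring)
    (hstep : ∀ i < n, IsMonomialTransform (R i) (w i) (dir i) (R (i + 1)) (w (i + 1)))
    -- the complete monomial primary ideal of the last ring and its iterated inverse transforms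
    (I : ∀ i, Ideal (R i).toSubring)
    (hmonomial : IsMonomialIdeal (w n) (I n))
    (hcomplete : idealClosure (I n) = I n)
    (hprimary : (I n).IsPrimary ∧ (I n).radical = maximalIdeal (R n).toSubring)
    (hI : ∀ i < n, I i =
      completeInverseTransform (R i) (w i) (dir i) (R (i + 1)) (w (i + 1)) (I (i + 1))) :
    (n = 3 → List.TFAE [
      ChangeOfDirection (R 0) (R 2) ∧ ChangeOfDirection (R 1) (R 3),
      (I 0).spanFinrank > (I 1).spanFinrank ∧ (I 1).spanFinrank > (I 2).spanFinrank,
      idealOrd (I 0) = idealOrd (I 1) + idealOrd (I 2),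
      OrdIsReesValuation (R 0) (R 0) (I 0) ∧ OrdIsReesValuation (R 1) (R 0) (I 0)]) ∧
    List.TFAE [
      ∀ i, i + 2 ≤ n → ChangeOfDirection (R i) (R (i + 2)),
      ∀ i, i + 2 ≤ n → (I i).spanFinrank > (I (i + 1)).spanFinrank,
      ∀ i, i + 3 ≤ n → idealOrd (I i) = idealOrd (I (i + 1)) + idealOrd (I (i + 2)),
      ∀ i, i + 2 ≤ n → OrdIsReesValuation (R i) (R 0) (I 0)] := by
  obtain ⟨h1, h2, h3, h4⟩ := monomialTransforms_iff_dir_ne n hd R w dir hfrac hreg hdim hparam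
    hstep I hmonomial hcomplete hprimary hI
  constructor
  · rintro rfl
    rw [h1 0 (by omega), h1 1 (by omega), h2 0 (by omega), h2 1 (by omega), h3 0 (by omega),
      h4 0 (by omega), h4 1 (by omega)]
    tfae_finish
  · have e1 : (∀ i, i + 2 ≤ n → ChangeOfDirection (R i) (R (i + 2))) ↔
        ∀ i, i + 2 ≤ n → dir i ≠ dir (i + 1) := forall₂_congr h1
    have e2 : (∀ i, i + 2 ≤ n → (I i).spanFinrank > (I (i + 1)).spanFinrank) ↔
        ∀ i, i + 2 ≤ n → dir i ≠ dir (i + 1) := forall₂_congr h2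
    have e3 : (∀ i, i + 3 ≤ n → idealOrd (I i) = idealOrd (I (i + 1)) + idealOrd (I (i + 2))) ↔
        ∀ i, i + 2 ≤ n → dir i ≠ dir (i + 1) := by
      rw [forall₂_congr h3]
      refine ⟨fun h i hi => ?_, fun h i hi => ⟨h i (by omega), h (i + 1) (by omega)⟩⟩
      by_cases hi' : i + 3 ≤ n
      · exact (h i hi').1
      · obtain ⟨j, rfl⟩ : ∃ j, i = j + 1 := ⟨i - 1, by omega⟩
        exact (h j (by omega)).2
    have e4 : (∀ i, i + 2 ≤ n → OrdIsReesValuation (R i) (R 0) (I 0)) ↔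
        ∀ i, i + 2 ≤ n → dir i ≠ dir (i + 1) := forall₂_congr h4
    rw [e1, e2, e3, e4]
    tfae_finish
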